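/- Theorem 3 (concluding remarks, Abelian groups of smooth order). There is an exact quantum algorithm for the following problem. Given: a decomposition of a finite Abelian group $G\cong\mathbb Z_{M_1}\times\dots\times\mathbb Z_{M_k}$ ($M_i\ge 2$) of order $m$, through which elements are written as $g=(g_1,\dots,g_k)$ with $0\le g_i<M_i$; an integer $r>1$; and the reversible evaluation $|x\rangle|y\rangle\mapsto|x\rangle|y\oplus f(x)\rangle$ of a function $f:G\to\{0,\dots,r-1\}$. Promise: there is an (unknown) subgroup $H\le G$ of index $r$ such that $f$ is constant on each coset of $H$ and takes distinct values on distinct cosets. Output: with probability exactly $1$, a nonzero element of $H^\perp=\{g\in G : \prod_{i=1}^k e^{2\pi i\, g_ih_i/M_i}=1 \text{ for all } h\in H\}$. If the order of $G$ is smooth, the algorithm runs in time polynomial in $\log m$ and in the time to compute $f$. That is, for every polynomial $s$ there is a polynomial $\tau$ in two variables such that, whenever every prime factor of $m$ is at most $s(\log_2 m)$ (logarithm rounded down) and each evaluation of $f$ is charged time $T$, the algorithm halts after at most $\tau(\log_2 m,T)$ time units. Here a quantum algorithm is a single program, the same for all inputs, for a random access machine at logarithmic cost that, besides classical instructions, performs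 elementary quantum gates (one- and two-qubit negations, phase shifts by $2\pi a/b$ and real rotations with squared cosine $a/(a+b)$ for integers $a,b$ that the program computes, plus Toffoli gates) and evaluations of $f$ on qubits that are all initially $|0\rangle$; the qubits are measured at the end. -/

import Mathlib

namespace QAlg

/-! ## Elementary quantum gates, states and circuits -/

/-- Elementary quantum gates, with operands (wire numbers and gate parameters) of type `α`.
`phase a b t` is `diag(1, exp(2πi·a/b))` on wire `t`; `rot a b t` is the real rotation of wire `t`
by the angle whose squared cosine is `a/(a+b)`; `cphase` and `crot` are their versions controlled
by the wire `c`; `query x y` evaluates the function, reading its argument from the wires starting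
at `x` and adding its value bitwise modulo 2 to the wires starting at `y`. -/
inductive Gate (α : Type) : Type
  | not (t : α)
  | cnot (c t : α)
  | ccnot (c d t : α)
  | phase (a b t : α)
  | cphase (a b c t : α)
  | rot (a b t : α)
  | crot (a b c t : α)
  | query (x y : α)

/-- The list of operands of a gate. -/
def Gate.operands {α : Type} : Gate α → List α
  | .not t => [t]
  | .cnot c t => [c, t]
  | .ccnot c d t => [c, d, t]
  | .phase a b t => [a, b, t]
  | .cphase a b c t => [a, b, c, t]
  | .rot a b t => [a, b, t]
  | .crot a b c t => [a, b, c, t]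
  | .query x y => [x, y]

/-- Apply a function to all operands of a gate. -/
def Gate.map {α β : Type} (φ : α → β) : Gate α → Gate β
  | .not t => .not (φ t)
  | .cnot c t => .cnot (φ c) (φ t)
  | .ccnot c d t => .ccnot (φ c) (φ d) (φ t)
  | .phase a b t => .phase (φ a) (φ b) (φ t)
  | .cphase a b c t => .cphase (φ a) (φ b) (φ c) (φ t)
  | .rot a b t => .rot (φ a) (φ b) (φ t)
  | .crot a b c t => .crot (φ a) (φ b) (φ c) (φ t)
  | .query x y => .query (φ x) (φ y)

/-- The time charged for performing a gate: one unit, except that an evaluation of the function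
costs `T` more. -/
def Gate.cost {α : Type} (T : ℕ) : Gate α → ℕ
  | .query _ _ => 1 + T
  | _ => 1

/-- A classical configuration of the wires `0, 1, 2, …`. -/
abbrev Config : Type := ℕ → Bool

/-- A (finite) superposition of configurations. -/
abbrev QState : Type := Config →₀ ℂ

/-- The negation matrix. -/
def notMatrix : Matrix Bool Bool ℂ :=
  fun v w => if v = w then 0 else 1

/-- `diag(1, exp(2πi·a/b))`. -/
noncomputable def phaseMatrix (a b : ℕ) : Matrix Bool Bool ℂ :=
  fun v w => if v = w then
    (if w then Complex.exp (2 * Real.pi * Complex.I * ((a : ℂ) / (b : ℂ))) else 1) else 0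

/-- The rotation `!![√p, -√(1-p); √(1-p), √p]` with `p = a/(a+b)` (rows and columns in the
order `false`, `true`). -/
noncomputable def rotMatrix (a b : ℕ) : Matrix Bool Bool ℂ :=
  fun v w =>
    let p : ℝ := (a : ℝ) / ((a : ℝ) + (b : ℝ))
    if v = w then ((Real.sqrt p : ℝ) : ℂ)
    else if w then -((Real.sqrt (1 - p) : ℝ) : ℂ) else ((Real.sqrt (1 - p) : ℝ) : ℂ)

/-- The image of a basis state under the one-qubit matrix `U` on wire `t`, controlled by the wires
in `cs` (the identity if `t` is among its own controls). -/
noncomputable def ctrlBasis (cs : List ℕ) (t : ℕ) (U : Matrix Bool Bool ℂ) (b : Config) : QState :=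
  if t ∉ cs ∧ (∀ c ∈ cs, b c = true) then
    ∑ v : Bool, Finsupp.single (Function.update b t v) (U v (b t))
  else Finsupp.single b 1

/-- The number written in binary, least significant bit first, on the `L` wires from `a` on. -/
def readField (L : ℕ) (b : Config) (a : ℕ) : ℕ :=
  ∑ l ∈ Finset.range L, if b (a + l) then 2 ^ l else 0

/-- The image of the configuration `b` under `|x⟩|y⟩ ↦ |x⟩|y ⊕ F(x)⟩`, where `x` is a `k`-tuple of
`L`-bit numbers on the wires from `x₀` on and `y` is an `L`-bit number on the wires from `y₀` on
(the identity if the two blocks of wires overlap). -/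
def queryConfig {k : ℕ} (L : ℕ) (F : (Fin k → ℕ) → ℕ) (x₀ y₀ : ℕ) (b : Config) : Config :=
  if x₀ + k * L ≤ y₀ ∨ y₀ + L ≤ x₀ then
    fun w =>
      if y₀ ≤ w ∧ w < y₀ + L then
        xor (b w) ((F fun i => readField L b (x₀ + i * L)).testBit (w - y₀))
      else b w
  else b

/-- The image of a basis state under a gate. -/
noncomputable def Gate.onBasis {k : ℕ} (L : ℕ) (F : (Fin k → ℕ) → ℕ) : Gate ℕ → Config → QState
  | .not t, b => ctrlBasis [] t notMatrix b
  | .cnot c t, b => ctrlBasis [c] t notMatrix b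
  | .ccnot c d t, b => ctrlBasis [c, d] t notMatrix b
  | .phase a a' t, b => ctrlBasis [] t (phaseMatrix a a') b
  | .cphase a a' c t, b => ctrlBasis [c] t (phaseMatrix a a') b
  | .rot a a' t, b => ctrlBasis [] t (rotMatrix a a') b
  | .crot a a' c t, b => ctrlBasis [c] t (rotMatrix a a') b
  | .query x y, b => Finsupp.single (queryConfig L F x y b) 1

/-- The linear operator performed by a gate. -/
noncomputable def Gate.op {k : ℕ} (L : ℕ) (F : (Fin k → ℕ) → ℕ) (g : Gate ℕ) :
    QState →ₗ[ℂ] QState :=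
  Finsupp.linearCombination ℂ (g.onBasis L F)

/-- The state after the gates of `gs` have been performed in order, starting from `|00…⟩`. -/
noncomputable def finalState {k : ℕ} (L : ℕ) (F : (Fin k → ℕ) → ℕ) (gs : List (Gate ℕ)) : QState :=
  gs.foldl (fun ψ g => g.op L F ψ) (Finsupp.single (fun _ => false) 1)

open Classical in
/-- The probability that measuring all wires of `ψ` yields a configuration in `S`. -/
noncomputable def prob (ψ : QState) (S : Set Config) : ℝ :=
  ∑ b ∈ ψ.support.filter (fun b => b ∈ S), ‖ψ b‖ ^ 2

/-! ## Programs: a random access machine at logarithmic cost that performs quantum gates -/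

/-- The memory of the machine: cells `0, 1, 2, …` holding natural numbers. -/
abbrev Mem : Type := ℕ → ℕ

/-- Arithmetic expressions; `load a` is the content of the cell with address `a`. -/
inductive Expr : Type
  | lit (n : ℕ)
  | load (addr : Expr)
  | add (a b : Expr)
  | sub (a b : Expr)
  | mul (a b : Expr)
  | div (a b : Expr)
  | mod (a b : Expr)

/-- The value of an expression (with truncated subtraction and integer division). -/
def Expr.eval (σ : Mem) : Expr → ℕ
  | .lit n => n
  | .load a => σ (a.eval σ)
  | .add a b => a.eval σ + b.eval σ
  | .sub a b => a.eval σ - b.eval σ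
  | .mul a b => a.eval σ * b.eval σ
  | .div a b => a.eval σ / b.eval σ
  | .mod a b => a.eval σ % b.eval σ

/-- The time to evaluate an expression: every intermediate value is charged its bit length. -/
def Expr.cost (σ : Mem) : Expr → ℕ
  | .lit n => 1 + Nat.size n
  | .load a => a.cost σ + (1 + Nat.size (σ (a.eval σ)))
  | .add a b => a.cost σ + b.cost σ + (1 + Nat.size (a.eval σ + b.eval σ))
  | .sub a b => a.cost σ + b.cost σ + (1 + Nat.size (a.eval σ - b.eval σ))
  | .mul a b => a.cost σ + b.cost σ + (1 + Nat.size (a.eval σ * b.eval σ))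
  | .div a b => a.cost σ + b.cost σ + (1 + Nat.size (a.eval σ / b.eval σ))
  | .mod a b => a.cost σ + b.cost σ + (1 + Nat.size (a.eval σ % b.eval σ))

/-- Programs. `store a v` writes the value of `v` to the cell with address `a`; `ite` and `loop`
test whether the condition is nonzero; `gate g` performs the gate `g` on the wires, and with the
parameters, given by the values of the operands. -/
inductive Prog : Type
  | skip
  | store (addr val : Expr)
  | seq (p q : Prog)
  | ite (cond : Expr) (p q : Prog)
  | loop (cond : Expr) (body : Prog)
  | gate (g : Gate Expr)

/-- `Exec T p σ σ' gs t`: if an evaluation of the function costs `T`, the program `p` started in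
memory `σ` halts in memory `σ'` after `t` time units, having performed the gates `gs`. -/
inductive Exec (T : ℕ) : Prog → Mem → Mem → List (Gate ℕ) → ℕ → Prop
  | skip (σ : Mem) : Exec T .skip σ σ [] 1
  | store (σ : Mem) (a v : Expr) :
      Exec T (.store a v) σ (Function.update σ (a.eval σ) (v.eval σ)) [] (1 + a.cost σ + v.cost σ)
  | seq {p q : Prog} {σ σ' σ'' : Mem} {gs gs' : List (Gate ℕ)} {t t' : ℕ}
      (hp : Exec T p σ σ' gs t) (hq : Exec T q σ' σ'' gs' t') :
      Exec T (.seq p q) σ σ'' (gs ++ gs') (t + t')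
  | iteTrue {e : Expr} {p q : Prog} {σ σ' : Mem} {gs : List (Gate ℕ)} {t : ℕ}
      (he : e.eval σ ≠ 0) (hp : Exec T p σ σ' gs t) :
      Exec T (.ite e p q) σ σ' gs (1 + e.cost σ + t)
  | iteFalse {e : Expr} {p q : Prog} {σ σ' : Mem} {gs : List (Gate ℕ)} {t : ℕ}
      (he : e.eval σ = 0) (hq : Exec T q σ σ' gs t) :
      Exec T (.ite e p q) σ σ' gs (1 + e.cost σ + t)
  | loopDone {e : Expr} {p : Prog} {σ : Mem} (he : e.eval σ = 0) :
      Exec T (.loop e p) σ σ [] (1 + e.cost σ)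
  | loopStep {e : Expr} {p : Prog} {σ σ' σ'' : Mem} {gs gs' : List (Gate ℕ)} {t t' : ℕ}
      (he : e.eval σ ≠ 0) (hp : Exec T p σ σ' gs t) (hl : Exec T (.loop e p) σ' σ'' gs' t') :
      Exec T (.loop e p) σ σ'' (gs ++ gs') (1 + e.cost σ + t + t')
  | gate (σ : Mem) (g : Gate Expr) :
      Exec T (.gate g) σ σ [g.map (fun e => e.eval σ)]
        (g.cost T + (g.operands.map (fun e => e.cost σ)).sum)

/-! ## The problem -/

/-- The input: the number `k` of cyclic factors, the index `r`, and the orders of the factors. -/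
def inputMem {k : ℕ} (M : Fin k → ℕ) (r : ℕ) : Mem
  | 0 => k
  | 1 => r
  | j + 2 => if h : j < k then M ⟨j, h⟩ else 0

/-- The number of bits used for each coordinate of a group element and for each function value:
the bit length of the order of the group. -/
def width {k : ℕ} (M : Fin k → ℕ) : ℕ := Nat.size (∏ i, M i)

/-- The coordinates of `g`, as natural numbers `0 ≤ gᵢ < Mᵢ`. -/
def coords {G : Type*} [AddCommGroup G] {k : ℕ} {M : Fin k → ℕ}
    (e : G ≃+ ((i : Fin k) → ZMod (M i))) (g : G) : Fin k → ℕ :=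
  fun i => (e g i).val

/-- The pairing `(g, h) ↦ ∏ᵢ exp(2πi gᵢ hᵢ / Mᵢ)` on a group decomposed into cyclic groups. -/
noncomputable def pairing {G : Type*} [AddCommGroup G] {k : ℕ} {M : Fin k → ℕ}
    [∀ i, NeZero (M i)] (e : G ≃+ ((i : Fin k) → ZMod (M i))) (g h : G) : ℂ :=
  ∏ i, ZMod.stdAddChar (e g i * e h i)

/-- The orthogonal subgroup of `H`: the `g` that pair to `1` with every element of `H`. -/
noncomputable def orthogonal {G : Type*} [AddCommGroup G] {k : ℕ} {M : Fin k → ℕ}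
    [∀ i, NeZero (M i)] (e : G ≃+ ((i : Fin k) → ZMod (M i))) (H : AddSubgroup G) :
    AddSubgroup G where
  carrier := {g | ∀ h ∈ H, pairing e g h = 1}
  zero_mem' := by
    intro h _
    simp [pairing]
  add_mem' := by
    intro a b ha hb h hh
    have h1 := ha h hh
    have h2 := hb h hh
    simp only [pairing] at h1 h2 ⊢
    simp only [map_add, Pi.add_apply, add_mul, AddChar.map_add_eq_mul, Finset.prod_mul_distrib,
      h1, h2, one_mul]
  neg_mem' := by
    intro a ha h hh
    have h1 := ha h hh
    simp only [pairing] at h1 ⊢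
    simp only [map_neg, Pi.neg_apply, neg_mul, AddChar.map_neg_eq_inv, Finset.prod_inv_distrib,
      h1, inv_one]

/-- The measured configurations whose first `k` fields are the coordinates of a nonzero element of
the orthogonal subgroup of `H`. -/
def correctOutputs {G : Type*} [AddCommGroup G] {k : ℕ} {M : Fin k → ℕ}
    [∀ i, NeZero (M i)] (e : G ≃+ ((i : Fin k) → ZMod (M i))) (H : AddSubgroup G) : Set Config :=
  {b | ∃ z ∈ orthogonal e H, z ≠ 0 ∧
    ∀ i : Fin k, readField (width M) b (i * width M) = coords e z i}

/-- `m` is smooth with respect to the polynomial `s`: its prime factors are at most `s(log₂ m)`. -/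
def IsSmooth (s : Polynomial ℕ) (m : ℕ) : Prop :=
  ∀ p : ℕ, p.Prime → p ∣ m → p ≤ s.eval (Nat.log 2 m)

end QAlg

namespace QAlg

/-! ## Bounding the running time by the number of steps -/

/-! Write the elements of the group in a mixed radix system whose radices come from trial division
of the orders of the cyclic factors. Smoothness bounds every radix, so a digit can be stored in a
one-hot register, with one wire for each of its values, and all constructions on a digit may take
time polynomial in its radix.

Sampling. Prepare the uniform superposition of all elements (`op_prepare`), evaluate the function
into a clean register (`op_oracle`) and apply the exact Fourier transform of the group
(`op_fourier`). By `fourierAmp_eq` the amplitudes are characters divided by the order of the group.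
The part of the state with output digits `d` is therefore a character sum (`branch_eq`). It vanishes
unless `d` represents an element of the orthogonal subgroup, because a translation by an element of
`H` multiplies the sum by a nontrivial root of unity (`branch_eq_zero`). The part with output zero
has squared norm exactly `1 / r` (`inner_branch_zero_zero`).

Amplification. Since `r` is given, the probability `1 - 1 / r` of a nonzero output is known exactly.
A flag qubit is rotated so that it equals one with probability `r / (4 (r - 1))`. The good event,
nonzero output and flag one, then has probability exactly `1 / 4`, and for this value a single step
of amplitude amplification leaves only the good part, up to the factor `-2` (`op_algorithm`). Every
configuration that survives carries a nonzero element of the orthogonal subgroup, and the norm is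
one by unitarity (`prob_algorithm`).

Exact Fourier transform. Input and output use the same radices with weights in opposite orders
(`Splitting`). The phase between output digit `l` and input digit `j` of the same coordinate is
trivial for `j < l`, so the digits can be transformed one after the other
(`prod_phaseFactor_digit`). For a single digit, Givens rotations make a uniform superposition on a
second one-hot register and phases turn it into a Fourier state. The old digit is then erased
exactly, using that different Fourier states are orthogonal (`op_erase`).

Running time. Circuits are described by a small language with loops and inverses. They are compiled
to programs (`Circ.exec`), and the inverse of a circuit is obtained by reversing it
(`Circ.inversePair`). Steps are counted first and converted into logarithmic cost afterwards
(`ExecN.exec`). Since the program text is fixed, bounds on the loops and on the bit lengths give a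
polynomial bound (`Circ.count_le`, `exec_program`). -/

/-- A bound for the bit length of the value of an expression, in units of `B + 1`, when all memory
cells are below `2 ^ B`. -/
def Expr.bitWeight : Expr → ℕ
  | .lit n => Nat.size n
  | .load _ => 1
  | .add a b => a.bitWeight + b.bitWeight + 1
  | .sub a _ => a.bitWeight
  | .mul a b => a.bitWeight + b.bitWeight
  | .div a _ => a.bitWeight
  | .mod a _ => a.bitWeight

/-- A bound for the cost of an expression, in units of `B + 1`, when all memory cells are below
`2 ^ B`. -/
def Expr.weight : Expr → ℕ
  | .lit n => 1 + Nat.size n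
  | .load a => a.weight + 2
  | .add a b => a.weight + b.weight + (1 + (Expr.add a b).bitWeight)
  | .sub a b => a.weight + b.weight + (1 + (Expr.sub a b).bitWeight)
  | .mul a b => a.weight + b.weight + (1 + (Expr.mul a b).bitWeight)
  | .div a b => a.weight + b.weight + (1 + (Expr.div a b).bitWeight)
  | .mod a b => a.weight + b.weight + (1 + (Expr.mod a b).bitWeight)

/-- Sums add one unit for the carry and products add bit lengths, while differences, quotients and
remainders do not exceed their first argument. The unit is `B + 1` and not `B`, so that literals and
carries are covered even when `B = 0`. -/
theorem Expr.size_eval_le {B : ℕ} {σ : Mem} (h : ∀ x, σ x < 2 ^ B) (e : Expr) :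
    Nat.size (e.eval σ) ≤ e.bitWeight * (B + 1) := by
  induction e with
  | lit n => simp only [eval, bitWeight]; nlinarith [Nat.zero_le (n.size * B)]
  | load a _ =>
    simp only [eval, bitWeight]
    have := Nat.size_le.2 (h (a.eval σ))
    omega
  | add a b iha ihb =>
    simp only [eval, bitWeight]
    rw [Nat.size_le] at *
    have h1 : (2:ℕ) ^ (a.bitWeight * (B + 1)) ≤ 2 ^ (a.bitWeight * (B + 1) + b.bitWeight * (B + 1)) :=
      Nat.pow_le_pow_right (by norm_num) (by omega)
    have h2 : (2:ℕ) ^ (b.bitWeight * (B + 1)) ≤ 2 ^ (a.bitWeight * (B + 1) + b.bitWeight * (B + 1)) :=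
      Nat.pow_le_pow_right (by norm_num) (by omega)
    calc a.eval σ + b.eval σ < 2 ^ (a.bitWeight * (B + 1) + b.bitWeight * (B + 1) + 1) := by
          rw [pow_succ]; omega
      _ ≤ _ := Nat.pow_le_pow_right (by norm_num) (by nlinarith)
  | sub a b iha ihb =>
    simp only [eval, bitWeight]
    exact (Nat.size_le_size (Nat.sub_le _ _)).trans iha
  | mul a b iha ihb =>
    simp only [eval, bitWeight]
    rw [Nat.size_le] at *
    rw [add_mul, pow_add]
    exact Nat.mul_lt_mul'' iha ihb
  | div a b iha ihb =>
    simp only [eval, bitWeight]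
    exact (Nat.size_le_size (Nat.div_le_self _ _)).trans iha
  | mod a b iha ihb =>
    simp only [eval, bitWeight]
    exact (Nat.size_le_size (Nat.mod_le _ _)).trans iha

theorem Expr.cost_le {B : ℕ} {σ : Mem} (h : ∀ x, σ x < 2 ^ B) (e : Expr) :
    e.cost σ ≤ e.weight * (B + 1) := by
  induction e with
  | lit n => simp only [cost, weight]; nlinarith [Nat.zero_le (n.size * B)]
  | load a ih =>
    have := Nat.size_le.2 (h (a.eval σ))
    simp only [cost, weight]; nlinarith
  | add a b iha ihb =>
    have := (Expr.add a b).size_eval_le h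
    simp only [cost, weight, eval] at *; nlinarith
  | sub a b iha ihb =>
    have := (Expr.sub a b).size_eval_le h
    simp only [cost, weight, eval] at *; nlinarith
  | mul a b iha ihb =>
    have := (Expr.mul a b).size_eval_le h
    simp only [cost, weight, eval] at *; nlinarith
  | div a b iha ihb =>
    have := (Expr.div a b).size_eval_le h
    simp only [cost, weight, eval] at *; nlinarith
  | mod a b iha ihb =>
    have := (Expr.mod a b).size_eval_le h
    simp only [cost, weight, eval] at *; nlinarith

/-- A bound for the cost of a single step of a program, in units of `B + 1`. -/
def Prog.weight : Prog → ℕ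
  | .skip => 1
  | .store a v => 1 + a.weight + v.weight
  | .seq p q => p.weight + q.weight
  | .ite e p q => 1 + e.weight + p.weight + q.weight
  | .loop e p => 1 + e.weight + p.weight
  | .gate g => 1 + (g.operands.map Expr.weight).sum

/-- `ExecN B p σ σ' gs s`: the program `p` started in `σ` halts in `σ'` after `s` steps, having
performed the gates `gs` and stored only values below `2 ^ B`. -/
inductive ExecN (B : ℕ) : Prog → Mem → Mem → List (Gate ℕ) → ℕ → Prop
  | store (σ : Mem) (a v : Expr) (h : v.eval σ < 2 ^ B) :
      ExecN B (.store a v) σ (Function.update σ (a.eval σ) (v.eval σ)) [] 1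
  | seq {p q : Prog} {σ σ' σ'' : Mem} {gs gs' : List (Gate ℕ)} {s s' : ℕ}
      (hp : ExecN B p σ σ' gs s) (hq : ExecN B q σ' σ'' gs' s') :
      ExecN B (.seq p q) σ σ'' (gs ++ gs') (s + s')
  | iteTrue {e : Expr} {p q : Prog} {σ σ' : Mem} {gs : List (Gate ℕ)} {s : ℕ}
      (he : e.eval σ ≠ 0) (hp : ExecN B p σ σ' gs s) :
      ExecN B (.ite e p q) σ σ' gs (1 + s)
  | iteFalse {e : Expr} {p q : Prog} {σ σ' : Mem} {gs : List (Gate ℕ)} {s : ℕ}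
      (he : e.eval σ = 0) (hq : ExecN B q σ σ' gs s) :
      ExecN B (.ite e p q) σ σ' gs (1 + s)
  | loopDone {e : Expr} {p : Prog} {σ : Mem} (he : e.eval σ = 0) :
      ExecN B (.loop e p) σ σ [] 1
  | loopStep {e : Expr} {p : Prog} {σ σ' σ'' : Mem} {gs gs' : List (Gate ℕ)} {s s' : ℕ}
      (he : e.eval σ ≠ 0) (hp : ExecN B p σ σ' gs s) (hl : ExecN B (.loop e p) σ' σ'' gs' s') :
      ExecN B (.loop e p) σ σ'' (gs ++ gs') (1 + s + s')
  | gate (σ : Mem) (g : Gate Expr) :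
      ExecN B (.gate g) σ σ [g.map (fun e => e.eval σ)] 1

theorem Gate.cost_le {α : Type} (T : ℕ) (g : Gate α) : g.cost T ≤ 1 + T := by
  cases g <;> simp [Gate.cost]

theorem sum_cost_le {B : ℕ} {σ : Mem} (h : ∀ x, σ x < 2 ^ B) (es : List Expr) :
    (es.map (fun e => e.cost σ)).sum ≤ (es.map Expr.weight).sum * (B + 1) := by
  induction es with
  | nil => simp
  | cons e es ih =>
    have := e.cost_le h
    simp only [List.map_cons, List.sum_cons, add_mul]
    omega

/-- The weight of a program dominates the weights of its parts, so one bound `U` serves for every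
single step, including all iterations of a loop. The bound on the memory has to be carried along in
the induction, since the cost of a step depends on the cells it reads. -/
theorem ExecN.exec {B T : ℕ} {p : Prog} {σ σ' : Mem} {gs : List (Gate ℕ)} {s : ℕ}
    (h : ExecN B p σ σ' gs s) (hσ : ∀ x, σ x < 2 ^ B) (U : ℕ)
    (hU : p.weight * (B + 1) + T ≤ U) :
    (∀ x, σ' x < 2 ^ B) ∧ ∃ t, Exec T p σ σ' gs t ∧ t ≤ s * U := by
  induction h with
  | store σ a v hv =>
    refine ⟨fun x => ?_, _, Exec.store σ a v, ?_⟩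
    · by_cases hx : x = a.eval σ
      · subst hx; simpa using hv
      · simpa [Function.update_of_ne hx] using hσ x
    · have h1 := a.cost_le hσ
      have h2 := v.cost_le hσ
      simp only [Prog.weight] at hU
      nlinarith
  | @seq p q σ σ' σ'' gs gs' s s' hp hq ihp ihq =>
    simp only [Prog.weight] at hU
    obtain ⟨h1, t, ht, hle⟩ := ihp hσ (by nlinarith)
    obtain ⟨h2, t', ht', hle'⟩ := ihq h1 (by nlinarith)
    exact ⟨h2, _, Exec.seq ht ht', by nlinarith⟩
  | @iteTrue e p q σ σ' gs s he hp ih =>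
    simp only [Prog.weight] at hU
    obtain ⟨h1, t, ht, hle⟩ := ih hσ (by nlinarith)
    have h2 := e.cost_le hσ
    exact ⟨h1, _, Exec.iteTrue he ht, by nlinarith⟩
  | @iteFalse e p q σ σ' gs s he hp ih =>
    simp only [Prog.weight] at hU
    obtain ⟨h1, t, ht, hle⟩ := ih hσ (by nlinarith)
    have h2 := e.cost_le hσ
    exact ⟨h1, _, Exec.iteFalse he ht, by nlinarith⟩
  | @loopDone e p σ he =>
    simp only [Prog.weight] at hU
    have h2 := e.cost_le hσ
    exact ⟨hσ, _, Exec.loopDone he, by nlinarith⟩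
  | @loopStep e p σ σ' σ'' gs gs' s s' he hp hl ihp ihl =>
    have hU' := hU
    simp only [Prog.weight] at hU'
    obtain ⟨h1, t, ht, hle⟩ := ihp hσ (by nlinarith)
    obtain ⟨h2, t', ht', hle'⟩ := ihl h1 hU
    have h3 := e.cost_le hσ
    exact ⟨h2, _, Exec.loopStep he ht ht', by nlinarith⟩
  | gate σ g =>
    refine ⟨hσ, _, Exec.gate σ g, ?_⟩
    have h1 := sum_cost_le hσ g.operands
    have h2 := g.cost_le T
    simp only [Prog.weight] at hU
    nlinarith

/-! ## Expressions over arrays -/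

/-- Expressions over the input cells, arrays and loop counters. -/
inductive HExpr : Type
  | lit (n : ℕ)
  | ctr (j : ℕ)
  | arr (a : ℕ) (i : HExpr)
  | inp (i : HExpr)
  | add (a b : HExpr)
  | sub (a b : HExpr)
  | mul (a b : HExpr)
  | div (a b : HExpr)
  | mod (a b : HExpr)

/-- The value of an expression, given the input `I`, the arrays `α` and the loop counters `ρ`. -/
def HExpr.eval (I : ℕ → ℕ) (α : ℕ → ℕ → ℕ) (ρ : ℕ → ℕ) : HExpr → ℕ
  | .lit n => n
  | .ctr j => ρ j
  | .arr a i => α a (i.eval I α ρ)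
  | .inp i => I (i.eval I α ρ)
  | .add a b => a.eval I α ρ + b.eval I α ρ
  | .sub a b => a.eval I α ρ - b.eval I α ρ
  | .mul a b => a.eval I α ρ * b.eval I α ρ
  | .div a b => a.eval I α ρ / b.eval I α ρ
  | .mod a b => a.eval I α ρ % b.eval I α ρ

/-- The address of entry `i` of array `a`; the arrays are interleaved behind the input. -/
def entryAddr (a : ℕ) (i : Expr) : Expr :=
  .add (.add (.load (.lit 0)) (.lit (2 + a))) (.mul (.lit 8) i)

/-- Translation into machine expressions; array `7` holds the loop counters. -/
def HExpr.compile : HExpr → Expr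
  | .lit n => .lit n
  | .ctr j => .load (entryAddr 7 (.lit j))
  | .arr a i => .load (entryAddr a i.compile)
  | .inp i => .load i.compile
  | .add a b => .add a.compile b.compile
  | .sub a b => .sub a.compile b.compile
  | .mul a b => .mul a.compile b.compile
  | .div a b => .div a.compile b.compile
  | .mod a b => .mod a.compile b.compile

/-- Only the arrays `0, …, 6`, the counters below `δ` and the first `k + 2` input cells are read. -/
def HExpr.OK (k : ℕ) (I : ℕ → ℕ) (α : ℕ → ℕ → ℕ) (ρ : ℕ → ℕ) (δ : ℕ) : HExpr → Prop
  | .lit _ => True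
  | .ctr j => j < δ
  | .arr a i => a < 7 ∧ i.OK k I α ρ δ
  | .inp i => i.eval I α ρ < k + 2 ∧ i.OK k I α ρ δ
  | .add a b => a.OK k I α ρ δ ∧ b.OK k I α ρ δ
  | .sub a b => a.OK k I α ρ δ ∧ b.OK k I α ρ δ
  | .mul a b => a.OK k I α ρ δ ∧ b.OK k I α ρ δ
  | .div a b => a.OK k I α ρ δ ∧ b.OK k I α ρ δ
  | .mod a b => a.OK k I α ρ δ ∧ b.OK k I α ρ δ

/-- Only counters of enclosing loops can occur. This makes the bound of a loop independent of the
loop's own counter, although the compiled program evaluates the bound again before every iteration.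
-/
theorem HExpr.OK.congr {k : ℕ} {I : ℕ → ℕ} {α : ℕ → ℕ → ℕ} {ρ ρ' : ℕ → ℕ} {δ : ℕ}
    (h : ∀ j < δ, ρ' j = ρ j) {e : HExpr} (he : e.OK k I α ρ δ) :
    e.OK k I α ρ' δ ∧ e.eval I α ρ' = e.eval I α ρ := by
  induction e with
  | lit n => exact ⟨trivial, rfl⟩
  | ctr j => exact ⟨he, h j he⟩
  | arr a i ih =>
    have := ih he.2
    exact ⟨⟨he.1, this.1⟩, by simp only [eval, this.2]⟩
  | inp i ih =>
    have := ih he.2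
    exact ⟨⟨by rw [this.2]; exact he.1, this.1⟩, by simp only [eval, this.2]⟩
  | add a b iha ihb | sub a b iha ihb | mul a b iha ihb | div a b iha ihb | mod a b iha ihb =>
    have h1 := iha he.1
    have h2 := ihb he.2
    exact ⟨⟨h1.1, h2.1⟩, by simp only [eval, h1.2, h2.2]⟩

/-- The memory `σ` holds the input `I`, the arrays `α` and the loop counters `ρ 0, …, ρ (δ - 1)`. -/
structure Rep (k : ℕ) (I : ℕ → ℕ) (σ : Mem) (α : ℕ → ℕ → ℕ) (ρ : ℕ → ℕ) (δ : ℕ) : Prop where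
  inp : ∀ j < k + 2, σ j = I j
  arr : ∀ a < 7, ∀ i, σ (k + 2 + 8 * i + a) = α a i
  ctr : ∀ j < δ, σ (k + 2 + 8 * j + 7) = ρ j

section

variable {k : ℕ} {I : ℕ → ℕ} {σ : Mem} {α : ℕ → ℕ → ℕ} {ρ : ℕ → ℕ} {δ B : ℕ}

theorem Rep.eval_entryAddr (h : Rep k I σ α ρ δ) (hI : I 0 = k) (a : ℕ) (i : Expr) :
    (entryAddr a i).eval σ = k + 2 + 8 * i.eval σ + a := by
  have := h.inp 0 (by omega)
  simp only [entryAddr, Expr.eval]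
  omega

theorem Rep.eval_compile (h : Rep k I σ α ρ δ) (hI : I 0 = k) (e : HExpr) (he : e.OK k I α ρ δ) :
    e.compile.eval σ = e.eval I α ρ := by
  induction e with
  | lit n => rfl
  | ctr j =>
    simp only [HExpr.compile, Expr.eval, h.eval_entryAddr hI, HExpr.eval]
    exact h.ctr j he
  | arr a i ih =>
    simp only [HExpr.compile, Expr.eval, h.eval_entryAddr hI, HExpr.eval]
    rw [ih he.2]
    exact h.arr a he.1 _
  | inp i ih =>
    simp only [HExpr.compile, Expr.eval, HExpr.eval]
    rw [ih he.2]
    exact h.inp _ he.1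
  | add a b iha ihb => simp only [HExpr.compile, Expr.eval, HExpr.eval, iha he.1, ihb he.2]
  | sub a b iha ihb => simp only [HExpr.compile, Expr.eval, HExpr.eval, iha he.1, ihb he.2]
  | mul a b iha ihb => simp only [HExpr.compile, Expr.eval, HExpr.eval, iha he.1, ihb he.2]
  | div a b iha ihb => simp only [HExpr.compile, Expr.eval, HExpr.eval, iha he.1, ihb he.2]
  | mod a b iha ihb => simp only [HExpr.compile, Expr.eval, HExpr.eval, iha he.1, ihb he.2]

/-- The arrays after an assignment. -/
def setEntry (α : ℕ → ℕ → ℕ) (a i v : ℕ) : ℕ → ℕ → ℕ :=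
  fun a' i' => if a' = a ∧ i' = i then v else α a' i'

/-- Behind the input, the residue of the address modulo `8` identifies the array and the quotient
identifies the entry, so an assignment meets exactly one entry. -/
theorem Rep.update_arr (h : Rep k I σ α ρ δ) {a : ℕ} (ha : a < 7) (i v : ℕ) :
    Rep k I (Function.update σ (k + 2 + 8 * i + a) v) (setEntry α a i v) ρ δ where
  inp j hj := by rw [Function.update_of_ne (by omega)]; exact h.inp j hj
  arr a' ha' i' := by
    by_cases hh : a' = a ∧ i' = i
    · obtain ⟨rfl, rfl⟩ := hh
      simp [setEntry]
    · rw [Function.update_of_ne (by omega), h.arr a' ha', setEntry, if_neg hh]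
  ctr j hj := by rw [Function.update_of_ne (by omega)]; exact h.ctr j hj

theorem Rep.update_ctr (h : Rep k I σ α ρ δ) (v : ℕ) :
    Rep k I (Function.update σ (k + 2 + 8 * δ + 7) v) α (Function.update ρ δ v) (δ + 1) where
  inp j hj := by rw [Function.update_of_ne (by omega)]; exact h.inp j hj
  arr a' ha' i' := by rw [Function.update_of_ne (by omega)]; exact h.arr a' ha' i'
  ctr j hj := by
    by_cases hh : j = δ
    · subst hh; simp
    · rw [Function.update_of_ne (by omega), Function.update_of_ne hh]; exact h.ctr j (by omega)

theorem Rep.mono {ρ' : ℕ → ℕ} {δ' : ℕ} (h : Rep k I σ α ρ δ) (hδ : δ' ≤ δ)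
    (hρ : ∀ j < δ', ρ j = ρ' j) : Rep k I σ α ρ' δ' where
  inp := h.inp
  arr := h.arr
  ctr j hj := by rw [h.ctr j (by omega), hρ j hj]

/-! ## Classical programs over arrays -/

/-- From arrays `α`, the program `p` computes arrays `α'` in at most `s` steps. -/
def Runs (B k : ℕ) (I : ℕ → ℕ) (p : Prog) (α α' : ℕ → ℕ → ℕ) (s : ℕ) : Prop :=
  ∀ σ ρ, Rep k I σ α ρ 0 → ∃ σ' s', ExecN B p σ σ' [] s' ∧ Rep k I σ' α' ρ 0 ∧ s' ≤ s

/-- Assignment of a value to an array entry. -/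
def assign (a : ℕ) (i v : HExpr) : Prog :=
  .store (entryAddr a i.compile) v.compile

theorem runs_assign (hI : I 0 = k) {a : ℕ} {i v : HExpr} (ha : a < 7)
    (hi : ∀ ρ, i.OK k I α ρ 0) (hv : ∀ ρ, v.OK k I α ρ 0) (x y : ℕ)
    (hx : ∀ ρ, i.eval I α ρ = x) (hy : ∀ ρ, v.eval I α ρ = y) (hB : y < 2 ^ B) :
    Runs B k I (assign a i v) α (setEntry α a x y) 1 := by
  intro σ ρ h
  have e1 := h.eval_compile hI i (hi ρ)
  have e2 := h.eval_compile hI v (hv ρ)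
  have e3 := h.eval_entryAddr hI a i.compile
  rw [hx] at e1
  rw [hy] at e2
  rw [e1] at e3
  refine ⟨_, 1, ExecN.store σ _ _ (by rw [e2]; exact hB), ?_, le_rfl⟩
  rw [e2, e3]
  exact h.update_arr ha x y

theorem Runs.seq {p q : Prog} {α' α'' : ℕ → ℕ → ℕ} {s s' : ℕ} (hp : Runs B k I p α α' s)
    (hq : Runs B k I q α' α'' s') : Runs B k I (.seq p q) α α'' (s + s') := by
  intro σ ρ h
  obtain ⟨σ1, s1, h1, h2, h3⟩ := hp σ ρ h
  obtain ⟨σ2, s2, h4, h5, h6⟩ := hq σ1 ρ h2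
  exact ⟨σ2, _, ExecN.seq h1 h4, h5, by omega⟩

theorem Runs.mono {p : Prog} {α' : ℕ → ℕ → ℕ} {s s' : ℕ} (hp : Runs B k I p α α' s)
    (hs : s ≤ s') : Runs B k I p α α' s' := by
  intro σ ρ h
  obtain ⟨σ1, s1, h1, h2, h3⟩ := hp σ ρ h
  exact ⟨σ1, s1, h1, h2, by omega⟩

theorem Runs.ite_true {p q : Prog} {e : HExpr} {α' : ℕ → ℕ → ℕ} {s : ℕ} (hI : I 0 = k)
    (hp : Runs B k I p α α' s)
    (he : ∀ ρ, e.OK k I α ρ 0) (h0 : ∀ ρ, e.eval I α ρ ≠ 0) :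
    Runs B k I (.ite e.compile p q) α α' (1 + s) := by
  intro σ ρ h
  obtain ⟨σ1, s1, h1, h2, h3⟩ := hp σ ρ h
  refine ⟨σ1, _, ExecN.iteTrue ?_ h1, h2, by omega⟩
  rw [h.eval_compile hI e (he ρ)]
  exact h0 ρ

theorem Runs.ite_false {p q : Prog} {e : HExpr} {α' : ℕ → ℕ → ℕ} {s : ℕ} (hI : I 0 = k)
    (hp : Runs B k I q α α' s)
    (he : ∀ ρ, e.OK k I α ρ 0) (h0 : ∀ ρ, e.eval I α ρ = 0) :
    Runs B k I (.ite e.compile p q) α α' (1 + s) := by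
  intro σ ρ h
  obtain ⟨σ1, s1, h1, h2, h3⟩ := hp σ ρ h
  refine ⟨σ1, _, ExecN.iteFalse ?_ h1, h2, by omega⟩
  rw [h.eval_compile hI e (he ρ)]
  exact h0 ρ

theorem Runs.loop_done {p : Prog} {e : HExpr} (hI : I 0 = k)
    (he : ∀ ρ, e.OK k I α ρ 0) (h0 : ∀ ρ, e.eval I α ρ = 0) :
    Runs B k I (.loop e.compile p) α α 1 := by
  intro σ ρ h
  refine ⟨σ, _, ExecN.loopDone ?_, h, le_rfl⟩
  rw [h.eval_compile hI e (he ρ)]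
  exact h0 ρ

theorem Runs.loop_step {p : Prog} {e : HExpr} {α' α'' : ℕ → ℕ → ℕ} {s s' : ℕ} (hI : I 0 = k)
    (hp : Runs B k I p α α' s) (hl : Runs B k I (.loop e.compile p) α' α'' s')
    (he : ∀ ρ, e.OK k I α ρ 0) (h0 : ∀ ρ, e.eval I α ρ ≠ 0) :
    Runs B k I (.loop e.compile p) α α'' (1 + s + s') := by
  intro σ ρ h
  obtain ⟨σ1, s1, h1, h2, h3⟩ := hp σ ρ h
  obtain ⟨σ2, s2, h4, h5, h6⟩ := hl σ1 ρ h2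
  refine ⟨σ2, _, ExecN.loopStep ?_ h1 h4, h5, by omega⟩
  rw [h.eval_compile hI e (he ρ)]
  exact h0 ρ

end

/-! ## Circuits with loops -/

/-- The building blocks of circuits: gates, except that rotations are replaced by reflections. -/
inductive Step (α : Type) : Type
  | not (t : α)
  | ccnot (c d t : α)
  | refl (a b c t : α)
  | cph (a b c t : α)
  | query (x y : α)

/-- Apply a function to all operands. -/
def Step.map {α β : Type} (φ : α → β) : Step α → Step β
  | .not t => .not (φ t)
  | .ccnot c d t => .ccnot (φ c) (φ d) (φ t)
  | .refl a b c t => .refl (φ a) (φ b) (φ c) (φ t)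
  | .cph a b c t => .cph (φ a) (φ b) (φ c) (φ t)
  | .query x y => .query (φ x) (φ y)

/-- The list of operands. -/
def Step.operands {α : Type} : Step α → List α
  | .not t => [t]
  | .ccnot c d t => [c, d, t]
  | .refl a b c t => [a, b, c, t]
  | .cph a b c t => [a, b, c, t]
  | .query x y => [x, y]

/-- The gates performing a step (`dir = true`) or its inverse (`dir = false`). -/
def Step.gates (dir : Bool) : Step ℕ → List (Gate ℕ)
  | .not t => [.not t]
  | .ccnot c d t => [.ccnot c d t]
  | .refl a b c t => [.cphase 1 2 c t, .crot a b c t]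
  | .cph a b c t => [.cphase (if dir then a else a * (b - 1)) b c t]
  | .query x y => [.query x y]

/-- The program performing a step (`dir = true`) or its inverse (`dir = false`). -/
def Step.compile (dir : Bool) : Step HExpr → Prog
  | .not t => .gate (.not t.compile)
  | .ccnot c d t => .gate (.ccnot c.compile d.compile t.compile)
  | .refl a b c t => .seq (.gate (.cphase (.lit 1) (.lit 2) c.compile t.compile))
      (.gate (.crot a.compile b.compile c.compile t.compile))
  | .cph a b c t => .gate (.cphase
      (if dir then a.compile else .mul a.compile (.sub b.compile (.lit 1)))
      b.compile c.compile t.compile)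
  | .query x y => .gate (.query x.compile y.compile)

/-- Circuits: `loop bound body` performs `body` for all values of a fresh loop counter below
`bound`, and `rev c` is the inverse of `c`. -/
inductive Circ : Type
  | prim (s : Step HExpr)
  | seq (c d : Circ)
  | loop (bound : HExpr) (body : Circ)
  | rev (c : Circ)

/-- The gates of a circuit (`dir = true`) or of its inverse (`dir = false`), inside `δ` loops whose
counters have the values `ρ 0, …, ρ (δ - 1)`. -/
def Circ.gates (I : ℕ → ℕ) (α : ℕ → ℕ → ℕ) : Bool → ℕ → (ℕ → ℕ) → Circ → List (Gate ℕ)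
  | dir, _, ρ, .prim s => (s.map (HExpr.eval I α ρ)).gates dir
  | true, δ, ρ, .seq c d => c.gates I α true δ ρ ++ d.gates I α true δ ρ
  | false, δ, ρ, .seq c d => d.gates I α false δ ρ ++ c.gates I α false δ ρ
  | true, δ, ρ, .loop bound body => (List.range (bound.eval I α ρ)).flatMap
      fun i => body.gates I α true (δ + 1) (Function.update ρ δ i)
  | false, δ, ρ, .loop bound body => (List.range (bound.eval I α ρ)).reverse.flatMap
      fun i => body.gates I α false (δ + 1) (Function.update ρ δ i)
  | dir, δ, ρ, .rev c => c.gates I α (!dir) δ ρ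

/-- The address of the loop counter `δ`. -/
def ctrAddr (δ : ℕ) : Expr := entryAddr 7 (.lit δ)

/-- Translation of circuits into programs. -/
def Circ.compile : Bool → ℕ → Circ → Prog
  | dir, _, .prim s => s.compile dir
  | true, δ, .seq c d => .seq (c.compile true δ) (d.compile true δ)
  | false, δ, .seq c d => .seq (d.compile false δ) (c.compile false δ)
  | true, δ, .loop bound body => .seq (.store (ctrAddr δ) (.lit 0))
      (.loop (.sub bound.compile (.load (ctrAddr δ)))
        (.seq (body.compile true (δ + 1))
          (.store (ctrAddr δ) (.add (.load (ctrAddr δ)) (.lit 1)))))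
  | false, δ, .loop bound body => .seq (.store (ctrAddr δ) bound.compile)
      (.loop (.load (ctrAddr δ))
        (.seq (.store (ctrAddr δ) (.sub (.load (ctrAddr δ)) (.lit 1)))
          (body.compile false (δ + 1))))
  | dir, δ, .rev c => c.compile (!dir) δ

/-- All expressions can be evaluated, and all loop bounds are at most `R`. -/
def Circ.OK (k : ℕ) (I : ℕ → ℕ) (α : ℕ → ℕ → ℕ) (R : ℕ) : ℕ → (ℕ → ℕ) → Circ → Prop
  | δ, ρ, .prim s => ∀ e ∈ s.operands, e.OK k I α ρ δ
  | δ, ρ, .seq c d => c.OK k I α R δ ρ ∧ d.OK k I α R δ ρ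
  | δ, ρ, .loop bound body => bound.OK k I α ρ δ ∧ bound.eval I α ρ ≤ R ∧
      ∀ i < bound.eval I α ρ, body.OK k I α R (δ + 1) (Function.update ρ δ i)
  | δ, ρ, .rev c => c.OK k I α R δ ρ

/-- A bound for the number of steps when all loop bounds are at most `R`. -/
def Circ.count (R : ℕ) : Circ → ℕ
  | .prim _ => 2
  | .seq c d => c.count R + d.count R
  | .loop _ body => 2 + R * (body.count R + 2)
  | .rev c => c.count R

/-- The size of a circuit as a program text. -/
def Circ.length : Circ → ℕ
  | .prim _ => 2
  | .seq c d => c.length + d.length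
  | .loop _ body => body.length + 4
  | .rev c => c.length

/-- The nesting depth of the loops. -/
def Circ.depth : Circ → ℕ
  | .prim _ => 0
  | .seq c d => c.depth + d.depth
  | .loop _ body => body.depth + 1
  | .rev c => c.depth

/-- Length and depth belong to the circuit text alone, so for a fixed circuit this is a polynomial
in `R`. The depth is additive even for sequences; this is cruder than a maximum but sufficient. -/
theorem Circ.count_le (R : ℕ) (c : Circ) : c.count R ≤ c.length * (R + 1) ^ c.depth := by
  induction c with
  | prim s => simp [count, length, depth]
  | seq c d ihc ihd =>
    simp only [count, length, depth, add_mul]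
    refine add_le_add (ihc.trans ?_) (ihd.trans ?_)
    · exact Nat.mul_le_mul_left _ (Nat.pow_le_pow_right (by omega) (by omega))
    · exact Nat.mul_le_mul_left _ (Nat.pow_le_pow_right (by omega) (by omega))
  | loop b body ih =>
    simp only [count, length, depth]
    have h1 : 1 ≤ (R + 1) ^ body.depth := Nat.one_le_pow _ _ (by omega)
    rw [pow_succ]
    nlinarith [Nat.mul_le_mul_left R ih, Nat.mul_le_mul_left R h1]
  | rev c ih => simpa [count, length, depth] using ih

/-! ### Correctness of compiled steps and circuits. -/

section

variable {k : ℕ} {I : ℕ → ℕ} {σ : Mem} {α : ℕ → ℕ → ℕ} {ρ : ℕ → ℕ} {δ B : ℕ}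

theorem Step.exec (hI : I 0 = k) (dir : Bool) (s : Step HExpr)
    (hs : ∀ e ∈ s.operands, e.OK k I α ρ δ) (h : Rep k I σ α ρ δ) :
    ∃ s', ExecN B (s.compile dir) σ σ ((s.map (HExpr.eval I α ρ)).gates dir) s' ∧ s' ≤ 2 := by
  have key : ∀ e ∈ s.operands, e.compile.eval σ = e.eval I α ρ :=
    fun e he => h.eval_compile hI e (hs e he)
  cases s with
  | not t =>
    simp only [operands, List.mem_singleton, forall_eq] at key
    refine ⟨_, ?_, one_le_two⟩
    have := ExecN.gate (B := B) σ (.not t.compile)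
    simpa [Gate.map, key, Step.map, Step.gates, Step.compile] using this
  | ccnot c d t =>
    simp only [operands, List.mem_cons, forall_eq_or_imp, List.not_mem_nil] at key
    refine ⟨_, ?_, one_le_two⟩
    have := ExecN.gate (B := B) σ (.ccnot c.compile d.compile t.compile)
    simpa [Gate.map, key, Step.map, Step.gates, Step.compile] using this
  | refl a b c t =>
    simp only [operands, List.mem_cons, forall_eq_or_imp, List.not_mem_nil] at key
    refine ⟨2, ?_, le_rfl⟩
    have := ExecN.seq (ExecN.gate (B := B) σ (.cphase (.lit 1) (.lit 2) c.compile t.compile))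
      (ExecN.gate (B := B) σ (.crot a.compile b.compile c.compile t.compile))
    simpa [Gate.map, key, Step.map, Step.gates, Step.compile, Expr.eval] using this
  | cph a b c t =>
    simp only [operands, List.mem_cons, forall_eq_or_imp, List.not_mem_nil] at key
    refine ⟨_, ?_, one_le_two⟩
    have := ExecN.gate (B := B) σ (.cphase
      (if dir then a.compile else .mul a.compile (.sub b.compile (.lit 1)))
      b.compile c.compile t.compile)
    cases dir <;> simpa [Gate.map, key, Step.map, Step.gates, Step.compile, Expr.eval] using this
  | query x y =>
    simp only [operands, List.mem_cons, forall_eq_or_imp, List.not_mem_nil] at key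
    refine ⟨_, ?_, one_le_two⟩
    have := ExecN.gate (B := B) σ (.query x.compile y.compile)
    simpa [Gate.map, key, Step.map, Step.gates, Step.compile] using this

/-- The counter of a loop at depth `δ` lives in its own cell, and the body may only use deeper
cells, so after the body the counter is still intact. The hypothesis `R < 2 ^ B` ensures that the
counters may be stored. -/
theorem Circ.exec (hI : I 0 = k) {R : ℕ} (hR : R < 2 ^ B) (c : Circ) :
    ∀ (dir : Bool) (δ : ℕ) (ρ : ℕ → ℕ) (σ : Mem), c.OK k I α R δ ρ → Rep k I σ α ρ δ →
    ∃ σ' s, ExecN B (c.compile dir δ) σ σ' (c.gates I α dir δ ρ) s ∧ Rep k I σ' α ρ δ ∧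
      s ≤ c.count R := by
  induction c with
  | prim s =>
    intro dir δ ρ σ hok h
    obtain ⟨s', h1, h2⟩ := Step.exec (B := B) hI dir s hok h
    exact ⟨σ, s', by simpa [gates, compile] using h1, h, h2⟩
  | seq c d ihc ihd =>
    intro dir δ ρ σ hok h
    cases dir with
    | true =>
      obtain ⟨σ1, s1, h1, h2, h3⟩ := ihc true δ ρ σ hok.1 h
      obtain ⟨σ2, s2, h4, h5, h6⟩ := ihd true δ ρ σ1 hok.2 h2
      refine ⟨σ2, _, ?_, h5, add_le_add h3 h6⟩
      simp only [compile, gates]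
      exact ExecN.seq h1 h4
    | false =>
      obtain ⟨σ1, s1, h1, h2, h3⟩ := ihd false δ ρ σ hok.2 h
      obtain ⟨σ2, s2, h4, h5, h6⟩ := ihc false δ ρ σ1 hok.1 h2
      refine ⟨σ2, s1 + s2, ?_, h5, by simp only [count]; omega⟩
      simp only [compile, gates]
      exact ExecN.seq h1 h4
  | rev c ih =>
    intro dir δ ρ σ hok h
    simpa [compile, gates, count] using ih (!dir) δ ρ σ hok h
  | loop bound body ih =>
    intro dir δ ρ σ hok h
    obtain ⟨hbOK, hbR, hbody⟩ := hok
    have hb := fun ρ' h => HExpr.OK.congr (ρ' := ρ') h hbOK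
    set n := bound.eval I α ρ with hn
    have haddr : ∀ {σ ρ δ'}, Rep k I σ α ρ δ' → (ctrAddr δ).eval σ = k + 2 + 8 * δ + 7 :=
      fun h => h.eval_entryAddr hI 7 (.lit δ)
    have hbound : ∀ {σ ρ'}, Rep k I σ α ρ' δ → (∀ j < δ, ρ' j = ρ j) →
        bound.compile.eval σ = n := by
      intro σ ρ' h hρ
      rw [h.eval_compile hI bound (hb ρ' hρ).1, (hb ρ' hρ).2]
    cases dir with
    | true =>
      -- Here `i` is the current counter and `j` is the number of iterations left.
      have aux : ∀ j i, i + j = n → ∀ σ, Rep k I σ α (Function.update ρ δ i) (δ + 1) →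
          ∃ σ' s, ExecN B (.loop (.sub bound.compile (.load (ctrAddr δ)))
            (.seq (body.compile true (δ + 1))
            (.store (ctrAddr δ) (.add (.load (ctrAddr δ)) (.lit 1))))) σ σ'
            ((List.range' i j).flatMap
              fun i => body.gates I α true (δ + 1) (Function.update ρ δ i)) s ∧
            Rep k I σ' α ρ δ ∧ s ≤ 1 + j * (body.count R + 2) := by
        intro j
        induction j with
        | zero =>
          intro i hi σ h
          refine ⟨σ, 1, ?_, ?_, by omega⟩
          · refine ExecN.loopDone ?_
            have h1 := hbound (h.mono (Nat.le_succ δ) (fun j _ => rfl))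
              (fun j hj => by rw [Function.update_of_ne (by omega)])
            have h2 := h.ctr δ (by omega)
            simp only [Function.update_self] at h2
            simp only [Expr.eval, h1, haddr h, h2]
            omega
          · exact h.mono (Nat.le_succ δ) (fun j hj => by rw [Function.update_of_ne (by omega)])
        | succ j ihj =>
          intro i hi σ h
          have h1 := hbound (h.mono (Nat.le_succ δ) (fun j _ => rfl))
            (fun j hj => by rw [Function.update_of_ne (by omega)])
          have h2 := h.ctr δ (by omega)
          simp only [Function.update_self] at h2
          obtain ⟨σ1, s1, e1, r1, b1⟩ := ih true (δ + 1) _ σ (hbody i (by omega)) h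
          have h3 := r1.ctr δ (by omega)
          simp only [Function.update_self] at h3
          have r2 := (r1.mono (Nat.le_succ δ) (fun j _ => rfl)).update_ctr (i + 1)
          rw [Function.update_idem] at r2
          obtain ⟨σ2, s2, e2, r3, b2⟩ := ihj (i + 1) (by omega) _ r2
          have e3 : ExecN B (.store (ctrAddr δ) (.add (.load (ctrAddr δ)) (.lit 1))) σ1
              (Function.update σ1 (k + 2 + 8 * δ + 7) (i + 1)) [] 1 := by
            have := ExecN.store (B := B) σ1 (ctrAddr δ) (.add (.load (ctrAddr δ)) (.lit 1))
              (by simp only [Expr.eval, haddr r1, h3]; omega)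
            simpa only [Expr.eval, haddr r1, h3] using this
          refine ⟨σ2, 1 + (s1 + 1) + s2, ?_, r3, ?_⟩
          · have := ExecN.loopStep (e := .sub bound.compile (.load (ctrAddr δ)))
              (by simp only [Expr.eval, h1, haddr h, h2]; omega) (ExecN.seq e1 e3) e2
            simpa [List.range'_succ] using this
          · rw [Nat.succ_mul]; omega
      obtain ⟨σ2, s2, e2, r2, b2⟩ := aux n 0 (by omega) _ (h.update_ctr 0)
      refine ⟨σ2, 1 + s2, ?_, r2, ?_⟩
      · have e3 : ExecN B (.store (ctrAddr δ) (.lit 0)) σ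
            (Function.update σ (k + 2 + 8 * δ + 7) 0) [] 1 := by
          have := ExecN.store (B := B) σ (ctrAddr δ) (.lit 0) (by simp [Expr.eval])
          simpa only [Expr.eval, haddr h] using this
        have := ExecN.seq e3 e2
        simpa [compile, gates, List.range_eq_range'] using this
      · simp only [count]
        have := Nat.mul_le_mul_right (body.count R + 2) hbR
        omega
    | false =>
      -- The inverse loop decrements its counter before the body. A counter equal to `j` at the test
      -- therefore means that the body still runs for `j - 1, …, 0`.
      have aux : ∀ j ≤ n, ∀ σ, Rep k I σ α (Function.update ρ δ j) (δ + 1) →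
          ∃ σ' s, ExecN B (.loop (.load (ctrAddr δ))
            (.seq (.store (ctrAddr δ) (.sub (.load (ctrAddr δ)) (.lit 1)))
            (body.compile false (δ + 1)))) σ σ'
            ((List.range j).reverse.flatMap
              fun i => body.gates I α false (δ + 1) (Function.update ρ δ i)) s ∧
            Rep k I σ' α ρ δ ∧ s ≤ 1 + j * (body.count R + 2) := by
        intro j
        induction j with
        | zero =>
          intro hi σ h
          refine ⟨σ, 1, ?_, ?_, by omega⟩
          · refine ExecN.loopDone ?_
            have h2 := h.ctr δ (by omega)
            simp only [Function.update_self] at h2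
            simp only [Expr.eval, haddr h, h2]
          · exact h.mono (Nat.le_succ δ) (fun j hj => by rw [Function.update_of_ne (by omega)])
        | succ j ihj =>
          intro hi σ h
          have h2 := h.ctr δ (by omega)
          simp only [Function.update_self] at h2
          have r2 := (h.mono (Nat.le_succ δ) (fun j _ => rfl)).update_ctr j
          rw [Function.update_idem] at r2
          have e3 : ExecN B (.store (ctrAddr δ) (.sub (.load (ctrAddr δ)) (.lit 1))) σ
              (Function.update σ (k + 2 + 8 * δ + 7) j) [] 1 := by
            have := ExecN.store (B := B) σ (ctrAddr δ) (.sub (.load (ctrAddr δ)) (.lit 1))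
              (by simp only [Expr.eval, haddr h, h2]; omega)
            simpa only [Expr.eval, haddr h, h2, Nat.add_sub_cancel] using this
          obtain ⟨σ1, s1, e1, r1, b1⟩ := ih false (δ + 1) _ _ (hbody j (by omega)) r2
          obtain ⟨σ2, s2, e2, r3, b2⟩ := ihj (by omega) _ r1
          refine ⟨σ2, 1 + (1 + s1) + s2, ?_, r3, ?_⟩
          · have := ExecN.loopStep (e := .load (ctrAddr δ))
              (by simp only [Expr.eval, haddr h, h2]; omega) (ExecN.seq e3 e1) e2
            simpa [List.range_succ] using this
          · rw [Nat.succ_mul]; omega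
      obtain ⟨σ2, s2, e2, r2, b2⟩ := aux n le_rfl _ (h.update_ctr n)
      refine ⟨σ2, 1 + s2, ?_, r2, ?_⟩
      · have e3 : ExecN B (.store (ctrAddr δ) bound.compile) σ
            (Function.update σ (k + 2 + 8 * δ + 7) n) [] 1 := by
          have h1 := hbound h (fun _ _ => rfl)
          have := ExecN.store (B := B) σ (ctrAddr δ) bound.compile (by omega)
          simpa only [h1, haddr h] using this
        have := ExecN.seq e3 e2
        simpa [compile, gates] using this
      · simp only [count]
        have := Nat.mul_le_mul_right (body.count R + 2) hbR
        omega

end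

end QAlg

namespace QAlg

open ComplexConjugate Matrix

/-! ## Inner product of states -/

/-- The inner product of two states. -/
noncomputable def inner (u v : QState) : ℂ := u.sum fun b c => conj c * v b

theorem inner_add_left (u u' v : QState) : inner (u + u') v = inner u v + inner u' v := by
  unfold inner
  exact Finsupp.sum_add_index' (by simp) (by intro b c c'; rw [map_add, add_mul])

theorem inner_smul_left (a : ℂ) (u v : QState) : inner (a • u) v = conj a * inner u v := by
  unfold inner
  rw [Finsupp.sum_smul_index' (by simp), Finsupp.mul_sum]
  simp [mul_assoc]

theorem inner_add_right (u v v' : QState) : inner u (v + v') = inner u v + inner u v' := by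
  simp [inner, mul_add, Finsupp.sum_add]

theorem inner_smul_right (a : ℂ) (u v : QState) : inner u (a • v) = a * inner u v := by
  unfold inner
  rw [Finsupp.mul_sum]
  refine Finsupp.sum_congr fun b _ => ?_
  simp only [Finsupp.smul_apply, smul_eq_mul]
  ring

theorem inner_single_left (b : Config) (c : ℂ) (v : QState) :
    inner (Finsupp.single b c) v = conj c * v b := by
  simp [inner]

theorem inner_zero_left (v : QState) : inner 0 v = 0 := by simp [inner]

theorem inner_zero_right (v : QState) : inner v 0 = 0 := by simp [inner]

theorem inner_sum_left {ι : Type*} (s : Finset ι) (u : ι → QState) (v : QState) :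
    inner (∑ i ∈ s, u i) v = ∑ i ∈ s, inner (u i) v := by
  classical
  induction s using Finset.induction_on with
  | empty => simp [inner_zero_left]
  | insert a s ha ih => rw [Finset.sum_insert ha, Finset.sum_insert ha, inner_add_left, ih]

theorem inner_sum_right {ι : Type*} (s : Finset ι) (u : ι → QState) (v : QState) :
    inner v (∑ i ∈ s, u i) = ∑ i ∈ s, inner v (u i) := by
  classical
  induction s using Finset.induction_on with
  | empty => simp [inner_zero_right]
  | insert a s ha ih => rw [Finset.sum_insert ha, Finset.sum_insert ha, inner_add_right, ih]

theorem inner_conj (u v : QState) : conj (inner u v) = inner v u := by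
  induction u using Finsupp.induction_linear with
  | zero => simp [inner_zero_left, inner_zero_right]
  | add u u' h h' => rw [inner_add_left, inner_add_right, map_add, h, h']
  | single b c =>
    rw [inner_single_left, map_mul, Complex.conj_conj]
    induction v using Finsupp.induction_linear with
    | zero => simp [inner_zero_left]
    | add v v' h h' => rw [inner_add_left, Finsupp.add_apply, map_add, mul_add, h, h']
    | single b' c' =>
      classical
      rw [inner_single_left, Finsupp.single_apply, Finsupp.single_apply]
      by_cases hb : b' = b
      · subst hb; simp [mul_comm]
      · rw [if_neg hb, if_neg (Ne.symm hb)]; simp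

/-- The operators `A` and `A'` are adjoint as soon as their matrices are. -/
theorem inner_adjoint_of_basis {A A' : QState →ₗ[ℂ] QState}
    (h : ∀ b b', conj (A (Finsupp.single b 1) b') = A' (Finsupp.single b' 1) b) (u v : QState) :
    inner (A u) v = inner u (A' v) := by
  induction u using Finsupp.induction_linear with
  | zero => simp [inner_zero_left]
  | add u u' h h' => rw [map_add, inner_add_left, inner_add_left, h, h']
  | single b c =>
    induction v using Finsupp.induction_linear with
    | zero => simp [inner_zero_right]
    | add u u' h h' => rw [map_add, inner_add_right, inner_add_right, h, h']
    | single b' c' =>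
      have h1 : Finsupp.single b c = c • Finsupp.single b (1 : ℂ) := by simp
      have h2 : Finsupp.single b' c' = c' • Finsupp.single b' (1 : ℂ) := by simp
      rw [h1, h2, map_smul, map_smul, inner_smul_left, inner_smul_left, inner_smul_right,
        inner_smul_right, inner_single_left, ← inner_conj, inner_single_left, ← h b b']
      simp

/-! ## Controlled one-qubit operators -/

/-- The one-qubit operator `U` on wire `t`, controlled by the wires in `cs`. -/
noncomputable def ctrlOp (cs : List ℕ) (t : ℕ) (U : Matrix Bool Bool ℂ) : QState →ₗ[ℂ] QState :=
  Finsupp.linearCombination ℂ (ctrlBasis cs t U)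

theorem ctrlOp_single (cs : List ℕ) (t : ℕ) (U : Matrix Bool Bool ℂ) (b : Config) :
    ctrlOp cs t U (Finsupp.single b 1) = ctrlBasis cs t U b := by
  simp [ctrlOp]

theorem ctrlOp_single_coeff (cs : List ℕ) (t : ℕ) (U : Matrix Bool Bool ℂ) (b : Config) (a : ℂ) :
    ctrlOp cs t U (Finsupp.single b a) = a • ctrlBasis cs t U b := by
  simp [ctrlOp]

theorem ctrl_update {cs : List ℕ} {t : ℕ} (ht : t ∉ cs) (b : Config) (v : Bool) :
    (∀ c ∈ cs, Function.update b t v c = true) ↔ ∀ c ∈ cs, b c = true := by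
  refine forall₂_congr fun c hc => ?_
  rw [Function.update_of_ne (by rintro rfl; exact ht hc)]

theorem qstate_hom_ext {A B : QState →ₗ[ℂ] QState}
    (h : ∀ b, A (Finsupp.single b 1) = B (Finsupp.single b 1)) : A = B := by
  refine Finsupp.lhom_ext' fun b => LinearMap.ext_ring ?_
  simpa using h b

/-- The target is not one of its own controls, so the first operator leaves the control condition
unchanged and the two matrices act on the same qubit under the same condition. -/
theorem ctrlOp_comp (cs : List ℕ) (t : ℕ) (U V : Matrix Bool Bool ℂ) :
    ctrlOp cs t U ∘ₗ ctrlOp cs t V = ctrlOp cs t (U * V) := by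
  refine qstate_hom_ext fun b => ?_
  rw [LinearMap.comp_apply, ctrlOp_single, ctrlOp_single, ctrlBasis, ctrlBasis]
  by_cases h : t ∉ cs ∧ ∀ c ∈ cs, b c = true
  · rw [if_pos h, if_pos h]
    have h1 : ∀ v, ctrlBasis cs t U (Function.update b t v) =
        ∑ w : Bool, Finsupp.single (Function.update b t w) (U w v) := by
      intro v
      rw [ctrlBasis, if_pos ⟨h.1, (ctrl_update h.1 b v).2 h.2⟩]
      simp
    rw [map_sum]
    simp only [ctrlOp_single_coeff, h1, Matrix.mul_apply, Fintype.sum_bool, smul_add,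
      Finsupp.smul_single, smul_eq_mul, Finsupp.single_add]
    rw [mul_comm (V true (b t)) (U true true), mul_comm (V true (b t)) (U false true),
      mul_comm (V false (b t)) (U true false), mul_comm (V false (b t)) (U false false)]
    abel
  · rw [if_neg h, if_neg h, ctrlOp_single, ctrlBasis, if_neg h]

theorem ctrlOp_one (cs : List ℕ) (t : ℕ) : ctrlOp cs t 1 = LinearMap.id := by
  refine qstate_hom_ext fun b => ?_
  rw [ctrlOp_single, ctrlBasis]
  split_ifs with h
  · cases hb : b t <;> simp [Matrix.one_apply] <;> rw [← hb, Function.update_eq_self]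
  · rfl

/-- A matrix coefficient can be nonzero only between configurations that agree off the target. Such
configurations satisfy the control condition together, and the claim becomes one about the entries
of `U`. -/
theorem ctrlOp_adjoint (cs : List ℕ) (t : ℕ) (U : Matrix Bool Bool ℂ) (u v : QState) :
    inner (ctrlOp cs t U u) v = inner u (ctrlOp cs t Uᴴ v) := by
  classical
  refine inner_adjoint_of_basis (fun b b' => ?_) u v
  rw [ctrlOp_single, ctrlOp_single]
  have half : ∀ (U : Matrix Bool Bool ℂ) (b b' : Config), ctrlBasis cs t U b b' =
      if t ∉ cs ∧ (∀ c ∈ cs, b c = true) then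
        (if Function.update b t (b' t) = b' then U (b' t) (b t) else 0)
      else if b = b' then 1 else 0 := by
    intro U b b'
    rw [ctrlBasis]
    split_ifs with h1 h2 h3
    · rw [Finsupp.finsetSum_apply, Finset.sum_eq_single (b' t)]
      · rw [h2, Finsupp.single_eq_same]
      · intro v _ hv
        rw [Finsupp.single_apply, if_neg]
        intro h
        exact hv (by rw [← h]; simp)
      · simp
    · rw [Finsupp.finsetSum_apply]
      refine Finset.sum_eq_zero fun v _ => ?_
      rw [Finsupp.single_apply, if_neg]
      intro h
      exact h2 (by rw [← h]; simp)
    · rw [h3, Finsupp.single_eq_same]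
    · rw [Finsupp.single_apply, if_neg h3]
  rw [half, half]
  by_cases hb : Function.update b t (b' t) = b'
  · have hb' : Function.update b' t (b t) = b := by rw [← hb]; simp
    have h1 : (∀ c ∈ cs, b' c = true) ↔ (t ∉ cs → ∀ c ∈ cs, b c = true) ∧ (t ∈ cs → ∀ c ∈ cs, b' c = true) := by
      by_cases ht : t ∈ cs
      · simp [ht]
      · rw [← hb, ctrl_update ht]; simp [ht]
    by_cases ht : t ∈ cs
    · simp only [ht, not_true, false_and, if_false]
      by_cases h : b = b'
      · simp [h]
      · simp [h, Ne.symm h]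
    · have h2 : (∀ c ∈ cs, b' c = true) ↔ (∀ c ∈ cs, b c = true) := by
        rw [← hb, ctrl_update ht]
      simp only [ht, not_false_eq_true, true_and, h2, hb, hb', if_true, Matrix.conjTranspose_apply]
      split_ifs with h3 h4 h5
      · rfl
      · simp
      · exact absurd h4.symm h5
      · rename_i h6; exact absurd h6.symm h4
      · simp
  · have hb' : Function.update b' t (b t) ≠ b := by
      intro h
      exact hb (by rw [← h]; simp)
    have h3 : b ≠ b' := by
      rintro rfl
      simp at hb
    simp [hb, hb', h3, Ne.symm h3]

/-! ## Gate lists and their inverses -/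

section

variable {k : ℕ} (L : ℕ) (F : (Fin k → ℕ) → ℕ)

/-- The operator performed by a list of gates. -/
noncomputable def applyGates : List (Gate ℕ) → QState →ₗ[ℂ] QState
  | [] => LinearMap.id
  | g :: gs => applyGates gs ∘ₗ g.op L F

theorem applyGates_append (gs hs : List (Gate ℕ)) :
    applyGates L F (gs ++ hs) = applyGates L F hs ∘ₗ applyGates L F gs := by
  induction gs with
  | nil => simp [applyGates]
  | cons g gs ih => simp only [List.cons_append, applyGates, ih, LinearMap.comp_assoc]

theorem finalState_eq (gs : List (Gate ℕ)) :
    finalState L F gs = applyGates L F gs (Finsupp.single (fun _ => false : Config) 1) := by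
  unfold finalState
  generalize Finsupp.single (fun _ => false : Config) (1 : ℂ) = ψ
  induction gs generalizing ψ with
  | nil => rfl
  | cons g gs ih => rw [List.foldl_cons, ih]; rfl

/-- Two gate lists performing unitary operators that are inverse to each other. -/
structure InversePair (gs gs' : List (Gate ℕ)) : Prop where
  adjoint : ∀ u v, inner (applyGates L F gs u) v = inner u (applyGates L F gs' v)
  left : ∀ u, applyGates L F gs' (applyGates L F gs u) = u
  right : ∀ u, applyGates L F gs (applyGates L F gs' u) = u

variable {L F}

theorem InversePair.symm {gs gs' : List (Gate ℕ)} (h : InversePair L F gs gs') :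
    InversePair L F gs' gs where
  adjoint u v := by rw [← inner_conj, ← h.adjoint, inner_conj]
  left := h.right
  right := h.left

theorem InversePair.append {gs gs' hs hs' : List (Gate ℕ)} (hg : InversePair L F gs gs')
    (hh : InversePair L F hs hs') : InversePair L F (gs ++ hs) (hs' ++ gs') where
  adjoint u v := by
    simp only [applyGates_append, LinearMap.comp_apply, hg.adjoint, hh.adjoint]
  left u := by
    simp only [applyGates_append, LinearMap.comp_apply, hg.left, hh.left]
  right u := by
    simp only [applyGates_append, LinearMap.comp_apply, hg.right, hh.right]

theorem InversePair.nil : InversePair L F [] [] where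
  adjoint _ _ := rfl
  left _ := rfl
  right _ := rfl

theorem InversePair.flatMap {f f' : ℕ → List (Gate ℕ)} (l : List ℕ)
    (h : ∀ i ∈ l, InversePair L F (f i) (f' i)) :
    InversePair L F (l.flatMap f) (l.reverse.flatMap f') := by
  induction l with
  | nil => exact InversePair.nil
  | cons a l ih =>
    rw [List.reverse_cons, List.flatMap_append, List.flatMap_cons]
    simpa using (h a (by simp)).append (ih fun i hi => h i (by simp [hi]))

theorem InversePair.of_ctrlOp {gs gs' : List (Gate ℕ)} {cs : List ℕ} {t : ℕ}
    {U : Matrix Bool Bool ℂ} (h1 : applyGates L F gs = ctrlOp cs t U)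
    (h2 : applyGates L F gs' = ctrlOp cs t Uᴴ) (hU : Uᴴ * U = 1) : InversePair L F gs gs' where
  adjoint u v := by rw [h1, h2, ctrlOp_adjoint]
  left u := by
    rw [h1, h2, ← LinearMap.comp_apply, ctrlOp_comp, hU, ctrlOp_one]; rfl
  right u := by
    rw [h1, h2, ← LinearMap.comp_apply, ctrlOp_comp, mul_eq_one_comm.1 hU, ctrlOp_one]; rfl

/-! ### Unitarity of the elementary matrices and inverses of circuits. -/

/-- The reflection `!![√p, √(1-p); √(1-p), -√p]` with `p = a/(a+b)`. -/
noncomputable def reflMatrix (a b : ℕ) : Matrix Bool Bool ℂ :=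
  fun v w =>
    let p : ℝ := (a : ℝ) / ((a : ℝ) + (b : ℝ))
    if v = w then (if v then -((Real.sqrt p : ℝ) : ℂ) else ((Real.sqrt p : ℝ) : ℂ))
    else ((Real.sqrt (1 - p) : ℝ) : ℂ)

/-- A rotation preceded by the sign change `diag(1, -1)` is a reflection. Reflections are
involutions, so this building block needs no separate inverse. -/
theorem rot_mul_phase (a b : ℕ) : rotMatrix a b * phaseMatrix 1 2 = reflMatrix a b := by
  have h : Complex.exp (2 * Real.pi * Complex.I * (((1 : ℕ) : ℂ) / ((2 : ℕ) : ℂ))) = -1 := by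
    rw [← Complex.exp_pi_mul_I]
    congr 1
    push_cast
    ring
  ext v w
  cases v <;> cases w <;>
    simp only [Matrix.mul_apply, Fintype.sum_bool, rotMatrix, phaseMatrix, reflMatrix, h] <;> simp

theorem reflMatrix_conjTranspose (a b : ℕ) : (reflMatrix a b)ᴴ = reflMatrix a b := by
  ext v w
  cases v <;> cases w <;> simp [reflMatrix, Matrix.conjTranspose_apply]

theorem reflMatrix_sq (a b : ℕ) : reflMatrix a b * reflMatrix a b = 1 := by
  set p : ℝ := (a : ℝ) / ((a : ℝ) + (b : ℝ)) with hp
  have h0 : 0 ≤ p := by positivity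
  have h1 : p ≤ 1 := div_le_one_of_le₀ (by linarith [(Nat.cast_nonneg b : (0:ℝ) ≤ b)]) (by positivity)
  have e : ((Real.sqrt p : ℝ) : ℂ) * ((Real.sqrt p : ℝ) : ℂ) +
      ((Real.sqrt (1 - p) : ℝ) : ℂ) * ((Real.sqrt (1 - p) : ℝ) : ℂ) = 1 := by
    rw [← Complex.ofReal_mul, ← Complex.ofReal_mul, Real.mul_self_sqrt h0,
      Real.mul_self_sqrt (by linarith)]
    push_cast
    ring
  ext v w
  cases v <;> cases w <;>
    simp only [Matrix.mul_apply, Fintype.sum_bool, reflMatrix, ← hp, Matrix.one_apply] <;> simp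
  · linear_combination e
  · ring
  · ring
  · linear_combination e

theorem notMatrix_conjTranspose : notMatrixᴴ = notMatrix := by
  ext v w
  cases v <;> cases w <;> simp [notMatrix, Matrix.conjTranspose_apply]

theorem notMatrix_sq : notMatrix * notMatrix = 1 := by
  ext v w
  cases v <;> cases w <;> simp [notMatrix, Matrix.mul_apply]

/-- Gate parameters are natural numbers, so the inverse phase `-a / b` is replaced by `a (b - 1) /
b`, which differs from it by the integer `a`. -/
theorem phaseMatrix_conjTranspose (a b : ℕ) :
    (phaseMatrix a b)ᴴ = phaseMatrix (a * (b - 1)) b := by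
  have h : conj (Complex.exp (2 * Real.pi * Complex.I * ((a : ℂ) / (b : ℂ)))) =
      Complex.exp (2 * Real.pi * Complex.I * (((a * (b - 1) : ℕ) : ℂ) / (b : ℂ))) := by
    rw [← Complex.exp_conj]
    simp only [map_mul, map_div₀, Complex.conj_I, Complex.conj_ofReal, map_natCast, map_ofNat]
    -- For `b = 0` division by zero makes both exponents vanish.
    rcases Nat.eq_zero_or_pos b with rfl | hb
    · simp
    · rw [Complex.exp_eq_exp_iff_exists_int]
      refine ⟨-a, ?_⟩
      have hb' : (b : ℂ) ≠ 0 := by exact_mod_cast hb.ne'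
      push_cast [Nat.cast_sub (show 1 ≤ b from hb)]
      field_simp
      ring
  ext v w
  cases v <;> cases w <;> simp only [phaseMatrix, Matrix.conjTranspose_apply]
  · simp
  · simp
  · simp
  · simpa using h

theorem phaseMatrix_conj (a b : ℕ) :
    (phaseMatrix a b)ᴴ * phaseMatrix a b = 1 := by
  have h : conj (Complex.exp (2 * Real.pi * Complex.I * ((a : ℂ) / (b : ℂ)))) *
      Complex.exp (2 * Real.pi * Complex.I * ((a : ℂ) / (b : ℂ))) = 1 := by
    rw [← Complex.exp_conj, ← Complex.exp_add]
    simp only [map_mul, map_div₀, Complex.conj_I, Complex.conj_ofReal, map_natCast, map_ofNat]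
    rw [← Complex.exp_zero]
    congr 1
    ring
  ext v w
  cases v <;> cases w <;>
    simp only [phaseMatrix, Matrix.conjTranspose_apply, Matrix.mul_apply, Fintype.sum_bool,
      Matrix.one_apply]
  · simp
  · simp
  · simp
  · simpa using h

theorem applyGates_singleton (g : Gate ℕ) : applyGates L F [g] = g.op L F := by
  simp [applyGates]

/-- When the blocks are disjoint, the first evaluation leaves the argument intact, so the second one
adds the same value modulo `2` and cancels it. -/
theorem queryConfig_queryConfig (x y : ℕ) (b : Config) :
    queryConfig L F x y (queryConfig L F x y b) = b := by
  by_cases h : x + k * L ≤ y ∨ y + L ≤ x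
  · have hread : ∀ i : Fin k, readField L (queryConfig L F x y b) (x + i * L) =
        readField L b (x + i * L) := by
      intro i
      unfold readField
      refine Finset.sum_congr rfl fun l hl => ?_
      rw [Finset.mem_range] at hl
      have h1 : (i : ℕ) * L + L ≤ k * L := by
        rw [← Nat.succ_mul]; exact Nat.mul_le_mul_right _ i.2
      have h2 : ¬ (y ≤ x + i * L + l ∧ x + i * L + l < y + L) := by omega
      simp only [queryConfig, if_pos h, if_neg h2]
    funext w
    conv_lhs => rw [queryConfig, if_pos h]
    simp only [hread]
    by_cases hw : y ≤ w ∧ w < y + L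
    · rw [if_pos hw, queryConfig, if_pos h, if_pos hw]
      simp
    · rw [if_neg hw, queryConfig, if_pos h, if_neg hw]
  · rw [queryConfig, if_neg h, queryConfig, if_neg h]

theorem Step.inversePair (s : Step ℕ) (dir : Bool) :
    InversePair L F (s.gates dir) (s.gates (!dir)) := by
  suffices h : InversePair L F (s.gates true) (s.gates false) by
    cases dir
    · exact h.symm
    · exact h
  cases s with
  | not t =>
    refine InversePair.of_ctrlOp (cs := []) (t := t) (U := notMatrix) (applyGates_singleton _) ?_ ?_
    · rw [notMatrix_conjTranspose]; exact applyGates_singleton _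
    · rw [notMatrix_conjTranspose, notMatrix_sq]
  | ccnot c d t =>
    refine InversePair.of_ctrlOp (cs := [c, d]) (t := t) (U := notMatrix)
      (applyGates_singleton _) ?_ ?_
    · rw [notMatrix_conjTranspose]; exact applyGates_singleton _
    · rw [notMatrix_conjTranspose, notMatrix_sq]
  | refl a b c t =>
    have h : applyGates L F ((Step.refl a b c t).gates true) = ctrlOp [c] t (reflMatrix a b) := by
      rw [← rot_mul_phase, ← ctrlOp_comp]
      simp only [Step.gates, applyGates, LinearMap.id_comp]
      rfl
    refine InversePair.of_ctrlOp h ?_ ?_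
    · rw [reflMatrix_conjTranspose]; exact h
    · rw [reflMatrix_conjTranspose, reflMatrix_sq]
  | cph a b c t =>
    refine InversePair.of_ctrlOp (cs := [c]) (t := t) (U := phaseMatrix a b)
      (applyGates_singleton _) ?_ (phaseMatrix_conj a b)
    rw [phaseMatrix_conjTranspose]; exact applyGates_singleton _
  | query x y =>
    have key : ∀ b, applyGates L F ((Step.query x y).gates true) (Finsupp.single b 1) =
        Finsupp.single (queryConfig L F x y b) 1 := by
      intro b
      simp [Step.gates, applyGates, Gate.op, Gate.onBasis]
    have inv : ∀ u, applyGates L F ((Step.query x y).gates true)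
        (applyGates L F ((Step.query x y).gates true) u) = u := by
      intro u
      rw [← LinearMap.comp_apply]
      conv_rhs => rw [← LinearMap.id_apply (R := ℂ) u]
      congr 1
      refine qstate_hom_ext fun b => ?_
      rw [LinearMap.comp_apply, key, key, queryConfig_queryConfig]; rfl
    refine ⟨fun u v => inner_adjoint_of_basis (fun b b' => ?_) u v, inv, inv⟩
    classical
    change conj (applyGates L F ((Step.query x y).gates true) _ _) =
      applyGates L F ((Step.query x y).gates true) _ _
    rw [key, key, Finsupp.single_apply, Finsupp.single_apply]
    have : queryConfig L F x y b = b' ↔ queryConfig L F x y b' = b :=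
      ⟨by rintro rfl; exact queryConfig_queryConfig _ _ _,
       by rintro rfl; exact queryConfig_queryConfig _ _ _⟩
    simp only [this]
    split_ifs <;> simp

/-- Sequences and loops are reversed together with their parts. The adjoint relation proved along
the way makes every circuit unitary, which later supplies all norms without computing amplitudes. -/
theorem Circ.inversePair (I : ℕ → ℕ) (α : ℕ → ℕ → ℕ) (c : Circ) :
    ∀ (dir : Bool) (δ : ℕ) (ρ : ℕ → ℕ),
      InversePair L F (c.gates I α dir δ ρ) (c.gates I α (!dir) δ ρ) := by
  induction c with
  | prim s =>
    intro dir δ ρ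
    simpa [gates] using Step.inversePair _ dir
  | seq c d ihc ihd =>
    intro dir δ ρ
    cases dir with
    | true => simpa [gates] using (ihc true δ ρ).append (ihd true δ ρ)
    | false => simpa [gates] using (ihd false δ ρ).append (ihc false δ ρ)
  | loop bound body ih =>
    intro dir δ ρ
    cases dir with
    | true =>
      simpa [gates] using InversePair.flatMap (L := L) (F := F) _ (fun i _ => ih true (δ + 1) (Function.update ρ δ i))
    | false =>
      simpa [gates] using InversePair.flatMap (L := L) (F := F) (List.range _).reverse (fun i _ => ih false (δ + 1) (Function.update ρ δ i))
  | rev c ih =>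
    intro dir δ ρ
    simpa [gates] using ih (!dir) δ ρ

end

end QAlg

namespace QAlg

/-! ## Classical circuits -/

/-- The action of a negation on configurations. -/
def Step.apply : Step ℕ → Config → Config
  | .not t, b => Function.update b t (!b t)
  | .ccnot c d t, b => if t = c ∨ t = d then b else Function.update b t (xor (b t) (b c && b d))
  | _, b => b

/-- Negations, possibly controlled. -/
def Step.IsClassical {α : Type} : Step α → Prop
  | .not _ => True
  | .ccnot _ _ _ => True
  | _ => False

/-- Circuits consisting of negations. -/
def Circ.IsClassical : Circ → Prop
  | .prim s => s.IsClassical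
  | .seq c d => c.IsClassical ∧ d.IsClassical
  | .loop _ body => body.IsClassical
  | .rev _ => False

/-- The action of a classical circuit on configurations. -/
def Circ.run (I : ℕ → ℕ) (α : ℕ → ℕ → ℕ) : ℕ → (ℕ → ℕ) → Circ → Config → Config
  | _, ρ, .prim s, b => (s.map (HExpr.eval I α ρ)).apply b
  | δ, ρ, .seq c d, b => d.run I α δ ρ (c.run I α δ ρ b)
  | δ, ρ, .loop bound body, b => (List.range (bound.eval I α ρ)).foldl
      (fun b i => body.run I α (δ + 1) (Function.update ρ δ i) b) b
  | _, _, .rev _, b => b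

/-- All steps of the circuit satisfy `Q`. -/
def Circ.All (I : ℕ → ℕ) (α : ℕ → ℕ → ℕ) (Q : Step ℕ → Prop) : ℕ → (ℕ → ℕ) → Circ → Prop
  | _, ρ, .prim s => Q (s.map (HExpr.eval I α ρ))
  | δ, ρ, .seq c d => c.All I α Q δ ρ ∧ d.All I α Q δ ρ
  | δ, ρ, .loop bound body => ∀ i < bound.eval I α ρ,
      body.All I α Q (δ + 1) (Function.update ρ δ i)
  | δ, ρ, .rev c => c.All I α Q δ ρ

theorem ctrlBasis_not (cs : List ℕ) (t : ℕ) (b : Config) :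
    ctrlBasis cs t notMatrix b = Finsupp.single
      (if t ∉ cs ∧ ∀ c ∈ cs, b c = true then Function.update b t (!b t) else b) 1 := by
  rw [ctrlBasis]
  split_ifs with h
  · cases hb : b t <;> simp [notMatrix]
  · rfl

section

variable {k L : ℕ} {F : (Fin k → ℕ) → ℕ} {I : ℕ → ℕ} {α : ℕ → ℕ → ℕ}

theorem applyGates_flatMap_range_succ (n : ℕ) (f : ℕ → List (Gate ℕ)) (u : QState) :
    applyGates L F ((List.range (n + 1)).flatMap f) u =
      applyGates L F (f n) (applyGates L F ((List.range n).flatMap f) u) := by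
  rw [List.range_succ, List.flatMap_append, applyGates_append]
  simp

theorem Step.applyGates_classical (s : Step ℕ) (hs : s.IsClassical) (b : Config) :
    applyGates L F (s.gates true) (Finsupp.single b 1) = Finsupp.single (s.apply b) 1 := by
  cases s with
  | not t =>
    simp [gates, applyGates, Gate.op, Gate.onBasis, ctrlBasis_not, apply]
  | ccnot c d t =>
    simp only [gates, applyGates, Gate.op, Gate.onBasis, ctrlBasis_not, apply, LinearMap.comp_apply,
      Finsupp.linearCombination_single, one_smul, LinearMap.id_apply]
    congr 1
    by_cases h : t = c ∨ t = d
    · simp only [List.mem_cons, List.not_mem_nil, or_false, h, not_true, false_and, if_false, if_true]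
    · simp only [List.mem_cons, List.not_mem_nil, or_false, h, not_false_eq_true, true_and, if_false,
        forall_eq_or_imp, forall_eq]
      cases hc : b c <;> cases hd : b d <;> simp
  | refl a b c t => exact hs.elim
  | cph a b c t => exact hs.elim
  | query x y => exact hs.elim

theorem Circ.applyGates_classical (c : Circ) : ∀ (δ : ℕ) (ρ : ℕ → ℕ), c.IsClassical → ∀ b,
    applyGates L F (c.gates I α true δ ρ) (Finsupp.single b 1) =
      Finsupp.single (c.run I α δ ρ b) 1 := by
  induction c with
  | prim s =>
    intro δ ρ h b
    simp only [gates, run]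
    exact Step.applyGates_classical _ (by cases s <;> simp_all [IsClassical, Step.IsClassical, Step.map]) b
  | seq c d ihc ihd =>
    intro δ ρ h b
    simp only [gates, run, applyGates_append, LinearMap.comp_apply, ihc δ ρ h.1, ihd δ ρ h.2]
  | loop bound body ih =>
    intro δ ρ h b
    simp only [gates, run]
    generalize bound.eval I α ρ = n
    induction n with
    | zero => simp [applyGates]
    | succ n ihn =>
      rw [applyGates_flatMap_range_succ, ihn, List.range_succ, List.foldl_append]
      simp only [List.foldl_cons, List.foldl_nil]
      exact ih _ _ h _
  | rev c => intro δ ρ h; exact h.elim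

/-- The wires written by a step satisfy `Q`. -/
def Step.Writes (L : ℕ) (Q : ℕ → Prop) : Step ℕ → Prop
  | .not t => Q t
  | .ccnot _ _ t => Q t
  | .refl _ _ _ t => Q t
  | .cph _ _ _ t => Q t
  | .query _ y => ∀ l < L, Q (y + l)

theorem Step.apply_of_writes {Q : ℕ → Prop} {s : Step ℕ} (hs : s.Writes L Q) (b : Config) {w : ℕ}
    (hw : ¬ Q w) : s.apply b w = b w := by
  cases s with
  | not t => exact Function.update_of_ne (by rintro rfl; exact hw hs) _ _
  | ccnot c d t =>
    rw [apply]
    split_ifs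
    · rfl
    · exact Function.update_of_ne (by rintro rfl; exact hw hs) _ _
  | refl a b c t => rfl
  | cph a b c t => rfl
  | query x y => rfl

theorem Circ.run_of_writes (L : ℕ) {Q : ℕ → Prop} {w : ℕ} (hw : ¬ Q w) (c : Circ) :
    ∀ (δ : ℕ) (ρ : ℕ → ℕ), c.All I α (Step.Writes L Q) δ ρ → ∀ b, c.run I α δ ρ b w = b w := by
  induction c with
  | prim s => intro δ ρ h b; exact Step.apply_of_writes h b hw
  | seq c d ihc ihd =>
    intro δ ρ h b
    rw [run, ihd δ ρ h.2, ihc δ ρ h.1]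
  | loop bound body ih =>
    intro δ ρ h b
    simp only [run]
    simp only [All] at h
    generalize bound.eval I α ρ = n at h
    induction n with
    | zero => simp
    | succ n ihn =>
      rw [List.range_succ, List.foldl_append]
      simp only [List.foldl_cons, List.foldl_nil]
      rw [ih _ _ (h n (by omega)), ihn fun i hi => h i (by omega)]
  | rev c => intro δ ρ h b; rfl

theorem Step.apply_congr {Q : ℕ → Prop} {s : Step ℕ} (hs : ∀ x ∈ s.operands, Q x)
    {b b' : Config} (hb : ∀ w, Q w → b w = b' w) {w : ℕ} (hw : Q w) :
    s.apply b w = s.apply b' w := by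
  cases s with
  | not t =>
    simp only [operands, List.mem_singleton, forall_eq] at hs
    simp only [apply, Function.update_apply, hb w hw, hb t hs]
  | ccnot c d t =>
    simp only [operands, List.mem_cons, forall_eq_or_imp, List.not_mem_nil] at hs
    simp only [apply]
    split_ifs
    · exact hb w hw
    · simp only [Function.update_apply, hb w hw, hb t hs.2.2.1, hb c hs.1, hb d hs.2.1]
  | refl a b c t => exact hb w hw
  | cph a b c t => exact hb w hw
  | query x y => exact hb w hw

/-- If all operands lie in `Q`, what happens outside `Q` has no influence inside. This lets the
conversion to binary commute with the evaluation of the function. -/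
theorem Circ.run_congr {Q : ℕ → Prop} (c : Circ) :
    ∀ (δ : ℕ) (ρ : ℕ → ℕ), c.All I α (fun s => ∀ x ∈ s.operands, Q x) δ ρ →
    ∀ b b' : Config, (∀ w, Q w → b w = b' w) → ∀ w, Q w →
      c.run I α δ ρ b w = c.run I α δ ρ b' w := by
  induction c with
  | prim s => intro δ ρ h b b' hb w hw; exact Step.apply_congr h hb hw
  | seq c d ihc ihd =>
    intro δ ρ h b b' hb
    exact ihd δ ρ h.2 _ _ (ihc δ ρ h.1 b b' hb)
  | loop bound body ih =>
    intro δ ρ h b b' hb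
    simp only [run]
    simp only [All] at h
    generalize bound.eval I α ρ = n at h
    induction n with
    | zero => simpa using hb
    | succ n ihn =>
      rw [List.range_succ, List.foldl_append, List.foldl_append]
      simp only [List.foldl_cons, List.foldl_nil]
      exact ih _ _ (h n (by omega)) _ _ (ihn fun i hi => h i (by omega))
  | rev c => intro δ ρ h b b' hb; exact hb

/-! ## Circuits writing only to some of the wires -/

/-- The states all of whose configurations agree with `b₀` outside `Q`. -/
noncomputable def agreeing (Q : ℕ → Prop) (b₀ : Config) : Submodule ℂ QState :=
  Finsupp.supported ℂ ℂ {b | ∀ w, ¬ Q w → b w = b₀ w}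

theorem single_mem_agreeing {Q : ℕ → Prop} {b₀ b : Config} (h : ∀ w, ¬ Q w → b w = b₀ w) (c : ℂ) :
    Finsupp.single b c ∈ agreeing Q b₀ :=
  Finsupp.single_mem_supported ℂ c h

theorem map_mem_agreeing {Q : ℕ → Prop} {b₀ : Config} {A : QState →ₗ[ℂ] QState}
    (h : ∀ b, (∀ w, ¬ Q w → b w = b₀ w) → A (Finsupp.single b 1) ∈ agreeing Q b₀)
    {u : QState} (hu : u ∈ agreeing Q b₀) : A u ∈ agreeing Q b₀ := by
  have h1 : u = ∑ b ∈ u.support, u b • Finsupp.single b 1 := by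
    conv_lhs => rw [← Finsupp.sum_single u]
    simp [Finsupp.sum]
  rw [h1, map_sum]
  refine Submodule.sum_mem _ fun b hb => ?_
  rw [map_smul]
  exact Submodule.smul_mem _ _ (h b ((Finsupp.mem_supported ℂ u).1 hu hb))

theorem ctrlOp_mem_agreeing {Q : ℕ → Prop} {b₀ : Config} {t : ℕ} (ht : Q t) (cs : List ℕ)
    (U : Matrix Bool Bool ℂ) {u : QState} (hu : u ∈ agreeing Q b₀) :
    ctrlOp cs t U u ∈ agreeing Q b₀ := by
  refine map_mem_agreeing (fun b hb => ?_) hu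
  rw [ctrlOp_single, ctrlBasis]
  split_ifs
  · refine Submodule.sum_mem _ fun v _ => single_mem_agreeing (fun w hw => ?_) _
    rw [Function.update_of_ne (by rintro rfl; exact hw ht), hb w hw]
  · exact single_mem_agreeing hb 1

theorem Step.mem_agreeing {Q : ℕ → Prop} {b₀ : Config} {s : Step ℕ} (hs : s.Writes L Q)
    (dir : Bool) {u : QState} (hu : u ∈ agreeing Q b₀) :
    applyGates L F (s.gates dir) u ∈ agreeing Q b₀ := by
  cases s with
  | not t => exact ctrlOp_mem_agreeing hs _ _ hu
  | ccnot c d t => exact ctrlOp_mem_agreeing hs _ _ hu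
  | refl a b c t =>
    exact ctrlOp_mem_agreeing hs [c] (rotMatrix a b)
      (ctrlOp_mem_agreeing hs [c] (phaseMatrix 1 2) hu)
  | cph a b c t => exact ctrlOp_mem_agreeing hs [c] _ hu
  | query x y =>
    refine map_mem_agreeing (fun b hb => ?_) hu
    simp only [gates, applyGates, Gate.op, Gate.onBasis, LinearMap.id_comp,
      Finsupp.linearCombination_single, one_smul]
    refine single_mem_agreeing (fun w hw => ?_) 1
    rw [← hb w hw, queryConfig]
    split_ifs with h1
    · have : ¬ (y ≤ w ∧ w < y + L) := by
        rintro ⟨h2, h3⟩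
        have := hs (w - y) (by omega)
        rw [Nat.add_sub_cancel' h2] at this
        exact hw this
      simp [this]
    · rfl

theorem applyGates_flatMap_mem {Q : ℕ → Prop} {b₀ : Config} (l : List ℕ)
    {f : ℕ → List (Gate ℕ)}
    (h : ∀ i ∈ l, ∀ u ∈ agreeing Q b₀, applyGates L F (f i) u ∈ agreeing Q b₀) :
    ∀ u ∈ agreeing Q b₀, applyGates L F (l.flatMap f) u ∈ agreeing Q b₀ := by
  induction l with
  | nil => intro u hu; exact hu
  | cons a l ih =>
    intro u hu
    rw [List.flatMap_cons, applyGates_append]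
    exact ih (fun i hi => h i (by simp [hi])) _ (h a (by simp) u hu)

/-- This confines a state to finitely many wires. The reflection about the initial state can only
test finitely many of them. -/
theorem Circ.mem_agreeing {Q : ℕ → Prop} {b₀ : Config} (c : Circ) :
    ∀ (dir : Bool) (δ : ℕ) (ρ : ℕ → ℕ), c.All I α (Step.Writes L Q) δ ρ →
    ∀ u ∈ agreeing Q b₀, applyGates L F (c.gates I α dir δ ρ) u ∈ agreeing Q b₀ := by
  induction c with
  | prim s =>
    intro dir δ ρ h u hu
    simp only [gates]
    exact Step.mem_agreeing h dir hu
  | seq c d ihc ihd =>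
    intro dir δ ρ h u hu
    cases dir with
    | true =>
      simp only [gates, applyGates_append, LinearMap.comp_apply]
      exact ihd _ _ _ h.2 _ (ihc _ _ _ h.1 _ hu)
    | false =>
      simp only [gates, applyGates_append, LinearMap.comp_apply]
      exact ihc _ _ _ h.1 _ (ihd _ _ _ h.2 _ hu)
  | loop bound body ih =>
    intro dir δ ρ h u hu
    cases dir with
    | true =>
      simp only [gates]
      exact applyGates_flatMap_mem _ (fun i hi => ih _ _ _ (h i (List.mem_range.1 hi))) u hu
    | false =>
      simp only [gates]
      exact applyGates_flatMap_mem _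
        (fun i hi => ih _ _ _ (h i (List.mem_range.1 (List.mem_reverse.1 hi)))) u hu
  | rev c ih =>
    intro dir δ ρ h u hu
    simp only [gates]
    exact ih _ _ _ h u hu

end

/-! ## Positional notation -/

/-- The number with the digits `f 0, …, f (t - 1)` in base `B`. -/
def digitSum (B : ℕ) (f : ℕ → ℕ) (t : ℕ) : ℕ := ∑ i ∈ Finset.range t, f i * B ^ i

theorem digitSum_succ (B : ℕ) (f : ℕ → ℕ) (t : ℕ) :
    digitSum B f (t + 1) = digitSum B f t + f t * B ^ t := Finset.sum_range_succ _ _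

theorem digitSum_lt {B : ℕ} {f : ℕ → ℕ} {t : ℕ} (h : ∀ i < t, f i < B) : digitSum B f t < B ^ t := by
  induction t with
  | zero => simp [digitSum]
  | succ t ih =>
    rw [digitSum_succ, pow_succ]
    have h1 := ih fun i hi => h i (by omega)
    have h2 := Nat.mul_le_mul_right (B ^ t) (Nat.succ_le_of_lt (h t (by omega)))
    rw [Nat.succ_mul] at h2
    rw [mul_comm (B ^ t) B]
    omega

theorem digitSum_add (B : ℕ) (f : ℕ → ℕ) (s t : ℕ) :
    digitSum B f (s + t) = digitSum B f s + B ^ s * digitSum B (fun i => f (s + i)) t := by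
  rw [digitSum, Finset.sum_range_add, digitSum, digitSum, Finset.mul_sum]
  congr 1
  refine Finset.sum_congr rfl fun i _ => ?_
  rw [pow_add]
  ring

theorem digitSum_digits {B : ℕ} (f : ℕ → ℕ) {s t u : ℕ} (h : ∀ i < s + t + u, f i < B) :
    digitSum B f (s + t + u) / B ^ s % B ^ t = digitSum B (fun i => f (s + i)) t := by
  rcases Nat.eq_zero_or_pos B with rfl | hB
  · have h0 : s + t + u = 0 := by
      by_contra hne
      exact absurd (h 0 (by omega)) (by omega)
    have hs : s = 0 := by omega
    have ht : t = 0 := by omega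
    subst hs ht
    simp [digitSum, Nat.mod_one]
  · have h1 : digitSum B f s < B ^ s := digitSum_lt fun i hi => h i (by omega)
    have h2 : digitSum B (fun i => f (s + i)) t < B ^ t := digitSum_lt fun i hi => h _ (by omega)
    rw [add_assoc, digitSum_add, Nat.add_mul_div_left _ _ (by positivity), Nat.div_eq_of_lt h1,
      zero_add, digitSum_add, Nat.add_mul_mod_self_left, Nat.mod_eq_of_lt h2]

theorem digitSum_testBit (x t : ℕ) :
    digitSum 2 (fun i => (x.testBit i).toNat) t = x % 2 ^ t := by
  induction t with
  | zero => simp [digitSum, Nat.mod_one]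
  | succ t ih => rw [digitSum_succ, ih, pow_succ, Nat.mod_mul, Nat.toNat_testBit]; ring

theorem readField_eq (L : ℕ) (b : Config) (a : ℕ) :
    readField L b a = digitSum 2 (fun i => (b (a + i)).toNat) L := by
  unfold readField digitSum
  refine Finset.sum_congr rfl fun i _ => ?_
  cases h : b (a + i) <;> simp [h]

/-- The same number is written with `k * L` binary digits and with `k` digits in base `2 ^ L`.
Cutting out the block at position `j` by division and remainder gives the field on one side and `x
j` on the other. -/
theorem readField_subfield {k L : ℕ} {b : Config} {a : ℕ} {x : ℕ → ℕ} (hx : ∀ i < k, x i < 2 ^ L)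
    (h : digitSum 2 (fun i => (b (a + i)).toNat) (k * L) = digitSum (2 ^ L) x k) {j : ℕ} (hj : j < k) :
    readField L b (a + j * L) = x j := by
  obtain ⟨u, rfl⟩ : ∃ u, k = j + 1 + u := ⟨k - (j + 1), by omega⟩
  have h1 := digitSum_digits (B := 2) (fun i => (b (a + i)).toNat) (s := j * L) (t := L)
    (u := u * L) fun i _ => by cases b (a + i) <;> simp
  have h2 := digitSum_digits (B := 2 ^ L) x (s := j) (t := 1) (u := u) hx
  have e : j * L + L + u * L = (j + 1 + u) * L := by ring
  rw [e, h] at h1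
  rw [← pow_mul, mul_comm L j, pow_one] at h2
  rw [readField_eq]
  simp only [add_assoc]
  rw [← h1, h2]
  simp [digitSum]

end QAlg

namespace QAlg

/-! ## Layout of the wires

Array `0` holds the numbers `n` of digits, `K` of bits of a group element, `L` of bits of a
coordinate, the stride `S`, and the number `N` of wires; the arrays `1`, …, `4` hold the radix, the
input weight, the output weight and the coordinate of each digit, and array `5` the powers of `2`.
The wires start with the output, the argument of the query, and the value of the query. -/

/-- The number of digits. -/
abbrev digitCount (α : ℕ → ℕ → ℕ) : ℕ := α 0 0
/-- The number of bits of a group element. -/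
abbrev totalBits (α : ℕ → ℕ → ℕ) : ℕ := α 0 1
/-- The number of bits of a coordinate. -/
abbrev fieldBits (α : ℕ → ℕ → ℕ) : ℕ := α 0 2
/-- The distance between the blocks of wires of consecutive digits. -/
abbrev stride (α : ℕ → ℕ → ℕ) : ℕ := α 0 3
/-- The number of wires. -/
abbrev wireCount (α : ℕ → ℕ → ℕ) : ℕ := α 0 4
/-- The radix of a digit. -/
abbrev radix (α : ℕ → ℕ → ℕ) (l : ℕ) : ℕ := α 1 l
/-- The contribution of a digit to a group element in binary, for the weights in array `a`. -/
abbrev digitWeight (α : ℕ → ℕ → ℕ) (a l : ℕ) : ℕ := α a l * α 5 (α 4 l * fieldBits α)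

/-- Entry `i` of array `0`. -/
def scalar (i : ℕ) : HExpr := .arr 0 (.lit i)

/-- The `i`-th wire of kind `tag` belonging to digit `l`. -/
def wire (α : ℕ → ℕ → ℕ) (tag l i : ℕ) : ℕ :=
  2 * totalBits α + fieldBits α + (16 * (l * stride α + i) + tag)

/-- The expression for `wire`. -/
def wireE (tag : ℕ) (l i : HExpr) : HExpr :=
  .add (.add (.mul (.lit 2) (scalar 1)) (scalar 2))
    (.add (.mul (.lit 16) (.add (.mul l (scalar 3)) i)) (.lit tag))

/-- The expression for `digitWeight` of the digit given by the outermost loop counter. -/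
def weightE (a : ℕ) : HExpr :=
  .mul (.arr a (.ctr 0)) (.arr 5 (.mul (.arr 4 (.ctr 0)) (scalar 2)))

@[simp] theorem eval_scalar (I : ℕ → ℕ) (α : ℕ → ℕ → ℕ) (ρ : ℕ → ℕ) (i : ℕ) :
    (scalar i).eval I α ρ = α 0 i := rfl

@[simp] theorem eval_wireE (I : ℕ → ℕ) (α : ℕ → ℕ → ℕ) (ρ : ℕ → ℕ) (tag : ℕ) (l i : HExpr) :
    (wireE tag l i).eval I α ρ = wire α tag (l.eval I α ρ) (i.eval I α ρ) := rfl

@[simp] theorem eval_weightE (I : ℕ → ℕ) (α : ℕ → ℕ → ℕ) (ρ : ℕ → ℕ) (a : ℕ) :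
    (weightE a).eval I α ρ = digitWeight α a (ρ 0) := rfl

/-- A controlled negation. -/
def cnot (c t : HExpr) : Circ := .prim (.ccnot c c t)

/-- The wire that is constantly `1`. -/
def oneE : HExpr := wireE 7 (.lit 0) (.lit 0)

/-- Adding a bit of the input and a bit of the addend, for the bit given by loop counter `1`. -/
def addBit : Circ :=
  .seq (.seq (.seq (.prim (.ccnot (wireE 4 (.ctr 0) (.ctr 1)) (wireE 2 (.ctr 0) (.ctr 1))
      (wireE 3 (.ctr 0) (.add (.ctr 1) (.lit 1)))))
    (.prim (.ccnot (wireE 4 (.ctr 0) (.ctr 1)) (wireE 3 (.ctr 0) (.ctr 1))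
      (wireE 3 (.ctr 0) (.add (.ctr 1) (.lit 1))))))
    (.prim (.ccnot (wireE 2 (.ctr 0) (.ctr 1)) (wireE 3 (.ctr 0) (.ctr 1))
      (wireE 3 (.ctr 0) (.add (.ctr 1) (.lit 1))))))
  (.seq (.seq (cnot (wireE 4 (.ctr 0) (.ctr 1)) (wireE 4 (.add (.ctr 0) (.lit 1)) (.ctr 1)))
    (cnot (wireE 2 (.ctr 0) (.ctr 1)) (wireE 4 (.add (.ctr 0) (.lit 1)) (.ctr 1))))
    (cnot (wireE 3 (.ctr 0) (.ctr 1)) (wireE 4 (.add (.ctr 0) (.lit 1)) (.ctr 1))))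

/-- Writing the contribution of a digit in binary. -/
def loadAddend (tag a : ℕ) : Circ :=
  .loop (.arr 1 (.ctr 0)) (.loop (scalar 1) (.prim (.ccnot (wireE tag (.ctr 0) (.ctr 1))
    (.add (wireE 6 (.lit 0) (.lit 0))
      (.mod (.div (.mul (.ctr 1) (weightE a)) (.arr 5 (.ctr 2))) (.lit 2)))
    (wireE 2 (.ctr 0) (.ctr 2)))))

/-- Converting the one-hot digits of kind `tag` into a binary number on the wires from `base` on,
using the weights in array `a`. -/
def toBinary (tag a : ℕ) (base : HExpr) : Circ :=
  .seq (.loop (scalar 0) (.seq (loadAddend tag a) (.loop (scalar 1) addBit)))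
    (.loop (scalar 1) (cnot (wireE 4 (scalar 0) (.ctr 0)) (.add base (.ctr 0))))

/-! ## Addition -/

/-- Past the common offset, the tag is the residue modulo `16`, and the pair `(l, i)` is recovered
by division by the stride. -/
theorem wire_inj {α : ℕ → ℕ → ℕ} {tag tag' l l' i i' : ℕ} (ht : tag < 16) (ht' : tag' < 16)
    (hi : i < stride α) (hi' : i' < stride α) :
    wire α tag l i = wire α tag' l' i' ↔ tag = tag' ∧ l = l' ∧ i = i' := by
  constructor
  · intro h
    unfold wire at h
    have h1 : tag = tag' := by omega
    have h2 : l * stride α + i = l' * stride α + i' := by omega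
    have h3 : l = l' := by
      have e := congrArg (· / stride α) h2
      simp only [mul_comm _ (stride α), Nat.mul_add_div (show 0 < stride α by omega),
        Nat.div_eq_of_lt hi, Nat.div_eq_of_lt hi', add_zero] at e
      exact e
    subst h3
    exact ⟨h1, rfl, by omega⟩
  · rintro ⟨rfl, rfl, rfl⟩; rfl

theorem wire_tag_ne {α : ℕ → ℕ → ℕ} {tag tag' : ℕ} (l l' i i' : ℕ) (ht : tag < 16) (ht' : tag' < 16)
    (h : tag ≠ tag') : wire α tag l i ≠ wire α tag' l' i' := by
  unfold wire
  omega

theorem ccnot_apply {c d t : ℕ} (hc : t ≠ c) (hd : t ≠ d) (b : Config) :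
    (Step.ccnot c d t).apply b = Function.update b t (xor (b t) (b c && b d)) := by
  simp [Step.apply, hc, hd]

/-- This is a full adder. The three Toffoli gates add the majority of the three bits, which is the
sum modulo `2` of their pairwise products, to the next carry; the three controlled negations add
their parity to the new sum bit. -/
theorem addBit_run (I : ℕ → ℕ) (α : ℕ → ℕ → ℕ) (δ : ℕ) (ρ : ℕ → ℕ) (b : Config)
    (hS : ρ 1 + 1 < stride α) :
    addBit.run I α δ ρ b =
      Function.update (Function.update b (wire α 3 (ρ 0) (ρ 1 + 1))
        (xor (b (wire α 3 (ρ 0) (ρ 1 + 1))) (xor (xor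
          (b (wire α 4 (ρ 0) (ρ 1)) && b (wire α 2 (ρ 0) (ρ 1)))
          (b (wire α 4 (ρ 0) (ρ 1)) && b (wire α 3 (ρ 0) (ρ 1))))
          (b (wire α 2 (ρ 0) (ρ 1)) && b (wire α 3 (ρ 0) (ρ 1))))))
        (wire α 4 (ρ 0 + 1) (ρ 1))
        (xor (b (wire α 4 (ρ 0 + 1) (ρ 1))) (xor (xor (b (wire α 4 (ρ 0) (ρ 1)))
          (b (wire α 2 (ρ 0) (ρ 1)))) (b (wire α 3 (ρ 0) (ρ 1))))) := by
  simp only [addBit, cnot, Circ.run, Step.map, eval_wireE, HExpr.eval]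
  generalize hs : wire α 4 (ρ 0) (ρ 1) = s
  generalize ha : wire α 2 (ρ 0) (ρ 1) = a
  generalize hc : wire α 3 (ρ 0) (ρ 1) = c
  generalize hs' : wire α 4 (ρ 0 + 1) (ρ 1) = s'
  generalize hc' : wire α 3 (ρ 0) (ρ 1 + 1) = c'
  have h1 : c' ≠ s := by rw [← hs, ← hc']; exact wire_tag_ne _ _ _ _ (by omega) (by omega) (by omega)
  have h2 : c' ≠ a := by rw [← ha, ← hc']; exact wire_tag_ne _ _ _ _ (by omega) (by omega) (by omega)
  have h3 : c' ≠ c := by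
    rw [← hc, ← hc', Ne, wire_inj (by omega) (by omega) (by omega) (by omega)]; omega
  have h4 : c' ≠ s' := by rw [← hs', ← hc']; exact wire_tag_ne _ _ _ _ (by omega) (by omega) (by omega)
  have h5 : s' ≠ s := by
    rw [← hs', ← hs, Ne, wire_inj (by omega) (by omega) (by omega) (by omega)]; omega
  have h6 : s' ≠ a := by rw [← hs', ← ha]; exact wire_tag_ne _ _ _ _ (by omega) (by omega) (by omega)
  have h7 : s' ≠ c := by rw [← hs', ← hc]; exact wire_tag_ne _ _ _ _ (by omega) (by omega) (by omega)
  simp only [ccnot_apply h1 h2, ccnot_apply h1 h3, ccnot_apply h2 h3, ccnot_apply h5 h5,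
    ccnot_apply h6 h6, ccnot_apply h7 h7]
  simp [h1.symm, h2.symm, h3.symm, h4.symm, h6.symm, h7.symm, Function.update_of_ne]

/-- Successive modifications of distinct wires by functions of the other wires. -/
theorem foldl_write (n : ℕ) (f : Config → ℕ → Config) (t : ℕ → ℕ) (g : ℕ → Config → Bool)
    (b : Config) (hinj : ∀ i < n, ∀ j < n, t i = t j → i = j)
    (hf : ∀ i < n, ∀ b, f b i = Function.update b (t i) (xor (b (t i)) (g i b)))
    (hg : ∀ i < n, ∀ b', (∀ w, (∀ j < n, w ≠ t j) → b' w = b w) → g i b' = g i b) :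
    (∀ i < n, (List.range n).foldl f b (t i) = xor (b (t i)) (g i b)) ∧
      ∀ w, (∀ i < n, w ≠ t i) → (List.range n).foldl f b w = b w := by
  suffices h : ∀ m ≤ n, (∀ i < m, (List.range m).foldl f b (t i) = xor (b (t i)) (g i b)) ∧
      ∀ w, (∀ i < m, w ≠ t i) → (List.range m).foldl f b w = b w from h n le_rfl
  intro m
  induction m with
  | zero => intro _; simp
  | succ m ih =>
    intro hm
    obtain ⟨h1, h2⟩ := ih (by omega)
    rw [List.range_succ, List.foldl_append, List.foldl_cons, List.foldl_nil, hf m (by omega)]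
    constructor
    · intro i hi
      by_cases him : i = m
      · subst him
        rw [Function.update_self, h2 _ fun j hj h => ?_, hg i (by omega)]
        · intro w hw
          exact h2 w fun j hj => hw j (by omega)
        · have := hinj _ (by omega) _ (by omega) h; omega
      · rw [Function.update_of_ne fun h => him (hinj _ (by omega) _ (by omega) h)]
        exact h1 i (by omega)
    · intro w hw
      rw [Function.update_of_ne (hw m (by omega))]
      exact h2 w fun i hi => hw i (by omega)

/-- The wires `i < t` of kind `tag` of digit `l`, read as a binary number. -/
def wireSum (α : ℕ → ℕ → ℕ) (b : Config) (tag l t : ℕ) : ℕ :=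
  digitSum 2 (fun i => (b (wire α tag l i)).toNat) t

/-- The configuration has the value `v` on the one-hot register of kind `tag` for digit `l`. -/
def OneHot (α : ℕ → ℕ → ℕ) (b : Config) (tag l v : ℕ) : Prop :=
  ∀ u < radix α l, b (wire α tag l u) = decide (u = v)

/-- The conditions under which conversion to binary works. -/
structure Layout (α : ℕ → ℕ → ℕ) : Prop where
  totalBits_lt : totalBits α < stride α
  radix_le : ∀ l < digitCount α, radix α l ≤ stride α
  radix_pos : ∀ l < digitCount α, 0 < radix α l
  pow : ∀ i < totalBits α, α 5 i = 2 ^ i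
  wireCount_eq : wireCount α = 2 * totalBits α + fieldBits α + 16 * ((digitCount α + 1) * stride α)

/-- In a one-hot register only the wire of the actual value is set, so of all controlled copies only
the one for `u = v` has an effect. -/
theorem loadAddend_run {α : ℕ → ℕ → ℕ} (hα : Layout α) (I : ℕ → ℕ) (ρ : ℕ → ℕ) {tag : ℕ}
    (htag : tag < 2) (a : ℕ) {b : Config} {v : ℕ} (hv : v < radix α (ρ 0))
    (hb : OneHot α b tag (ρ 0) v) (h1 : b (wire α 7 0 0) = true) (h0 : b (wire α 6 0 0) = false)
    (hfresh : ∀ i < totalBits α, b (wire α 2 (ρ 0) i) = false) :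
    (∀ i < totalBits α, (loadAddend tag a).run I α 1 ρ b (wire α 2 (ρ 0) i) =
      (v * digitWeight α a (ρ 0)).testBit i) ∧
    ∀ w, (∀ i < totalBits α, w ≠ wire α 2 (ρ 0) i) → (loadAddend tag a).run I α 1 ρ b w = b w := by
  have hS := hα.totalBits_lt
  have hinner : ∀ u < radix α (ρ 0), ∀ b' : Config,
      (∀ w, (∀ i < totalBits α, w ≠ wire α 2 (ρ 0) i) → b' w = b w) →
      (∀ i < totalBits α, (Circ.loop (scalar 1) (.prim (.ccnot (wireE tag (.ctr 0) (.ctr 1))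
        (.add (wireE 6 (.lit 0) (.lit 0))
          (.mod (.div (.mul (.ctr 1) (weightE a)) (.arr 5 (.ctr 2))) (.lit 2)))
        (wireE 2 (.ctr 0) (.ctr 2))))).run I α 2 (Function.update ρ 1 u) b' (wire α 2 (ρ 0) i) =
        xor (b' (wire α 2 (ρ 0) i)) (decide (u = v) && (u * digitWeight α a (ρ 0)).testBit i)) ∧
      ∀ w, (∀ i < totalBits α, w ≠ wire α 2 (ρ 0) i) →
        (Circ.loop (scalar 1) (.prim (.ccnot (wireE tag (.ctr 0) (.ctr 1))
        (.add (wireE 6 (.lit 0) (.lit 0))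
          (.mod (.div (.mul (.ctr 1) (weightE a)) (.arr 5 (.ctr 2))) (.lit 2)))
        (wireE 2 (.ctr 0) (.ctr 2))))).run I α 2 (Function.update ρ 1 u) b' w = b' w := by
    intro u hu b' hb'
    simp only [Circ.run, Step.map, eval_scalar, HExpr.eval, eval_wireE, eval_weightE]
    simp only [Function.update_self, ne_eq, not_false_eq_true,
      Function.update_of_ne, OfNat.zero_ne_ofNat, zero_ne_one, OfNat.one_ne_ofNat]
    -- The second control makes the Toffoli gate depend on a classically computed bit. Tag `6` is
    -- constantly `0` and tag `7` constantly `1`, and the bit is added to the address of the former.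
    have hctrl : ∀ i < totalBits α,
        b (wire α 6 0 0 + u * digitWeight α a (ρ 0) / α 5 i % 2) =
          (u * digitWeight α a (ρ 0)).testBit i := by
      intro i hi
      rw [hα.pow i hi, Nat.testBit_eq_decide_div_mod_eq]
      rcases Nat.mod_two_eq_zero_or_one (u * digitWeight α a (ρ 0) / 2 ^ i) with h | h
      · rw [h, add_zero, h0]; simp
      · rw [h, show wire α 6 0 0 + 1 = wire α 7 0 0 from rfl, h1]; simp
    have hctrl_ne : ∀ i j : ℕ, wire α 2 (ρ 0) j ≠
        wire α 6 0 0 + u * digitWeight α a (ρ 0) / α 5 i % 2 := by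
      intro i j
      have := Nat.mod_lt (u * digitWeight α a (ρ 0) / α 5 i) (show 0 < 2 by norm_num)
      unfold wire
      omega
    have key := foldl_write (totalBits α)
      (fun b i => (Step.ccnot (wire α tag (ρ 0) u)
        (wire α 6 0 0 + u * digitWeight α a (ρ 0) / α 5 i % 2) (wire α 2 (ρ 0) i)).apply b)
      (fun i => wire α 2 (ρ 0) i)
      (fun i b => b (wire α tag (ρ 0) u) && b (wire α 6 0 0 + u * digitWeight α a (ρ 0) / α 5 i % 2))
      b' (fun i hi j hj h => ((wire_inj (by omega) (by omega) (by omega) (by omega)).1 h).2.2)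
      (fun i hi b => ccnot_apply (wire_tag_ne _ _ _ _ (by omega) (by omega) (by omega))
        (hctrl_ne i i) b)
      (fun i hi b'' hb'' => by
        rw [hb'' _ fun j hj => wire_tag_ne _ _ _ _ (by omega) (by omega) (by omega),
          hb'' _ fun j hj => (hctrl_ne i j).symm])
    refine ⟨fun i hi => ?_, key.2⟩
    have e1 := hb' (wire α tag (ρ 0) u) fun j hj =>
      wire_tag_ne _ _ _ _ (by omega) (by omega) (by omega)
    have e2 := hb' _ fun j hj => (hctrl_ne i j).symm
    rw [key.1 i hi, e1, hb u hu, e2, hctrl i hi]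
  -- After the values below `m` have been treated, the addend is present exactly if `v < m`.
  suffices h : ∀ m ≤ radix α (ρ 0), (∀ i < totalBits α, (List.range m).foldl (fun b u =>
      (Circ.loop (scalar 1) (.prim (.ccnot (wireE tag (.ctr 0) (.ctr 1))
        (.add (wireE 6 (.lit 0) (.lit 0))
          (.mod (.div (.mul (.ctr 1) (weightE a)) (.arr 5 (.ctr 2))) (.lit 2)))
        (wireE 2 (.ctr 0) (.ctr 2))))).run I α 2 (Function.update ρ 1 u) b) b (wire α 2 (ρ 0) i) =
      (decide (v < m) && (v * digitWeight α a (ρ 0)).testBit i)) ∧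
      ∀ w, (∀ i < totalBits α, w ≠ wire α 2 (ρ 0) i) → (List.range m).foldl (fun b u =>
      (Circ.loop (scalar 1) (.prim (.ccnot (wireE tag (.ctr 0) (.ctr 1))
        (.add (wireE 6 (.lit 0) (.lit 0))
          (.mod (.div (.mul (.ctr 1) (weightE a)) (.arr 5 (.ctr 2))) (.lit 2)))
        (wireE 2 (.ctr 0) (.ctr 2))))).run I α 2 (Function.update ρ 1 u) b) b w = b w by
    have := h _ le_rfl
    simpa [loadAddend, Circ.run, HExpr.eval, hv] using this
  intro m
  induction m with
  | zero => intro _; exact ⟨fun i hi => by simpa using hfresh i hi, fun w _ => rfl⟩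
  | succ m ih =>
    intro hm
    obtain ⟨ih1, ih2⟩ := ih (by omega)
    rw [List.range_succ, List.foldl_append, List.foldl_cons, List.foldl_nil]
    obtain ⟨j1, j2⟩ := hinner m (by omega) _ ih2
    refine ⟨fun i hi => ?_, fun w hw => by rw [j2 w hw, ih2 w hw]⟩
    rw [j1 i hi, ih1 i hi]
    by_cases hmv : m = v
    · subst hmv; simp
    · have : (v < m + 1) = (v < m) := by apply propext; omega
      simp [hmv, this]

/-- Ripple-carry addition. The result is written to the fresh layer belonging to the next digit
instead of overwriting a summand. -/
theorem addBits_run {α : ℕ → ℕ → ℕ} (hα : Layout α) (I : ℕ → ℕ) (ρ : ℕ → ℕ) {b : Config}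
    (hc : ∀ i ≤ totalBits α, b (wire α 3 (ρ 0) i) = false)
    (hs : ∀ i < totalBits α, b (wire α 4 (ρ 0 + 1) i) = false)
    (hlt : wireSum α b 4 (ρ 0) (totalBits α) + wireSum α b 2 (ρ 0) (totalBits α) < 2 ^ totalBits α) :
    wireSum α ((Circ.loop (scalar 1) addBit).run I α 1 ρ b) 4 (ρ 0 + 1) (totalBits α) =
      wireSum α b 4 (ρ 0) (totalBits α) + wireSum α b 2 (ρ 0) (totalBits α) := by
  have hS := hα.totalBits_lt
  simp only [Circ.run, eval_scalar]
  -- The decisive part is the last clause: the low `m` bits of the result, together with the current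
  -- carry at weight `2 ^ m`, make up the sum of the low parts of the summands.
  suffices h : ∀ m ≤ totalBits α, ∀ b', b' = (List.range m).foldl
      (fun b i => addBit.run I α 2 (Function.update ρ 1 i) b) b →
      (∀ i, i < stride α → b' (wire α 4 (ρ 0) i) = b (wire α 4 (ρ 0) i)) ∧
      (∀ i, i < stride α → b' (wire α 2 (ρ 0) i) = b (wire α 2 (ρ 0) i)) ∧
      (∀ i, m < i → i ≤ totalBits α → b' (wire α 3 (ρ 0) i) = false) ∧
      (∀ i, m ≤ i → i < totalBits α → b' (wire α 4 (ρ 0 + 1) i) = false) ∧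
      wireSum α b' 4 (ρ 0 + 1) m + (b' (wire α 3 (ρ 0) m)).toNat * 2 ^ m =
        wireSum α b 4 (ρ 0) m + wireSum α b 2 (ρ 0) m by
    obtain ⟨-, -, -, -, h5⟩ := h _ le_rfl _ rfl
    rw [← h5]
    rw [← h5] at hlt
    -- A final carry would contribute `2 ^ totalBits α`, which the assumption on the sum excludes.
    cases hcarry : (List.range (totalBits α)).foldl
      (fun b i => addBit.run I α 2 (Function.update ρ 1 i) b) b (wire α 3 (ρ 0) (totalBits α))
    · simp
    · rw [hcarry] at hlt
      simp at hlt
  intro m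
  induction m with
  | zero =>
    rintro - b' rfl
    refine ⟨fun _ _ => rfl, fun _ _ => rfl, fun i _ hi => hc i hi, fun i _ hi => hs i hi, ?_⟩
    simp [wireSum, digitSum, hc 0 (by omega)]
  | succ m ih =>
    intro hm b' hb'
    obtain ⟨i1, i2, i3, i4, i5⟩ := ih (by omega) _ rfl
    generalize hB : (List.range m).foldl
      (fun b i => addBit.run I α 2 (Function.update ρ 1 i) b) b = B at i1 i2 i3 i4 i5
    rw [List.range_succ, List.foldl_append, List.foldl_cons, List.foldl_nil, hB,
      addBit_run _ _ _ _ _ (by simp; omega)] at hb'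
    simp only [Function.update_self, ne_eq, zero_ne_one, not_false_eq_true,
      Function.update_of_ne] at hb'
    have hne : ∀ tag l i, tag < 16 → i < stride α →
        ¬ (tag = 3 ∧ l = ρ 0 ∧ i = m + 1) → ¬ (tag = 4 ∧ l = ρ 0 + 1 ∧ i = m) →
        b' (wire α tag l i) = B (wire α tag l i) := by
      intro tag l i ht hi h1 h2
      rw [hb', Function.update_of_ne, Function.update_of_ne]
      · rwa [Ne, wire_inj ht (by omega) hi (by omega)]
      · rwa [Ne, wire_inj ht (by omega) hi (by omega)]
    have hcarry : b' (wire α 3 (ρ 0) (m + 1)) = xor (xor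
          (b (wire α 4 (ρ 0) m) && b (wire α 2 (ρ 0) m))
          (b (wire α 4 (ρ 0) m) && B (wire α 3 (ρ 0) m)))
          (b (wire α 2 (ρ 0) m) && B (wire α 3 (ρ 0) m)) := by
      rw [hb', Function.update_of_ne (wire_tag_ne _ _ _ _ (by omega) (by omega) (by omega)),
        Function.update_self, i3 (m + 1) (by omega) (by omega), i1 m (by omega), i2 m (by omega)]
      simp
    have hsum : b' (wire α 4 (ρ 0 + 1) m) = xor (xor (b (wire α 4 (ρ 0) m))
        (b (wire α 2 (ρ 0) m))) (B (wire α 3 (ρ 0) m)) := by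
      rw [hb', Function.update_self, i4 m le_rfl (by omega), i1 m (by omega), i2 m (by omega)]
      simp
    refine ⟨fun i hi => ?_, fun i hi => ?_, fun i hi hi' => ?_, fun i hi hi' => ?_, ?_⟩
    · rw [hne _ _ _ (by omega) hi (by omega) (by omega), i1 i hi]
    · rw [hne _ _ _ (by omega) hi (by omega) (by omega), i2 i hi]
    · rw [hne _ _ _ (by omega) (by omega) (by omega) (by omega), i3 i (by omega) hi']
    · rw [hne _ _ _ (by omega) (by omega) (by omega) (by omega), i4 i (by omega) hi']
    · have hlow : wireSum α b' 4 (ρ 0 + 1) m = wireSum α B 4 (ρ 0 + 1) m := by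
        unfold wireSum digitSum
        refine Finset.sum_congr rfl fun i hi => ?_
        rw [Finset.mem_range] at hi
        have := hne 4 (ρ 0 + 1) i (by omega) (by omega) (by omega) (by omega)
        simp only [this]
      have hstep : ∀ (b : Config) tag l, wireSum α b tag l (m + 1) =
          wireSum α b tag l m + (b (wire α tag l m)).toNat * 2 ^ m := fun b tag l =>
        digitSum_succ _ _ _
      have hbit : ∀ s a c : Bool, (xor (xor s a) c).toNat +
          2 * (xor (xor (s && a) (s && c)) (a && c)).toNat = s.toNat + a.toNat + c.toNat := by
        decide
      have := hbit (b (wire α 4 (ρ 0) m)) (b (wire α 2 (ρ 0) m)) (B (wire α 3 (ρ 0) m))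
      rw [hstep, hstep, hstep, hlow, hcarry, hsum, pow_succ]
      have h2 := congrArg (fun z => z * 2 ^ m) this
      simp only [add_mul] at h2
      linarith

/-- The wires changed by `toBinary`. -/
def Work (α : ℕ → ℕ → ℕ) (base w : ℕ) : Prop :=
  (∃ tag l i, 2 ≤ tag ∧ tag ≤ 4 ∧ l ≤ digitCount α ∧ i < stride α ∧ w = wire α tag l i) ∨
    ∃ i < totalBits α, w = base + i

theorem toBinary_writes {α : ℕ → ℕ → ℕ} (hα : Layout α) (I : ℕ → ℕ) (ρ : ℕ → ℕ) (L tag a : ℕ)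
    (base : HExpr) (x : ℕ) (hbase : ∀ ρ, base.eval I α ρ = x) :
    (toBinary tag a base).All I α (Step.Writes L (Work α x)) 0 ρ := by
  have hS := hα.totalBits_lt
  simp only [toBinary, loadAddend, addBit, cnot, Circ.All, Step.map, Step.Writes, eval_scalar,
    HExpr.eval, eval_wireE, hbase]
  simp only [Function.update_self]
  refine ⟨fun l (hl : l < digitCount α) => ⟨fun u hu i (hi : i < totalBits α) => ?_,
    fun i (hi : i < totalBits α) => ⟨⟨⟨?_, ?_⟩, ?_⟩, ⟨?_, ?_⟩, ?_⟩⟩,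
    fun i (hi : i < totalBits α) => ?_⟩
  · exact Or.inl ⟨2, l, i, by omega, by omega, by omega, by omega, rfl⟩
  · exact Or.inl ⟨3, l, i + 1, by omega, by omega, by omega, by omega, rfl⟩
  · exact Or.inl ⟨3, l, i + 1, by omega, by omega, by omega, by omega, rfl⟩
  · exact Or.inl ⟨3, l, i + 1, by omega, by omega, by omega, by omega, rfl⟩
  · exact Or.inl ⟨4, l + 1, i, by omega, by omega, by omega, by omega, rfl⟩
  · exact Or.inl ⟨4, l + 1, i, by omega, by omega, by omega, by omega, rfl⟩
  · exact Or.inl ⟨4, l + 1, i, by omega, by omega, by omega, by omega, rfl⟩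
  · exact Or.inr ⟨i, hi, rfl⟩

theorem wireSum_testBit {α : ℕ → ℕ → ℕ} {b : Config} {tag l t x : ℕ}
    (h : ∀ i < t, b (wire α tag l i) = x.testBit i) (hx : x < 2 ^ t) : wireSum α b tag l t = x := by
  have : wireSum α b tag l t = digitSum 2 (fun i => (x.testBit i).toNat) t := by
    unfold wireSum digitSum
    refine Finset.sum_congr rfl fun i hi => ?_
    simp only [h i (Finset.mem_range.1 hi)]
  rw [this, digitSum_testBit, Nat.mod_eq_of_lt hx]

/-- Layer `m` of the accumulator holds the partial sum over the digits below `m`. Every digit has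
its own wires for addend, carry and sum, so nothing has to be cleaned on the way; where necessary,
the whole circuit is undone later. -/
theorem toBinary_run {α : ℕ → ℕ → ℕ} (hα : Layout α) (I : ℕ → ℕ) (ρ : ℕ → ℕ) {tag : ℕ}
    (htag : tag < 2) (a : ℕ) (base : HExpr) (x : ℕ) (hbase : ∀ ρ, base.eval I α ρ = x)
    (hx : x + totalBits α ≤ 2 * totalBits α) {b : Config} {v : ℕ → ℕ}
    (hv : ∀ l < digitCount α, v l < radix α l) (hb : ∀ l < digitCount α, OneHot α b tag l (v l))
    (h1 : b (wire α 7 0 0) = true) (h0 : b (wire α 6 0 0) = false)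
    (hfresh : ∀ w, Work α x w → b w = false)
    (hlt : ∑ l ∈ Finset.range (digitCount α), v l * digitWeight α a l < 2 ^ totalBits α) :
    digitSum 2 (fun i => ((toBinary tag a base).run I α 0 ρ b (x + i)).toNat) (totalBits α) =
      ∑ l ∈ Finset.range (digitCount α), v l * digitWeight α a l := by
  have hS := hα.totalBits_lt
  have hmono : ∀ m ≤ digitCount α, ∑ l ∈ Finset.range m, v l * digitWeight α a l <
      2 ^ totalBits α := fun m hm => (Finset.sum_le_sum_of_subset
    (Finset.range_subset_range.2 hm)).trans_lt hlt
  -- Besides the partial sum, the invariant records that the digits and constants are unchanged and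
  -- that the working wires of the later digits are still in their initial state.
  have hmain : ∀ m ≤ digitCount α, ∀ b', b' = (List.range m).foldl (fun b l =>
      (Circ.seq (loadAddend tag a) (.loop (scalar 1) addBit)).run I α 1 (Function.update ρ 0 l) b) b →
      wireSum α b' 4 m (totalBits α) = ∑ l ∈ Finset.range m, v l * digitWeight α a l ∧
      (∀ tag' l i, tag' < 16 → i < stride α → (tag' < 2 ∨ 4 < tag' ∨ (tag' < 4 ∧ m ≤ l) ∨ m < l) →
        b' (wire α tag' l i) = b (wire α tag' l i)) ∧
      ∀ w < 2 * totalBits α, b' w = b w := by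
    intro m
    induction m with
    | zero =>
      rintro - b' rfl
      refine ⟨?_, fun _ _ _ _ _ _ => rfl, fun _ _ => rfl⟩
      simp only [Finset.range_zero, Finset.sum_empty, wireSum, digitSum]
      refine Finset.sum_eq_zero fun i hi => ?_
      rw [Finset.mem_range] at hi
      have := hfresh (wire α 4 0 i)
        (Or.inl ⟨4, 0, i, by omega, by omega, by omega, by omega, rfl⟩)
      simp [this]
    | succ m ih =>
      intro hm b' hb'
      obtain ⟨i1, i2, i3⟩ := ih (by omega) _ rfl
      rw [List.range_succ, List.foldl_append, List.foldl_cons, List.foldl_nil] at hb'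
      generalize (List.range m).foldl (fun b l => (Circ.seq (loadAddend tag a)
        (.loop (scalar 1) addBit)).run I α 1 (Function.update ρ 0 l) b) b = B at i1 i2 i3 hb'
      rw [Circ.run] at hb'
      have hρ : Function.update ρ 0 m 0 = m := Function.update_self _ _ _
      have hl := loadAddend_run hα I (Function.update ρ 0 m) htag a (b := B) (v := v m)
        (by rw [hρ]; exact hv m (by omega))
        (by
          rw [hρ]
          intro u hu
          have := hα.radix_le m (by omega)
          rw [i2 _ _ _ (by omega) (by omega) (by omega)]
          exact hb m (by omega) u hu)
        (by rw [i2 _ _ _ (by omega) (by omega) (by omega), h1])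
        (by rw [i2 _ _ _ (by omega) (by omega) (by omega), h0])
        (by
          rw [hρ]
          intro i hi
          rw [i2 _ _ _ (by omega) (by omega) (by omega)]
          exact hfresh _ (Or.inl ⟨2, m, i, by omega, by omega, by omega, by omega, rfl⟩))
      rw [hρ] at hl
      obtain ⟨l1, l2⟩ := hl
      have hterm : v m * digitWeight α a m < 2 ^ totalBits α := by
        have := hmono (m + 1) hm
        rw [Finset.sum_range_succ] at this
        omega
      generalize (loadAddend tag a).run I α 1 (Function.update ρ 0 m) B = C at l1 l2 hb'
      have hC : ∀ tag' l i, tag' < 16 → i < stride α → tag' ≠ 2 ∨ l ≠ m →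
          C (wire α tag' l i) = B (wire α tag' l i) := by
        intro tag' l i ht hi hh
        refine l2 _ fun j hj => ?_
        rw [Ne, wire_inj ht (by omega) hi (by omega)]
        omega
      have hsum4 : wireSum α C 4 m (totalBits α) = wireSum α B 4 m (totalBits α) := by
        unfold wireSum digitSum
        refine Finset.sum_congr rfl fun i hi => ?_
        rw [Finset.mem_range] at hi
        have := hC 4 m i (by omega) (by omega) (by omega)
        simp only [this]
      have hsum2 : wireSum α C 2 m (totalBits α) = v m * digitWeight α a m :=
        wireSum_testBit l1 hterm
      have hadd := addBits_run hα I (Function.update ρ 0 m) (b := C)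
        (by
          rw [hρ]
          intro i hi
          rw [hC _ _ _ (by omega) (by omega) (by omega), i2 _ _ _ (by omega) (by omega) (by omega)]
          exact hfresh _ (Or.inl ⟨3, m, i, by omega, by omega, by omega, by omega, rfl⟩))
        (by
          rw [hρ]
          intro i hi
          rw [hC _ _ _ (by omega) (by omega) (by omega), i2 _ _ _ (by omega) (by omega) (by omega)]
          exact hfresh _ (Or.inl ⟨4, m + 1, i, by omega, by omega, by omega, by omega, rfl⟩))
        (by
          rw [hρ, hsum4, hsum2, i1, ← Finset.sum_range_succ]
          exact hmono (m + 1) hm)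
      rw [hρ, hsum4, hsum2, i1, ← Finset.sum_range_succ] at hadd
      have hrest : ∀ w, (∀ i < stride α, w ≠ wire α 3 m i) → (∀ i < stride α, w ≠ wire α 4 (m + 1) i) →
          b' w = C w := by
        intro w hw1 hw2
        rw [hb']
        refine Circ.run_of_writes (Q := fun w => (∃ i < stride α, w = wire α 3 m i) ∨
          ∃ i < stride α, w = wire α 4 (m + 1) i) 0 ?_ _ _ _ ?_ _
        · rintro (⟨i, hi, h⟩ | ⟨i, hi, h⟩)
          · exact hw1 i hi h
          · exact hw2 i hi h
        · simp only [addBit, cnot, Circ.All, Step.map, Step.Writes, eval_scalar, HExpr.eval, eval_wireE]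
          simp only [Function.update_self, ne_eq, not_false_eq_true, Function.update_of_ne,
            zero_ne_one]
          intro i (hi : i < totalBits α)
          have e1 : ∃ i' < stride α, wire α 3 m (i + 1) = wire α 3 m i' := ⟨i + 1, by omega, rfl⟩
          have e2 : ∃ i' < stride α, wire α 4 (m + 1) i = wire α 4 (m + 1) i' := ⟨i, by omega, rfl⟩
          exact ⟨⟨⟨Or.inl e1, Or.inl e1⟩, Or.inl e1⟩, ⟨Or.inr e2, Or.inr e2⟩, Or.inr e2⟩
      refine ⟨by rw [hb']; exact hadd, fun tag' l i ht hi hh => ?_, fun w hw => ?_⟩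
      · rw [hrest, hC _ _ _ ht hi (by omega), i2 _ _ _ ht hi (by omega)]
        · intro j hj
          rw [Ne, wire_inj ht (by omega) hi hj]
          omega
        · intro j hj
          rw [Ne, wire_inj ht (by omega) hi hj]
          omega
      · have hne : ∀ tag l i, w ≠ wire α tag l i := by
          intro tag l i
          unfold wire
          omega
        rw [hrest _ (fun _ _ => hne _ _ _) (fun _ _ => hne _ _ _), l2 _ (fun _ _ => hne _ _ _), i3 w hw]
  obtain ⟨m1, -, m3⟩ := hmain _ le_rfl _ rfl
  have hrun : (toBinary tag a base).run I α 0 ρ b =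
      (Circ.loop (scalar 1) (cnot (wireE 4 (scalar 0) (.ctr 0)) (.add base (.ctr 0)))).run I α 0 ρ
        ((List.range (digitCount α)).foldl (fun b l =>
          (Circ.seq (loadAddend tag a) (.loop (scalar 1) addBit)).run I α 1
            (Function.update ρ 0 l) b) b) := rfl
  rw [hrun]
  generalize (List.range (digitCount α)).foldl (fun b l =>
      (Circ.seq (loadAddend tag a) (.loop (scalar 1) addBit)).run I α 1
        (Function.update ρ 0 l) b) b = B at m1 m3
  rw [← m1]
  simp only [cnot, Circ.run, Step.map, eval_wireE, eval_scalar, HExpr.eval, hbase,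
    Function.update_self]
  have key := foldl_write (totalBits α)
    (fun b i => (Step.ccnot (wire α 4 (digitCount α) i) (wire α 4 (digitCount α) i) (x + i)).apply b)
    (fun i => x + i)
    (fun i b => b (wire α 4 (digitCount α) i) && b (wire α 4 (digitCount α) i))
    B (fun i hi j hj h => by omega)
    (fun i hi b => ccnot_apply (by unfold wire; omega) (by unfold wire; omega) b)
    (fun i hi b'' hb'' => by
      rw [hb'' _ fun j hj => by unfold wire; omega])
  refine Finset.sum_congr rfl fun i hi => ?_
  rw [Finset.mem_range] at hi
  dsimp only
  rw [key.1 i hi, m3 _ (by omega), hfresh _ (Or.inr ⟨i, hi, rfl⟩)]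
  simp

end QAlg

namespace QAlg

open ComplexConjugate

/-! ## Operators of circuits -/

/-- The operator performed by a circuit (`dir = true`) or its inverse (`dir = false`). -/
noncomputable def Circ.op {k : ℕ} (L : ℕ) (F : (Fin k → ℕ) → ℕ) (I : ℕ → ℕ) (α : ℕ → ℕ → ℕ)
    (dir : Bool) (δ : ℕ) (ρ : ℕ → ℕ) (c : Circ) : QState →ₗ[ℂ] QState :=
  applyGates L F (c.gates I α dir δ ρ)

/-- The phase factor `exp(2πi·a/b)`. -/
noncomputable def phaseFactor (a b : ℕ) : ℂ :=
  Complex.exp (2 * Real.pi * Complex.I * ((a : ℂ) / (b : ℂ)))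

theorem phaseFactor_zero (b : ℕ) : phaseFactor 0 b = 1 := by simp [phaseFactor]

theorem phaseFactor_add (a a' b : ℕ) :
    phaseFactor (a + a') b = phaseFactor a b * phaseFactor a' b := by
  rw [phaseFactor, phaseFactor, phaseFactor, ← Complex.exp_add]
  congr 1
  push_cast
  ring

theorem phaseFactor_mul_left {a b c : ℕ} (hc : c ≠ 0) :
    phaseFactor (c * a) (c * b) = phaseFactor a b := by
  rw [phaseFactor, phaseFactor]
  push_cast
  rw [mul_div_mul_left _ _ (by exact_mod_cast hc)]

theorem phaseFactor_of_dvd {a b : ℕ} (h : b ∣ a) : phaseFactor a b = 1 := by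
  obtain ⟨c, rfl⟩ := h
  rcases Nat.eq_zero_or_pos b with rfl | hb
  · simp [phaseFactor]
  · rw [phaseFactor, Complex.exp_eq_one_iff]
    refine ⟨c, ?_⟩
    have : (b : ℂ) ≠ 0 := by exact_mod_cast hb.ne'
    push_cast
    field_simp

theorem phaseFactor_conj_mul (a b : ℕ) : conj (phaseFactor a b) * phaseFactor a b = 1 := by
  rw [phaseFactor, ← Complex.exp_conj, ← Complex.exp_add]
  simp only [map_mul, map_div₀, Complex.conj_I, Complex.conj_ofReal, map_natCast, map_ofNat]
  rw [← Complex.exp_zero]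
  congr 1
  ring

theorem phaseFactor_one_eq (x p : ℕ) : phaseFactor x p = phaseFactor 1 p ^ x := by
  induction x with
  | zero => simp [phaseFactor_zero]
  | succ x ih => rw [phaseFactor_add, pow_succ, ih]

/-- Orthogonality of the characters of a cyclic group. -/
theorem sum_conj_phaseFactor {p x z : ℕ} (hx : x < p) (hz : z < p) (hxz : x ≠ z) :
    ∑ v ∈ Finset.range p, conj (phaseFactor (z * v) p) * phaseFactor (x * v) p = 0 := by
  have hp : 0 < p := by omega
  set ζ : ℂ := conj (phaseFactor z p) * phaseFactor x p with hζ
  have h1 : ∀ a v, phaseFactor (a * v) p = phaseFactor a p ^ v := by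
    intro a v
    rw [phaseFactor_one_eq, phaseFactor_one_eq a, pow_mul]
  have h2 : ∀ v, conj (phaseFactor (z * v) p) * phaseFactor (x * v) p = ζ ^ v := by
    intro v
    rw [h1, h1, map_pow, ← mul_pow]
  have h3 : ζ ^ p = 1 := by
    rw [← h2, phaseFactor_of_dvd (Dvd.intro_left _ rfl), phaseFactor_of_dvd (Dvd.intro_left _ rfl)]
    simp
  have h4 : ζ ≠ 1 := by
    intro h
    have h5 : phaseFactor x p = phaseFactor z p := by
      have e := phaseFactor_conj_mul z p
      have hne : conj (phaseFactor z p) ≠ 0 := by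
        intro h0; rw [h0, zero_mul] at e; exact zero_ne_one e
      exact mul_left_cancel₀ hne (by rw [e, ← h])
    rw [phaseFactor, phaseFactor, Complex.exp_eq_exp_iff_exists_int] at h5
    obtain ⟨m, hm⟩ := h5
    have hpi : (2 * Real.pi * Complex.I : ℂ) ≠ 0 := Complex.two_pi_I_ne_zero
    have hp' : (p : ℂ) ≠ 0 := by exact_mod_cast hp.ne'
    have h6 : (x : ℂ) = z + m * p := by
      have e : (2 * Real.pi * Complex.I : ℂ) * (x / p) = (2 * Real.pi * Complex.I) * (z / p + m) := by
        rw [hm]; ring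
      have e2 := mul_left_cancel₀ hpi e
      field_simp at e2
      rw [e2]; ring
    have h7 : (x : ℤ) = z + m * p := by exact_mod_cast h6
    have h8 : m = 0 := by
      by_contra hm0
      rcases lt_or_gt_of_ne hm0 with h | h
      · nlinarith
      · nlinarith
    rw [h8] at h7
    omega
  simp only [h2]
  have := geom_sum_mul ζ p
  rw [h3, sub_self] at this
  exact (mul_eq_zero.1 this).resolve_right (sub_ne_zero.2 h4)

section

variable {k L : ℕ} {F : (Fin k → ℕ) → ℕ} {I : ℕ → ℕ} {α : ℕ → ℕ → ℕ} {δ : ℕ} {ρ : ℕ → ℕ}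

theorem Circ.op_seq (c d : Circ) (u : QState) : (Circ.seq c d).op L F I α true δ ρ u =
    d.op L F I α true δ ρ (c.op L F I α true δ ρ u) := by
  simp only [op, gates, applyGates_append, LinearMap.comp_apply]

theorem Circ.op_seq_false (c d : Circ) (u : QState) : (Circ.seq c d).op L F I α false δ ρ u =
    c.op L F I α false δ ρ (d.op L F I α false δ ρ u) := by
  simp only [op, gates, applyGates_append, LinearMap.comp_apply]

theorem Circ.op_rev (dir : Bool) (c : Circ) (u : QState) : (Circ.rev c).op L F I α dir δ ρ u =
    c.op L F I α (!dir) δ ρ u := by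
  simp only [op, gates]

theorem Circ.op_op_not (dir : Bool) (c : Circ) (u : QState) :
    c.op L F I α dir δ ρ (c.op L F I α (!dir) δ ρ u) = u :=
  (Circ.inversePair I α c dir δ ρ).right u

theorem Circ.inner_op (dir : Bool) (c : Circ) (u v : QState) :
    inner (c.op L F I α dir δ ρ u) v = inner u (c.op L F I α (!dir) δ ρ v) :=
  (Circ.inversePair I α c dir δ ρ).adjoint u v

/-- The intermediate states are prescribed in advance, so a loop is analysed by checking one
iteration. -/
theorem Circ.op_loop (bound : HExpr) (body : Circ) (n : ℕ) (hn : bound.eval I α ρ = n)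
    (ψ : ℕ → QState)
    (h : ∀ i < n, body.op L F I α true (δ + 1) (Function.update ρ δ i) (ψ i) = ψ (i + 1)) :
    (Circ.loop bound body).op L F I α true δ ρ (ψ 0) = ψ n := by
  simp only [op, gates, hn]
  induction n generalizing bound with
  | zero => simp [applyGates]
  | succ n ih =>
    -- Only the value of the bound matters, so a literal can take its place in the induction.
    rw [applyGates_flatMap_range_succ, ih (.lit n) rfl fun i hi => h i (by omega)]
    exact h n (by omega)

theorem Circ.op_loop_diag (bound : HExpr) (body : Circ) (n : ℕ) (hn : bound.eval I α ρ = n)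
    (b : Config) (χ : ℕ → ℂ) (h : ∀ i < n, body.op L F I α true (δ + 1) (Function.update ρ δ i)
      (Finsupp.single b 1) = χ i • Finsupp.single b 1) :
    (Circ.loop bound body).op L F I α true δ ρ (Finsupp.single b 1) =
      (∏ i ∈ Finset.range n, χ i) • Finsupp.single b 1 := by
  have := Circ.op_loop (L := L) (F := F) (δ := δ) (ρ := ρ) bound body n hn
    (fun i => (∏ j ∈ Finset.range i, χ j) • Finsupp.single b 1) fun i hi => by
      rw [map_smul, h i hi, smul_smul, Finset.prod_range_succ]
  simpa using this

theorem Circ.op_loop_mem (W : Submodule ℂ QState) (dir : Bool) (bound : HExpr) (body : Circ)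
    (h : ∀ i < bound.eval I α ρ, ∀ u ∈ W,
      body.op L F I α dir (δ + 1) (Function.update ρ δ i) u ∈ W) :
    ∀ u ∈ W, (Circ.loop bound body).op L F I α dir δ ρ u ∈ W := by
  have aux : ∀ (l : List ℕ) (f : ℕ → List (Gate ℕ)),
      (∀ i ∈ l, ∀ u ∈ W, applyGates L F (f i) u ∈ W) →
      ∀ u ∈ W, applyGates L F (l.flatMap f) u ∈ W := by
    intro l f
    induction l with
    | nil => intro _ u hu; exact hu
    | cons a l ih =>
      intro h u hu
      rw [List.flatMap_cons, applyGates_append]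
      exact ih (fun i hi => h i (by simp [hi])) _ (h a (by simp) u hu)
  cases dir with
  | true =>
    simp only [op, gates]
    exact aux _ _ fun i hi => h i (List.mem_range.1 hi)
  | false =>
    simp only [op, gates]
    exact aux _ _ fun i hi => h i (List.mem_range.1 (List.mem_reverse.1 hi))

theorem Circ.op_classical {c : Circ} (hc : c.IsClassical) (b : Config) (z : ℂ) :
    c.op L F I α true δ ρ (Finsupp.single b z) = Finsupp.single (c.run I α δ ρ b) z := by
  have h1 : Finsupp.single b z = z • Finsupp.single b (1 : ℂ) := by simp
  rw [h1, map_smul, op, Circ.applyGates_classical c δ ρ hc]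
  simp

theorem op_cnot (dir : Bool) (c t : HExpr) (h : t.eval I α ρ ≠ c.eval I α ρ) (b : Config) :
    (cnot c t).op L F I α dir δ ρ (Finsupp.single b 1) =
      Finsupp.single (Function.update b (t.eval I α ρ)
        (xor (b (t.eval I α ρ)) (b (c.eval I α ρ)))) 1 := by
  have h1 := Circ.op_classical (c := cnot c t) (L := L) (F := F) (I := I) (α := α) (δ := δ) (ρ := ρ)
    trivial b 1
  cases dir
  · refine Eq.trans ?_ (h1.trans ?_)
    · simp only [Circ.op, cnot, Circ.gates, Step.gates, Step.map]
    · simp [cnot, Circ.run, Step.map, ccnot_apply h h]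
  · rw [h1]
    simp [cnot, Circ.run, Step.map, ccnot_apply h h]

theorem op_cph (a b c t : HExpr) (h : t.eval I α ρ ≠ c.eval I α ρ) (e : Config) :
    (Circ.prim (.cph a b c t)).op L F I α true δ ρ (Finsupp.single e 1) =
      (if e (c.eval I α ρ) = true ∧ e (t.eval I α ρ) = true
        then phaseFactor (a.eval I α ρ) (b.eval I α ρ) else 1) • Finsupp.single e 1 := by
  simp only [Circ.op, Circ.gates, Step.map, Step.gates, applyGates, LinearMap.id_comp, Gate.op,
    Gate.onBasis, if_true, Finsupp.linearCombination_single, one_smul, ctrlBasis]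
  by_cases hc : e (c.eval I α ρ) = true
  · rw [if_pos (by simp [h, hc])]
    cases ht : e (t.eval I α ρ) with
    | true =>
      have e1 : Function.update e (t.eval I α ρ) true = e := by rw [← ht]; simp
      simp [phaseMatrix, e1, hc, phaseFactor]
    | false =>
      have e1 : Function.update e (t.eval I α ρ) false = e := by rw [← ht]; simp
      simp [phaseMatrix, e1]
  · rw [if_neg (by simp [hc]), if_neg (by simp [hc]), one_smul]

theorem op_refl (dir : Bool) (a b c t : HExpr) (h : t.eval I α ρ ≠ c.eval I α ρ) (e : Config) :
    (Circ.prim (.refl a b c t)).op L F I α dir δ ρ (Finsupp.single e 1) =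
      if e (c.eval I α ρ) = true then
        ∑ v : Bool, reflMatrix (a.eval I α ρ) (b.eval I α ρ) v (e (t.eval I α ρ)) •
          Finsupp.single (Function.update e (t.eval I α ρ) v) 1
      else Finsupp.single e 1 := by
  have h1 : (Circ.prim (.refl a b c t)).op L F I α dir δ ρ =
      ctrlOp [c.eval I α ρ] (t.eval I α ρ) (reflMatrix (a.eval I α ρ) (b.eval I α ρ)) := by
    rw [← rot_mul_phase, ← ctrlOp_comp]
    simp only [Circ.op, Circ.gates, Step.map, Step.gates, applyGates, LinearMap.id_comp]
    rfl
  rw [h1, ctrlOp_single, ctrlBasis]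
  simp [h]

/-! ## Givens rotations and uniform superpositions -/

/-- A reflection in the plane spanned by the configurations in which exactly one of the wires `c`,
`t` is `1`. -/
def givens (a b c t : HExpr) : Circ :=
  .seq (.seq (cnot t c) (.prim (.refl a b c t))) (cnot t c)

/-- The configuration `b` with the wire `w v` set to `1`. -/
def hot (b : Config) (w : ℕ → ℕ) (v : ℕ) : Config := Function.update b (w v) true

/-- The square root of `a / (a + b)`. -/
noncomputable def amp (a b : ℕ) : ℂ := ((Real.sqrt ((a : ℝ) / ((a : ℝ) + (b : ℝ))) : ℝ) : ℂ)

/-- The square root of `1 - a / (a + b)`. -/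
noncomputable def coamp (a b : ℕ) : ℂ :=
  ((Real.sqrt (1 - (a : ℝ) / ((a : ℝ) + (b : ℝ))) : ℝ) : ℂ)

/-- Controlled by wire `i + 1`, wire `i` is negated. Among the one-hot configurations exactly the
values `i` and `i + 1` then have wire `i` set, and they differ on wire `i + 1`, so a reflection of
that wire controlled by wire `i` acts in the desired plane. The second negation restores the
encoding. Being conjugate to an involution, the circuit is its own inverse, hence the independence
of `dir`. -/
theorem op_givens (dir : Bool) (a b c t : HExpr) {p i : ℕ} {w : ℕ → ℕ} {e : Config}
    (hw : ∀ i < p, ∀ j < p, w i = w j → i = j) (he : ∀ i < p, e (w i) = false)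
    (hc : c.eval I α ρ = w i) (ht : t.eval I α ρ = w (i + 1)) (hi : i + 1 < p) {v : ℕ} (hv : v < p) :
    (givens a b c t).op L F I α dir δ ρ (Finsupp.single (hot e w v) 1) =
      if v = i then
        amp (a.eval I α ρ) (b.eval I α ρ) • Finsupp.single (hot e w i) 1 +
          coamp (a.eval I α ρ) (b.eval I α ρ) • Finsupp.single (hot e w (i + 1)) 1
      else if v = i + 1 then
        coamp (a.eval I α ρ) (b.eval I α ρ) • Finsupp.single (hot e w i) 1 -
          amp (a.eval I α ρ) (b.eval I α ρ) • Finsupp.single (hot e w (i + 1)) 1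
      else Finsupp.single (hot e w v) 1 := by
  have hne : w (i + 1) ≠ w i := fun h => by have := hw _ hi _ (by omega) h; omega
  have hct : c.eval I α ρ ≠ t.eval I α ρ := by rw [hc, ht]; exact hne.symm
  have h1 : (givens a b c t).op L F I α dir δ ρ (Finsupp.single (hot e w v) 1) =
      (cnot t c).op L F I α dir δ ρ ((Circ.prim (.refl a b c t)).op L F I α dir δ ρ
        ((cnot t c).op L F I α dir δ ρ (Finsupp.single (hot e w v) 1))) := by
    cases dir <;> simp only [givens, Circ.op_seq, Circ.op_seq_false]
  rw [h1, op_cnot dir t c hct]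
  rw [op_refl dir a b c t hct.symm]
  simp only [hc, ht]
  have ei := he i (by omega)
  have ei1 := he (i + 1) hi
  have hD : Function.update (hot e w i) (w (i + 1)) true = Function.update (hot e w (i + 1)) (w i) true := by
    unfold hot; rw [Function.update_comm hne]
  have a1 : hot e w i (w i) = true := by simp [hot]
  have a2 : hot e w i (w (i + 1)) = false := by simp [hot, hne, ei1]
  have b1 : hot e w (i + 1) (w i) = false := by simp [hot, hne.symm, ei]
  have b2 : hot e w (i + 1) (w (i + 1)) = true := by simp [hot]
  have a3 : Function.update (hot e w i) (w (i + 1)) false = hot e w i := by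
    rw [Function.update_eq_self_iff, a2]
  have a4 : Function.update (hot e w i) (w i) true = hot e w i := by
    rw [Function.update_eq_self_iff, a1]
  have b3 : Function.update (hot e w (i + 1)) (w i) false = hot e w (i + 1) := by
    rw [Function.update_eq_self_iff, b1]
  generalize hA : hot e w i = A at *
  generalize hB : hot e w (i + 1) = B at *
  by_cases g1 : v = i
  · subst g1
    rw [if_pos rfl, hA, a1, a2, Bool.xor_false, a4, if_pos a1, a2]
    simp only [Fintype.sum_bool, map_add, map_smul, op_cnot dir t c hct, hc, ht, a3, a1, a2, hD]
    simp only [Function.update_self, Function.update_of_ne hne, b2, Bool.xor_true, Bool.xor_false,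
      Function.update_idem, a4, b3, Bool.not_true]
    rw [add_comm]
    simp [reflMatrix, amp, coamp]
  by_cases g2 : v = i + 1
  · subst g2
    rw [hB, b1, b2, Bool.xor_true, Bool.not_false, ← hD,
      if_pos (by rw [Function.update_of_ne hne.symm, a1]), if_neg g1, if_pos rfl,
      Function.update_self]
    simp only [Fintype.sum_bool, map_add, map_smul, op_cnot dir t c hct, hc, ht, a3, a1, a2,
      Function.update_idem]
    simp only [hD, Function.update_self, Bool.xor_true, Bool.xor_false,
      Function.update_idem, a4, b3, Bool.not_true]
    rw [add_comm]
    simp [reflMatrix, amp, coamp, sub_eq_add_neg]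
  · have c1 : hot e w v (w i) = false := by
      rw [hot, Function.update_of_ne (fun h => g1 (hw _ hv _ (by omega) h.symm)), ei]
    have c2 : hot e w v (w (i + 1)) = false := by
      rw [hot, Function.update_of_ne (fun h => g2 (hw _ hv _ hi h.symm)), ei1]
    have c3 : Function.update (hot e w v) (w i) false = hot e w v := by
      rw [Function.update_eq_self_iff, c1]
    rw [if_neg g1, if_neg g2, c1, c2, Bool.xor_false, c3, if_neg (by simp [c1]),
      op_cnot dir t c hct, hc, ht, c1, c2, Bool.xor_false, c3]

end

end QAlg

/-! ### Uniform superpositions on one-hot registers. -/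

namespace QAlg

open ComplexConjugate

/-- Preparing a uniform superposition on the one-hot register of kind `tag` of the digit given by
the outermost loop counter. -/
def chain (δ tag : ℕ) : Circ :=
  .loop (.sub (.arr 1 (.ctr 0)) (.lit 1))
    (givens (.lit 1) (.sub (.sub (.arr 1 (.ctr 0)) (.ctr δ)) (.lit 1))
      (wireE tag (.ctr 0) (.ctr δ)) (wireE tag (.ctr 0) (.add (.ctr δ) (.lit 1))))

/-- The amplitude of a uniform superposition of `p` configurations. -/
noncomputable def unif (p : ℕ) : ℂ := ((Real.sqrt (1 / (p : ℝ)) : ℝ) : ℂ)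

theorem unif_mul_self {p : ℕ} : unif p * unif p = 1 / (p : ℂ) := by
  rw [unif, ← Complex.ofReal_mul, Real.mul_self_sqrt (by positivity)]
  push_cast
  rfl

theorem conj_unif (p : ℕ) : conj (unif p) = unif p := Complex.conj_ofReal _

section

variable {k L : ℕ} {F : (Fin k → ℕ) → ℕ} {I : ℕ → ℕ} {α : ℕ → ℕ → ℕ} {δ : ℕ} {ρ : ℕ → ℕ}

theorem wire_injOn (hα : Layout α) {l : ℕ} (hl : l < digitCount α) {tag : ℕ} (ht : tag < 16) :
    ∀ i < radix α l, ∀ j < radix α l, wire α tag l i = wire α tag l j → i = j := by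
  intro i hi j hj h
  have := hα.radix_le l hl
  exact ((wire_inj ht ht (by omega) (by omega)).1 h).2.2

/-- The amplitude not yet distributed is moved along the register. At value `i` the reflection has
parameter `1 / (p - i)`, the fraction that value `i` must keep of what remains. -/
theorem op_chain (hα : Layout α) (hδ : 0 < δ) (hl : ρ 0 < digitCount α) {tag : ℕ} (ht : tag < 16)
    {b : Config} (hb : ∀ u < radix α (ρ 0), b (wire α tag (ρ 0) u) = false) :
    (chain δ tag).op L F I α true δ ρ (Finsupp.single (hot b (wire α tag (ρ 0)) 0) 1) =
      ∑ v ∈ Finset.range (radix α (ρ 0)),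
        unif (radix α (ρ 0)) • Finsupp.single (hot b (wire α tag (ρ 0)) v) 1 := by
  have hp := hα.radix_pos _ hl
  set p := radix α (ρ 0) with hpdef
  set w := wire α tag (ρ 0) with hw
  have key := Circ.op_loop (L := L) (F := F) (I := I) (α := α) (δ := δ) (ρ := ρ)
    (.sub (.arr 1 (.ctr 0)) (.lit 1))
    (givens (.lit 1) (.sub (.sub (.arr 1 (.ctr 0)) (.ctr δ)) (.lit 1))
      (wireE tag (.ctr 0) (.ctr δ)) (wireE tag (.ctr 0) (.add (.ctr δ) (.lit 1)))) (p - 1) rfl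
    -- The values below `i` already have their final amplitude, and value `i` carries the rest of
    -- the norm. For `i = 0` this is the initial configuration and for `i = p - 1` the uniform
    -- superposition.
    (fun i => ∑ v ∈ Finset.range i, unif p • Finsupp.single (hot b w v) (1 : ℂ) +
      ((Real.sqrt (((p - i : ℕ) : ℝ) / p) : ℝ) : ℂ) • Finsupp.single (hot b w i) 1) ?_
  · simp only [Finset.range_zero, Finset.sum_empty, zero_add, Nat.sub_zero] at key
    have hp' : (p : ℝ) ≠ 0 := by exact_mod_cast hp.ne'
    rw [div_self hp', Real.sqrt_one, Complex.ofReal_one, one_smul] at key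
    rw [chain, key, show p - (p - 1) = 1 by omega, Nat.cast_one]
    conv_rhs => rw [show p = (p - 1) + 1 by omega, Finset.sum_range_succ]
    rw [show p - 1 + 1 = p by omega, unif]
  · intro i hi
    have hρ : Function.update ρ δ i 0 = ρ 0 := Function.update_of_ne (by omega) _ _
    obtain ⟨q, hq⟩ : ∃ q, p = q + 1 + i := ⟨p - 1 - i, by omega⟩
    have hb' : (HExpr.sub (.sub (.arr 1 (.ctr 0)) (.ctr δ)) (.lit 1)).eval I α
        (Function.update ρ δ i) = q := by
      simp only [HExpr.eval, hρ, Function.update_self]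
      change p - i - 1 = q
      omega
    have hG : ∀ v < p, (givens (.lit 1) (.sub (.sub (.arr 1 (.ctr 0)) (.ctr δ)) (.lit 1))
        (wireE tag (.ctr 0) (.ctr δ)) (wireE tag (.ctr 0) (.add (.ctr δ) (.lit 1)))).op L F I α true
        (δ + 1) (Function.update ρ δ i) (Finsupp.single (hot b w v) 1) =
      if v = i then
        amp 1 q • Finsupp.single (hot b w i) 1 + coamp 1 q • Finsupp.single (hot b w (i + 1)) 1
      else if v = i + 1 then
        coamp 1 q • Finsupp.single (hot b w i) 1 - amp 1 q • Finsupp.single (hot b w (i + 1)) 1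
      else Finsupp.single (hot b w v) 1 := by
      intro v hv
      have h := op_givens (L := L) (F := F) (I := I) (α := α) (δ := δ + 1)
        (ρ := Function.update ρ δ i) (p := p) (i := i) (w := w) (e := b) true (.lit 1)
        (.sub (.sub (.arr 1 (.ctr 0)) (.ctr δ)) (.lit 1))
        (wireE tag (.ctr 0) (.ctr δ)) (wireE tag (.ctr 0) (.add (.ctr δ) (.lit 1)))
        (wire_injOn hα hl ht) hb
        (by simp [HExpr.eval, hρ, hw]) (by simp [HExpr.eval, hρ, hw]) (by omega) hv
      rw [hb'] at h
      exact h
    simp only [map_add, map_sum, map_smul]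
    rw [Finset.sum_congr rfl fun v hv => by
      have := Finset.mem_range.1 hv
      rw [hG v (by omega), if_neg (by omega), if_neg (by omega)]]
    rw [hG i (by omega), if_pos rfl, Finset.sum_range_succ, add_assoc, smul_add, smul_smul, smul_smul]
    have h1 : p - i = q + 1 := by omega
    have h2 : p - (i + 1) = q := by omega
    rw [h1, h2]
    have hp' : (0 : ℝ) < p := by exact_mod_cast hp
    have e1 : ((Real.sqrt (((q + 1 : ℕ) : ℝ) / p) : ℝ) : ℂ) * amp 1 q = unif p := by
      rw [amp, unif, ← Complex.ofReal_mul, ← Real.sqrt_mul (by positivity)]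
      congr 2
      push_cast
      field_simp
      ring
    have e2 : ((Real.sqrt (((q + 1 : ℕ) : ℝ) / p) : ℝ) : ℂ) * coamp 1 q =
        ((Real.sqrt ((q : ℝ) / p) : ℝ) : ℂ) := by
      rw [coamp, ← Complex.ofReal_mul, ← Real.sqrt_mul (by positivity)]
      congr 2
      push_cast
      field_simp
      ring
    rw [e1, e2]

/-- The span of the configurations with one of the wires `w 0, …, w (p - 1)` set to `1`. -/
noncomputable def hotSpan (b : Config) (w : ℕ → ℕ) (p : ℕ) : Submodule ℂ QState :=
  Submodule.span ℂ {u | ∃ v < p, u = Finsupp.single (hot b w v) 1}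

theorem single_mem_hotSpan {b : Config} {w : ℕ → ℕ} {p v : ℕ} (hv : v < p) :
    Finsupp.single (hot b w v) 1 ∈ hotSpan b w p :=
  Submodule.subset_span ⟨v, hv, rfl⟩

theorem map_mem_hotSpan {b : Config} {w : ℕ → ℕ} {p : ℕ} {A : QState →ₗ[ℂ] QState}
    (h : ∀ v < p, A (Finsupp.single (hot b w v) 1) ∈ hotSpan b w p) {u : QState}
    (hu : u ∈ hotSpan b w p) : A u ∈ hotSpan b w p := by
  have : Submodule.map A (hotSpan b w p) ≤ hotSpan b w p := by
    rw [hotSpan, Submodule.map_span_le]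
    rintro _ ⟨v, hv, rfl⟩
    exact h v hv
  exact this ⟨u, hu, rfl⟩

theorem hot_injOn {b : Config} {w : ℕ → ℕ} {p : ℕ} (hw : ∀ i < p, ∀ j < p, w i = w j → i = j)
    (hb : ∀ i < p, b (w i) = false) {u v : ℕ} (hu : u < p) (hv : v < p)
    (h : hot b w u = hot b w v) : u = v := by
  by_contra hne
  have h1 := congrFun h (w u)
  rw [hot, hot, Function.update_self, Function.update_of_ne fun e => hne (hw _ hu _ hv e),
    hb u hu] at h1
  exact absurd h1 (by simp)

/-- An element of the span is fixed by an operator that fixes all but one of the configurations, if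
the coefficient of the exceptional one vanishes. -/
theorem eq_of_mem_hotSpan {b : Config} {w : ℕ → ℕ} {p : ℕ}
    (hw : ∀ i < p, ∀ j < p, w i = w j → i = j) (hb : ∀ i < p, b (w i) = false)
    {A : QState →ₗ[ℂ] QState} {v₀ : ℕ} (hv₀ : v₀ < p)
    (hA : ∀ v < p, v ≠ v₀ → A (Finsupp.single (hot b w v) 1) = Finsupp.single (hot b w v) 1)
    {u : QState} (hu : u ∈ hotSpan b w p) (h0 : u (hot b w v₀) = 0) : A u = u := by
  classical
  have key : ∀ u ∈ hotSpan b w p, A (u - u (hot b w v₀) • Finsupp.single (hot b w v₀) 1) =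
      u - u (hot b w v₀) • Finsupp.single (hot b w v₀) 1 := by
    intro u hu
    induction hu using Submodule.span_induction with
    | mem x hx =>
      obtain ⟨v, hv, rfl⟩ := hx
      by_cases hvv : v = v₀
      · subst hvv
        simp
      · rw [Finsupp.single_apply, if_neg fun h => hvv (hot_injOn hw hb hv hv₀ h), zero_smul,
          sub_zero]
        exact hA v hv hvv
    | zero => simp
    | add x y _ _ hx hy =>
      have : x + y - (x + y) (hot b w v₀) • Finsupp.single (hot b w v₀) (1 : ℂ) =
          (x - x (hot b w v₀) • Finsupp.single (hot b w v₀) (1 : ℂ)) +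
          (y - y (hot b w v₀) • Finsupp.single (hot b w v₀) (1 : ℂ)) := by
        rw [Finsupp.add_apply, add_smul]; abel
      rw [this, map_add, hx, hy]
    | smul a x _ hx =>
      have : a • x - (a • x) (hot b w v₀) • Finsupp.single (hot b w v₀) (1 : ℂ) =
          a • (x - x (hot b w v₀) • Finsupp.single (hot b w v₀) (1 : ℂ)) := by
        rw [Finsupp.smul_apply, smul_eq_mul, smul_sub, smul_smul]
      rw [this, map_smul, hx]
  have := key u hu
  rwa [h0, zero_smul, sub_zero] at this

/-- The inverse of the chain will be applied to Fourier states other than the one it was built from.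
Its value there is not computed; it suffices that the one-hot configurations are not left. -/
theorem op_chain_mem (hα : Layout α) (dir : Bool) (hδ : 0 < δ) (hl : ρ 0 < digitCount α) {tag : ℕ}
    (ht : tag < 16) {b : Config} (hb : ∀ u < radix α (ρ 0), b (wire α tag (ρ 0) u) = false)
    {u : QState} (hu : u ∈ hotSpan b (wire α tag (ρ 0)) (radix α (ρ 0))) :
    (chain δ tag).op L F I α dir δ ρ u ∈ hotSpan b (wire α tag (ρ 0)) (radix α (ρ 0)) := by
  refine Circ.op_loop_mem _ dir _ _ (fun i hi u hu => map_mem_hotSpan (fun v hv => ?_) hu) u hu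
  have hρ : Function.update ρ δ i 0 = ρ 0 := Function.update_of_ne (by omega) _ _
  change i < radix α (ρ 0) - 1 at hi
  have h := op_givens (L := L) (F := F) (I := I) (α := α) (δ := δ + 1)
    (ρ := Function.update ρ δ i) (p := radix α (ρ 0)) (i := i) (w := wire α tag (ρ 0)) (e := b) dir
    (.lit 1) (.sub (.sub (.arr 1 (.ctr 0)) (.ctr δ)) (.lit 1))
      (wireE tag (.ctr 0) (.ctr δ)) (wireE tag (.ctr 0) (.add (.ctr δ) (.lit 1)))
    (wire_injOn hα hl ht) hb
    (by simp [HExpr.eval, hρ]) (by simp [HExpr.eval, hρ]) (by omega) hv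
  rw [h]
  have m1 := single_mem_hotSpan (b := b) (w := wire α tag (ρ 0)) (show i < radix α (ρ 0) by omega)
  have m2 := single_mem_hotSpan (b := b) (w := wire α tag (ρ 0)) (show i + 1 < radix α (ρ 0) by omega)
  split_ifs
  · exact add_mem (Submodule.smul_mem _ _ m1) (Submodule.smul_mem _ _ m2)
  · exact sub_mem (Submodule.smul_mem _ _ m1) (Submodule.smul_mem _ _ m2)
  · exact single_mem_hotSpan hv

/-! ## The Fourier transform of a digit -/

/-- Preparing the Fourier state whose number is given by loop counter `1`. -/
def fourierState : Circ :=
  .seq (chain 2 1) (.loop (.arr 1 (.ctr 0))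
    (.prim (.cph (.mul (.ctr 1) (.ctr 2)) (.arr 1 (.ctr 0)) oneE (wireE 1 (.ctr 0) (.ctr 2)))))

/-- Erasing the input digit, given its Fourier state. -/
def erase : Circ :=
  .loop (.arr 1 (.ctr 0)) (.seq (.rev fourierState)
    (.seq (cnot (wireE 1 (.ctr 0) (.lit 0)) (wireE 0 (.ctr 0) (.ctr 1))) fourierState))

/-- The phases between the input digit and the output digit. -/
def digitPhases : Circ :=
  .loop (.arr 1 (.ctr 0)) (.loop (.arr 1 (.ctr 0)) (.prim (.cph (.mul (.ctr 1) (.ctr 2))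
    (.arr 1 (.ctr 0)) (wireE 0 (.ctr 0) (.ctr 1)) (wireE 1 (.ctr 0) (.ctr 2)))))

/-- The numerator of the phase between the output digit `ctr 0` and the input digit `ctr 1`, up to
the values of the digits. -/
def crossE : HExpr :=
  .mul (.mul (.arr 2 (.ctr 1)) (.arr 3 (.ctr 0)))
    (.sub (.lit 1) (.add (.sub (.arr 4 (.ctr 0)) (.arr 4 (.ctr 1)))
      (.sub (.arr 4 (.ctr 1)) (.arr 4 (.ctr 0)))))

/-- The order of the cyclic group of the digit `ctr 0`. -/
def orderE : HExpr := .mul (.mul (.arr 1 (.ctr 0)) (.arr 2 (.ctr 0))) (.arr 3 (.ctr 0))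

/-- The phases between the output digit and the remaining input digits. -/
def crossPhases : Circ :=
  .loop (scalar 0) (.loop (.arr 1 (.ctr 1)) (.loop (.arr 1 (.ctr 0))
    (.prim (.cph (.mul (.mul (.ctr 2) (.ctr 3)) crossE) orderE
      (wireE 0 (.ctr 1) (.ctr 2)) (wireE 1 (.ctr 0) (.ctr 3))))))

/-- The Fourier transform of a digit. -/
def fourierDigit : Circ :=
  .seq (cnot oneE (wireE 1 (.ctr 0) (.lit 0))) (.seq (chain 1 1)
    (.seq digitPhases (.seq erase crossPhases)))

/-- The numerator of the phase between output digit `l` and input digit `j`. -/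
def crossWeight (α : ℕ → ℕ → ℕ) (l j : ℕ) : ℕ :=
  α 2 j * α 3 l * (1 - ((α 4 l - α 4 j) + (α 4 j - α 4 l)))

/-- The order of the cyclic group of digit `l`. -/
def orderOfDigit (α : ℕ → ℕ → ℕ) (l : ℕ) : ℕ := radix α l * α 2 l * α 3 l

/-- The phase between the value `v` of output digit `l` and the input digits in `b`. -/
noncomputable def crossFactor (α : ℕ → ℕ → ℕ) (b : Config) (l v : ℕ) : ℂ :=
  ∏ j ∈ Finset.range (digitCount α), ∏ u ∈ Finset.range (radix α j),
    if b (wire α 0 j u) = true then phaseFactor (u * v * crossWeight α l j) (orderOfDigit α l) else 1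

/-- The Fourier state with number `x` on the output register of digit `l`. -/
noncomputable def fourierVec (α : ℕ → ℕ → ℕ) (b : Config) (l x : ℕ) : QState :=
  ∑ v ∈ Finset.range (radix α l), (unif (radix α l) * phaseFactor (x * v) (radix α l)) •
    Finsupp.single (hot b (wire α 1 l) v) 1

/-- On a one-hot register, a phase controlled by each wire amounts to a single phase depending on
the value. -/
theorem prod_hot {b : Config} {w : ℕ → ℕ} {p : ℕ} (hw : ∀ i < p, ∀ j < p, w i = w j → i = j)
    (hb : ∀ i < p, b (w i) = false) {v : ℕ} (hv : v < p) (χ : ℕ → ℂ) :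
    ∏ i ∈ Finset.range p, (if hot b w v (w i) = true then χ i else 1) = χ v := by
  rw [Finset.prod_eq_single v]
  · simp [hot]
  · intro i hi hiv
    rw [Finset.mem_range] at hi
    rw [if_neg]
    rw [hot, Function.update_of_ne fun h => hiv (hw _ hi _ hv h), hb i hi]
    simp
  · intro h; exact absurd (Finset.mem_range.2 hv) h

theorem op_fourierState (hα : Layout α) (hl : ρ 0 < digitCount α) {b : Config}
    (hb : ∀ u < radix α (ρ 0), b (wire α 1 (ρ 0) u) = false) (h1 : b (wire α 7 0 0) = true) :
    fourierState.op L F I α true 2 ρ (Finsupp.single (hot b (wire α 1 (ρ 0)) 0) 1) =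
      fourierVec α b (ρ 0) (ρ 1) := by
  rw [fourierState, Circ.op_seq, op_chain hα (by omega) hl (by omega) hb, map_sum, fourierVec]
  refine Finset.sum_congr rfl fun v hv => ?_
  rw [Finset.mem_range] at hv
  rw [map_smul, Circ.op_loop_diag _ _ (radix α (ρ 0)) rfl _ (fun i =>
    if hot b (wire α 1 (ρ 0)) v (wire α 1 (ρ 0) i) = true then
      phaseFactor (ρ 1 * i) (radix α (ρ 0)) else 1) fun i hi => ?_,
    prod_hot (wire_injOn hα hl (by omega)) hb hv, smul_smul]
  rw [op_cph]
  · simp only [oneE, eval_wireE, HExpr.eval, ne_eq, OfNat.zero_ne_ofNat, OfNat.one_ne_ofNat,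
      not_false_eq_true, Function.update_of_ne, Function.update_self]
    have : hot b (wire α 1 (ρ 0)) v (wire α 7 0 0) = true := by
      rw [hot, Function.update_of_ne (wire_tag_ne _ _ _ _ (by omega) (by omega) (by omega)), h1]
    simp only [this, true_and]
  · simp only [oneE, eval_wireE, HExpr.eval]
    exact wire_tag_ne _ _ _ _ (by omega) (by omega) (by omega)

theorem op_fourierState_mem (hα : Layout α) (hl : ρ 0 < digitCount α) {b : Config}
    (hb : ∀ u < radix α (ρ 0), b (wire α 1 (ρ 0) u) = false)
    {u : QState} (hu : u ∈ hotSpan b (wire α 1 (ρ 0)) (radix α (ρ 0))) :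
    fourierState.op L F I α false 2 ρ u ∈ hotSpan b (wire α 1 (ρ 0)) (radix α (ρ 0)) := by
  rw [fourierState, Circ.op_seq_false]
  refine op_chain_mem hα false (by omega) hl (by omega) hb ?_
  refine Circ.op_loop_mem _ false _ _ (fun i hi u hu => map_mem_hotSpan (fun v hv => ?_) hu) u hu
  have h2 := op_cph (L := L) (F := F) (I := I) (α := α) (δ := 3) (ρ := Function.update ρ 2 i)
    (.mul (.mul (.ctr 1) (.ctr 2)) (.sub (.arr 1 (.ctr 0)) (.lit 1))) (.arr 1 (.ctr 0)) oneE
    (wireE 1 (.ctr 0) (.ctr 2))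
    (by simp only [oneE, eval_wireE]; exact wire_tag_ne _ _ _ _ (by omega) (by omega) (by omega))
    (hot b (wire α 1 (ρ 0)) v)
  -- The inverse of a phase is again a phase, with the numerator multiplied by `b - 1`, so the lemma
  -- for the forward direction applies to it.
  have h3 : (Circ.prim (.cph (.mul (.ctr 1) (.ctr 2)) (.arr 1 (.ctr 0)) oneE
      (wireE 1 (.ctr 0) (.ctr 2)))).op L F I α false 3 (Function.update ρ 2 i) =
      (Circ.prim (.cph (.mul (.mul (.ctr 1) (.ctr 2)) (.sub (.arr 1 (.ctr 0)) (.lit 1)))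
        (.arr 1 (.ctr 0)) oneE (wireE 1 (.ctr 0) (.ctr 2)))).op L F I α true 3
        (Function.update ρ 2 i) := rfl
  rw [h3, h2]
  exact Submodule.smul_mem _ _ (single_mem_hotSpan hv)

/-- Up to the common factor `1 / p` this is the orthogonality of two different characters of the
cyclic group of order `p`. -/
theorem inner_fourierVec (hα : Layout α) {l : ℕ} (hl : l < digitCount α) {b : Config}
    (hb : ∀ u < radix α l, b (wire α 1 l u) = false) {x z : ℕ} (hx : x < radix α l)
    (hz : z < radix α l) (hxz : x ≠ z) : inner (fourierVec α b l z) (fourierVec α b l x) = 0 := by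
  classical
  have coef : ∀ v ∈ Finset.range (radix α l), inner ((unif (radix α l) *
      phaseFactor (z * v) (radix α l)) • Finsupp.single (hot b (wire α 1 l) v) 1)
        (fourierVec α b l x) = conj (unif (radix α l) * phaseFactor (z * v) (radix α l)) *
          (unif (radix α l) * phaseFactor (x * v) (radix α l)) := by
    intro v hv
    rw [inner_smul_left, inner_single_left, map_one, one_mul, fourierVec, Finsupp.finsetSum_apply,
      Finset.sum_eq_single v]
    · simp
    · intro v' hv' h
      rw [Finsupp.smul_apply, Finsupp.single_apply, if_neg, smul_zero]
      exact fun e => h (hot_injOn (wire_injOn hα hl (by omega)) hb (Finset.mem_range.1 hv')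
        (Finset.mem_range.1 hv) e)
    · exact fun h => absurd hv h
  rw [show fourierVec α b l z = ∑ v ∈ Finset.range (radix α l), (unif (radix α l) *
    phaseFactor (z * v) (radix α l)) • Finsupp.single (hot b (wire α 1 l) v) 1 from rfl,
    inner_sum_left, Finset.sum_congr rfl coef]
  simp only [map_mul, conj_unif]
  have := sum_conj_phaseFactor hx hz hxz
  calc _ = unif (radix α l) * unif (radix α l) * ∑ v ∈ Finset.range (radix α l),
      conj (phaseFactor (z * v) (radix α l)) * phaseFactor (x * v) (radix α l) := by
        rw [Finset.mul_sum]
        exact Finset.sum_congr rfl fun v _ => by ring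
    _ = 0 := by rw [this, mul_zero]

theorem hot_comm {b : Config} {w w' : ℕ → ℕ} {u v : ℕ} (h : w u ≠ w' v) :
    hot (hot b w u) w' v = hot (hot b w' v) w u := by
  unfold hot
  rw [Function.update_comm h]

/-- For each candidate `z` the Fourier state with number `z` is undone. If `z = x`, the output
register becomes the configuration with value `0`, and a negation controlled by it clears wire `x`
of the input. If `z ≠ x`, orthogonality leaves no amplitude on value `0`, so the negation does
nothing. In both cases the Fourier state is then restored. Thus the input digit is erased without
being measured and without error. -/
theorem op_erase (hα : Layout α) (hl : ρ 0 < digitCount α) {b : Config} {x : ℕ}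
    (hx : x < radix α (ρ 0)) (hb : ∀ u < radix α (ρ 0), b (wire α 1 (ρ 0) u) = false)
    (hb' : ∀ u < radix α (ρ 0), b (wire α 0 (ρ 0) u) = false) (h1 : b (wire α 7 0 0) = true) :
    erase.op L F I α true 1 ρ (fourierVec α (hot b (wire α 0 (ρ 0)) x) (ρ 0) x) =
      fourierVec α b (ρ 0) x := by
  set l := ρ 0 with hldef
  set X := wire α 0 l
  set Y := wire α 1 l
  have hXY : ∀ u v, X u ≠ Y v := fun u v => wire_tag_ne _ _ _ _ (by omega) (by omega) (by omega)
  have hX := wire_injOn hα hl (tag := 0) (by omega)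
  have hY := wire_injOn hα hl (tag := 1) (by omega)
  have key := Circ.op_loop (L := L) (F := F) (I := I) (α := α) (δ := 1) (ρ := ρ)
    (.arr 1 (.ctr 0)) (.seq (.rev fourierState)
    (.seq (cnot (wireE 1 (.ctr 0) (.lit 0)) (wireE 0 (.ctr 0) (.ctr 1))) fourierState))
    (radix α l) rfl
    -- Before iteration `z` the input digit is still present exactly if `z ≤ x`.
    (fun z => fourierVec α (if z ≤ x then hot b X x else b) l x) ?_
  · simp only [Nat.zero_le, if_true, if_neg (show ¬ radix α l ≤ x by omega)] at key
    exact key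
  intro z hz
  have hρ : Function.update ρ 1 z 0 = l := Function.update_of_ne (by omega) _ _
  have hl' : Function.update ρ 1 z 0 < digitCount α := by rw [hρ]; exact hl
  rw [Circ.op_seq, Circ.op_seq, Circ.op_rev]
  have hstate : ∀ b : Config, (∀ u < radix α l, b (Y u) = false) → b (wire α 7 0 0) = true →
      fourierState.op L F I α true 2 (Function.update ρ 1 z) (Finsupp.single (hot b Y 0) 1) =
      fourierVec α b l z := by
    intro b hb h1
    have := op_fourierState (L := L) (F := F) (I := I) (ρ := Function.update ρ 1 z) hα hl' (b := b)
      (by rw [hρ]; exact hb) h1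
    rw [hρ, Function.update_self] at this
    exact this
  have hhot : (∀ u < radix α l, hot b X x (Y u) = false) ∧ hot b X x (wire α 7 0 0) = true := by
    refine ⟨fun u hu => ?_, ?_⟩
    · rw [hot, Function.update_of_ne (hXY _ _).symm, hb u hu]
    · rw [hot, Function.update_of_ne (wire_tag_ne _ _ _ _ (by omega) (by omega) (by omega)), h1]
  have hinv : ∀ b : Config, (∀ u < radix α l, b (Y u) = false) → b (wire α 7 0 0) = true →
      fourierState.op L F I α (!true) 2 (Function.update ρ 1 z) (fourierVec α b l z) =
      Finsupp.single (hot b Y 0) 1 := by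
    intro b hb h1
    rw [← hstate b hb h1]
    exact Circ.op_op_not (!true) fourierState _
  have hcnot : ∀ e : Config, (cnot (wireE 1 (.ctr 0) (.lit 0)) (wireE 0 (.ctr 0) (.ctr 1))).op L F I α
      true 2 (Function.update ρ 1 z) (Finsupp.single e 1) =
      Finsupp.single (Function.update e (X z) (xor (e (X z)) (e (Y 0)))) 1 := by
    intro e
    rw [op_cnot]
    · simp only [eval_wireE, HExpr.eval, hρ, Function.update_self, X, Y]
    · simp only [eval_wireE, HExpr.eval, hρ, Function.update_self]
      exact hXY _ _
  by_cases hzx : z = x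
  · subst hzx
    rw [if_pos le_rfl, if_neg (by omega), hinv _ hhot.1 hhot.2, hcnot]
    have e1 : hot (hot b X z) Y 0 (X z) = true := by
      rw [hot, Function.update_of_ne (hXY _ _), hot, Function.update_self]
    have e2 : hot (hot b X z) Y 0 (Y 0) = true := by rw [hot, Function.update_self]
    have e3 : Function.update (hot (hot b X z) Y 0) (X z) false = hot b Y 0 := by
      rw [hot, Function.update_comm (hXY _ _).symm, hot, Function.update_idem,
        show Function.update b (X z) false = b by rw [Function.update_eq_self_iff, hb' z hz]]
      rfl
    rw [e1, e2, Bool.xor_self, e3, hstate b hb h1]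
  · have hB : (if z ≤ x then hot b X x else b) = (if z + 1 ≤ x then hot b X x else b) := by
      by_cases h : z ≤ x
      · rw [if_pos h, if_pos (by omega)]
      · rw [if_neg h, if_neg (by omega)]
    rw [← hB]
    set e : Config := if z ≤ x then hot b X x else b with he
    have heY : ∀ u < radix α l, e (Y u) = false := by
      rw [he]; split_ifs
      · exact hhot.1
      · exact hb
    have he1 : e (wire α 7 0 0) = true := by
      rw [he]; split_ifs
      · exact hhot.2
      · exact h1
    have hmem : fourierVec α e l x ∈ hotSpan e Y (radix α l) :=
      Submodule.sum_mem _ fun v hv =>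
        Submodule.smul_mem _ _ (single_mem_hotSpan (Finset.mem_range.1 hv))
    have hmem' : fourierState.op L F I α (!true) 2 (Function.update ρ 1 z) (fourierVec α e l x) ∈
        hotSpan e Y (radix α l) := by
      have := op_fourierState_mem (L := L) (F := F) (I := I) (ρ := Function.update ρ 1 z) hα hl'
        (b := e) (by rw [hρ]; exact heY) (u := fourierVec α e l x) (by rw [hρ]; exact hmem)
      rwa [hρ] at this
    -- By adjointness this coefficient is the inner product of the Fourier states with numbers `z`
    -- and `x`.
    have hcoef : fourierState.op L F I α (!true) 2 (Function.update ρ 1 z) (fourierVec α e l x)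
        (hot e Y 0) = 0 := by
      have h2 := Circ.inner_op (L := L) (F := F) (I := I) (α := α) (δ := 2)
        (ρ := Function.update ρ 1 z) true fourierState (Finsupp.single (hot e Y 0) 1)
        (fourierVec α e l x)
      rw [hstate e heY he1, inner_fourierVec hα hl heY hx hz (Ne.symm hzx), inner_single_left,
        map_one, one_mul] at h2
      exact h2.symm
    rw [eq_of_mem_hotSpan hY heY (hα.radix_pos l hl) (fun v hv hv0 => ?_) hmem' hcoef]
    · exact Circ.op_op_not true fourierState _
    · rw [hcnot]
      have : hot e Y v (Y 0) = false := by
        rw [hot, Function.update_of_ne fun h => hv0 (hY _ hv _ (by omega) h.symm),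
          heY 0 (by omega)]
      rw [this, Bool.xor_false, Function.update_eq_self]

theorem op_digitPhases (hα : Layout α) (hl : ρ 0 < digitCount α) {b : Config} {x v : ℕ}
    (hx : x < radix α (ρ 0)) (hv : v < radix α (ρ 0))
    (hb : ∀ u < radix α (ρ 0), b (wire α 1 (ρ 0) u) = false)
    (hb' : ∀ u < radix α (ρ 0), b (wire α 0 (ρ 0) u) = false) :
    digitPhases.op L F I α true 1 ρ
      (Finsupp.single (hot (hot b (wire α 0 (ρ 0)) x) (wire α 1 (ρ 0)) v) 1) =
      phaseFactor (x * v) (radix α (ρ 0)) •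
        Finsupp.single (hot (hot b (wire α 0 (ρ 0)) x) (wire α 1 (ρ 0)) v) 1 := by
  set l := ρ 0 with hldef
  set X := wire α 0 l with hXdef
  set Y := wire α 1 l with hYdef
  have hXY : ∀ u v, X u ≠ Y v := fun u v => wire_tag_ne _ _ _ _ (by omega) (by omega) (by omega)
  have hX := wire_injOn hα hl (tag := 0) (by omega)
  have hY := wire_injOn hα hl (tag := 1) (by omega)
  rw [digitPhases, Circ.op_loop_diag _ _ (radix α l) rfl _ (fun u =>
    if hot (hot b X x) Y v (X u) = true then phaseFactor (u * v) (radix α l) else 1)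
    fun u hu => ?_]
  · rw [hot_comm (hXY _ _), prod_hot hX (fun i hi => by
      rw [hot, Function.update_of_ne (hXY _ _), hb' i hi]) hx]
  · rw [Circ.op_loop_diag _ _ (radix α l) rfl _ (fun i =>
      if hot (hot b X x) Y v (Y i) = true then (if hot (hot b X x) Y v (X u) = true then
        phaseFactor (u * i) (radix α l) else 1) else 1) fun i hi => ?_]
    · rw [prod_hot hY (fun i hi => by
        rw [hot, Function.update_of_ne (hXY _ _).symm, hb i hi]) hv]
    · rw [op_cph]
      · simp only [eval_wireE, HExpr.eval, Function.update_apply, Nat.reduceAdd, reduceIte,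
          OfNat.zero_ne_ofNat, OfNat.one_ne_ofNat, OfNat.ofNat_ne_one,
          zero_ne_one]
        rw [← hldef, ← hXdef, ← hYdef]
        congr 1
        by_cases g1 : hot (hot b X x) Y v (X u) = true <;>
          by_cases g2 : hot (hot b X x) Y v (Y i) = true <;> simp [g1, g2]
      · simp only [eval_wireE, HExpr.eval]
        exact wire_tag_ne _ _ _ _ (by omega) (by omega) (by omega)

theorem op_crossPhases (hα : Layout α) (hl : ρ 0 < digitCount α) {b : Config} {v : ℕ}
    (hv : v < radix α (ρ 0)) (hb : ∀ u < radix α (ρ 0), b (wire α 1 (ρ 0) u) = false) :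
    crossPhases.op L F I α true 1 ρ (Finsupp.single (hot b (wire α 1 (ρ 0)) v) 1) =
      crossFactor α b (ρ 0) v • Finsupp.single (hot b (wire α 1 (ρ 0)) v) 1 := by
  set l := ρ 0 with hldef
  have hY := wire_injOn hα hl (tag := 1) (by omega)
  have hXY : ∀ j u, hot b (wire α 1 l) v (wire α 0 j u) = b (wire α 0 j u) := fun j u => by
    rw [hot, Function.update_of_ne (wire_tag_ne _ _ _ _ (by omega) (by omega) (by omega))]
  rw [crossPhases, crossFactor, Circ.op_loop_diag _ _ (digitCount α) rfl _ _ fun j hj => ?_]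
  rw [Circ.op_loop_diag _ _ (radix α j) (by simp [HExpr.eval]) _ _ fun u hu => ?_]
  rw [Circ.op_loop_diag _ _ (radix α l) rfl _ (fun i =>
      if hot b (wire α 1 l) v (wire α 1 l i) = true then (if b (wire α 0 j u) = true then
        phaseFactor (u * i * crossWeight α l j) (orderOfDigit α l) else 1) else 1) fun i hi => ?_]
  · rw [prod_hot hY hb hv]
  · rw [op_cph]
    · simp only [crossE, orderE, eval_wireE, HExpr.eval, Function.update_apply, Nat.reduceAdd, Nat.reduceEqDiff, reduceIte,
          OfNat.zero_ne_ofNat, OfNat.one_ne_ofNat, OfNat.ofNat_ne_one,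
          zero_ne_one]
      rw [← hldef, hXY, crossWeight, orderOfDigit]
      congr 1
      by_cases g1 : b (wire α 0 j u) = true <;>
        by_cases g2 : hot b (wire α 1 l) v (wire α 1 l i) = true <;> simp [g1, g2]
    · simp only [eval_wireE, HExpr.eval]
      exact wire_tag_ne _ _ _ _ (by omega) (by omega) (by omega)

/-- The phases with the own input digit must come before its erasure and complete the Fourier state.
The remaining phases form a diagonal operator controlled by the other input digits, which would
spoil the Fourier state, and so they come afterwards. -/
theorem op_fourierDigit (hα : Layout α) (hl : ρ 0 < digitCount α) {b : Config} {x : ℕ}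
    (hx : x < radix α (ρ 0)) (hb : ∀ u < radix α (ρ 0), b (wire α 1 (ρ 0) u) = false)
    (hb' : ∀ u < radix α (ρ 0), b (wire α 0 (ρ 0) u) = false) (h1 : b (wire α 7 0 0) = true) :
    fourierDigit.op L F I α true 1 ρ (Finsupp.single (hot b (wire α 0 (ρ 0)) x) 1) =
      ∑ v ∈ Finset.range (radix α (ρ 0)),
        (unif (radix α (ρ 0)) * phaseFactor (x * v) (radix α (ρ 0)) * crossFactor α b (ρ 0) v) •
          Finsupp.single (hot b (wire α 1 (ρ 0)) v) 1 := by
  have hXY : ∀ u v, wire α 0 (ρ 0) u ≠ wire α 1 (ρ 0) v :=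
    fun u v => wire_tag_ne _ _ _ _ (by omega) (by omega) (by omega)
  have hp := hα.radix_pos _ hl
  have g1 : hot b (wire α 0 (ρ 0)) x (wire α 7 0 0) = true := by
    rw [hot, Function.update_of_ne (wire_tag_ne _ _ _ _ (by omega) (by omega) (by omega)), h1]
  have g2 : ∀ u < radix α (ρ 0), hot b (wire α 0 (ρ 0)) x (wire α 1 (ρ 0) u) = false := by
    intro u hu
    rw [hot, Function.update_of_ne (hXY _ _).symm, hb u hu]
  rw [fourierDigit, Circ.op_seq, op_cnot, Circ.op_seq, Circ.op_seq, Circ.op_seq]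
  · simp only [oneE, eval_wireE, HExpr.eval, g1, g2 0 hp, Bool.false_xor]
    change (crossPhases.op L F I α true 1 ρ) ((erase.op L F I α true 1 ρ)
      ((digitPhases.op L F I α true 1 ρ) (((chain 1 1).op L F I α true 1 ρ)
        (Finsupp.single (hot (hot b (wire α 0 (ρ 0)) x) (wire α 1 (ρ 0)) 0) 1)))) = _
    rw [op_chain hα (by omega) hl (by omega) g2, map_sum]
    have h2 : ∑ v ∈ Finset.range (radix α (ρ 0)), digitPhases.op L F I α true 1 ρ
        (unif (radix α (ρ 0)) •
          Finsupp.single (hot (hot b (wire α 0 (ρ 0)) x) (wire α 1 (ρ 0)) v) 1) =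
        fourierVec α (hot b (wire α 0 (ρ 0)) x) (ρ 0) x := by
      refine Finset.sum_congr rfl fun v hv => ?_
      rw [map_smul, op_digitPhases hα hl hx (Finset.mem_range.1 hv) hb hb', smul_smul]
    rw [h2, op_erase hα hl hx hb hb' h1, fourierVec, map_sum]
    refine Finset.sum_congr rfl fun v hv => ?_
    rw [map_smul, op_crossPhases hα hl (Finset.mem_range.1 hv) hb, smul_smul]
  · simp only [oneE, eval_wireE, HExpr.eval]
    exact wire_tag_ne _ _ _ _ (by omega) (by omega) (by omega)

end

end QAlg

namespace QAlg

/-! ## Sums over tuples of digits -/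

open Classical in
/-- The sequences with entries `d l < p l` for `l < t` and zeros afterwards. -/
noncomputable def tuples (p : ℕ → ℕ) : ℕ → Finset (ℕ → ℕ)
  | 0 => {0}
  | t + 1 => (tuples p t ×ˢ Finset.range (p t)).image fun x => Function.update x.1 t x.2

theorem mem_tuples {p : ℕ → ℕ} {t : ℕ} {d : ℕ → ℕ} :
    d ∈ tuples p t ↔ (∀ l < t, d l < p l) ∧ ∀ l, t ≤ l → d l = 0 := by
  induction t generalizing d with
  | zero =>
    simp only [tuples, Finset.mem_singleton, not_lt_zero, false_imp_iff, implies_true, true_and,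
      zero_le, true_imp_iff]
    exact ⟨fun h => by simp [h], fun h => funext h⟩
  | succ t ih =>
    simp only [tuples, Finset.mem_image, Finset.mem_product, Finset.mem_range, Prod.exists]
    constructor
    · rintro ⟨d', v, ⟨hd, hv⟩, rfl⟩
      obtain ⟨h1, h2⟩ := ih.1 hd
      constructor
      · intro l hl
        by_cases h : l = t
        · subst h; rwa [Function.update_self]
        · rw [Function.update_of_ne h]; exact h1 l (by omega)
      · intro l hl
        rw [Function.update_of_ne (by omega)]
        exact h2 l (by omega)
    · rintro ⟨h1, h2⟩
      refine ⟨Function.update d t 0, d t, ⟨ih.2 ⟨fun l hl => ?_, fun l hl => ?_⟩, h1 t (by omega)⟩, ?_⟩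
      · rw [Function.update_of_ne (by omega)]; exact h1 l (by omega)
      · by_cases h : l = t
        · subst h; rw [Function.update_self]
        · rw [Function.update_of_ne h]; exact h2 l (by omega)
      · simp

theorem update_injOn_tuples (p : ℕ → ℕ) (t : ℕ) :
    Set.InjOn (fun x : (ℕ → ℕ) × ℕ => Function.update x.1 t x.2)
      (tuples p t ×ˢ Finset.range (p t) : Finset _) := by
  rintro ⟨d, v⟩ hd ⟨d', v'⟩ hd' h
  simp only [Finset.coe_product, Set.mem_prod, Finset.mem_coe, mem_tuples] at hd hd' h
  have hv : v = v' := by simpa using congrFun h t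
  refine Prod.ext (funext fun l => ?_) hv
  by_cases hl : l = t
  · subst hl
    exact (hd.1.2 l le_rfl).trans (hd'.1.2 l le_rfl).symm
  · simpa [hl] using congrFun h l

theorem sum_tuples_succ {A : Type*} [AddCommMonoid A] (p : ℕ → ℕ) (t : ℕ) (g : (ℕ → ℕ) → A) :
    ∑ d ∈ tuples p (t + 1), g d =
      ∑ d ∈ tuples p t, ∑ v ∈ Finset.range (p t), g (Function.update d t v) := by
  classical
  rw [tuples, Finset.sum_image (update_injOn_tuples p t), Finset.sum_product]

theorem card_tuples (p : ℕ → ℕ) (t : ℕ) : (tuples p t).card = ∏ l ∈ Finset.range t, p l := by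
  classical
  induction t with
  | zero => simp [tuples]
  | succ t ih =>
    rw [tuples, Finset.card_image_of_injOn (update_injOn_tuples p t), Finset.card_product, ih,
      Finset.card_range, Finset.prod_range_succ]

section

variable {k L : ℕ} {F : (Fin k → ℕ) → ℕ} {I : ℕ → ℕ} {α : ℕ → ℕ → ℕ} {δ : ℕ} {ρ : ℕ → ℕ}

/-- Every iteration branches into the values of one further digit. The final state is a sum over all
paths, each path being recorded in its configuration and weighted by the product of its amplitudes.
-/
theorem op_loop_tuples (bound : HExpr) (body : Circ) (n : ℕ) (hn : bound.eval I α ρ = n)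
    (p : ℕ → ℕ) (c : ℕ → (ℕ → ℕ) → Config) (a : ℕ → ℕ → ℂ)
    (h : ∀ l < n, ∀ d ∈ tuples p l,
      body.op L F I α true (δ + 1) (Function.update ρ δ l) (Finsupp.single (c l d) 1) =
      ∑ v ∈ Finset.range (p l), a l v • Finsupp.single (c (l + 1) (Function.update d l v)) 1) :
    (Circ.loop bound body).op L F I α true δ ρ (Finsupp.single (c 0 0) 1) =
      ∑ d ∈ tuples p n, (∏ l ∈ Finset.range n, a l (d l)) • Finsupp.single (c n d) 1 := by
  have key := Circ.op_loop (L := L) (F := F) (δ := δ) (ρ := ρ) bound body n hn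
    (fun t => ∑ d ∈ tuples p t, (∏ l ∈ Finset.range t, a l (d l)) •
      Finsupp.single (c t d) (1 : ℂ)) fun t ht => ?_
  · simpa [tuples] using key
  · simp only [map_sum, map_smul]
    rw [sum_tuples_succ]
    refine Finset.sum_congr rfl fun d hd => ?_
    rw [h t ht d hd, Finset.smul_sum]
    refine Finset.sum_congr rfl fun v _ => ?_
    rw [smul_smul, Finset.prod_range_succ, Function.update_self]
    congr 2
    refine Finset.prod_congr rfl fun l hl => ?_
    rw [Function.update_of_ne (Finset.mem_range.1 hl).ne]

/-! ## One-hot registers -/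

open Classical in
/-- The configuration `b` with the one-hot registers of kind `tag` of the digits from `lo` up to
`hi` set to the values in `e`. -/
noncomputable def put (α : ℕ → ℕ → ℕ) (tag lo hi : ℕ) (e : ℕ → ℕ) (b : Config) : Config :=
  fun w => b w || decide (∃ j, lo ≤ j ∧ j < hi ∧ w = wire α tag j (e j))

theorem put_of_ne {tag lo hi : ℕ} {e : ℕ → ℕ} {b : Config} {w : ℕ}
    (h : ∀ j < hi, w ≠ wire α tag j (e j)) : put α tag lo hi e b w = b w := by
  have : ¬ ∃ j, lo ≤ j ∧ j < hi ∧ w = wire α tag j (e j) := fun ⟨j, _, h1, h2⟩ => h j h1 h2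
  simp [put, this]

theorem put_tag_ne {tag lo hi : ℕ} {e : ℕ → ℕ} {b : Config} {tag' l i : ℕ} (ht : tag < 16)
    (ht' : tag' < 16) (h : tag' ≠ tag) :
    put α tag lo hi e b (wire α tag' l i) = b (wire α tag' l i) :=
  put_of_ne fun _ _ => wire_tag_ne _ _ _ _ ht' ht h

theorem put_low {tag lo hi : ℕ} {e : ℕ → ℕ} {b : Config} {w : ℕ}
    (hw : w < 2 * totalBits α + fieldBits α) : put α tag lo hi e b w = b w :=
  put_of_ne fun _ _ => by unfold wire; omega

theorem put_wire {tag lo hi : ℕ} {e : ℕ → ℕ} {b : Config} {l i : ℕ} (ht : tag < 16)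
    (he : ∀ j < hi, e j < stride α) (hi' : i < stride α) :
    put α tag lo hi e b (wire α tag l i) =
      (b (wire α tag l i) || decide (lo ≤ l ∧ l < hi ∧ i = e l)) := by
  unfold put
  congr 1
  rw [decide_eq_decide]
  constructor
  · rintro ⟨j, h1, h2, h3⟩
    obtain ⟨-, rfl, h4⟩ := (wire_inj ht ht hi' (he j h2)).1 h3
    exact ⟨h1, h2, h4⟩
  · rintro ⟨h1, h2, rfl⟩
    exact ⟨l, h1, h2, rfl⟩

theorem hot_apply (b : Config) (w : ℕ → ℕ) (v x : ℕ) : hot b w v x = (b x || decide (x = w v)) := by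
  unfold hot
  by_cases h : x = w v
  · simp [h]
  · simp [h]

theorem hot_put {tag lo hi : ℕ} (h : lo ≤ hi) (e : ℕ → ℕ) (b : Config) (v : ℕ) :
    hot (put α tag lo hi e b) (wire α tag hi) v =
      put α tag lo (hi + 1) (Function.update e hi v) b := by
  classical
  funext w
  rw [hot_apply, put, put, Bool.or_assoc, ← Bool.decide_or]
  congr 1
  rw [decide_eq_decide]
  constructor
  · rintro (⟨j, h1, h2, h3⟩ | h1)
    · exact ⟨j, h1, by omega, by rwa [Function.update_of_ne (by omega)]⟩
    · exact ⟨hi, h, by omega, by rwa [Function.update_self]⟩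
  · rintro ⟨j, h1, h2, h3⟩
    by_cases hj : j = hi
    · subst hj
      rw [Function.update_self] at h3
      exact Or.inr h3
    · rw [Function.update_of_ne hj] at h3
      exact Or.inl ⟨j, h1, by omega, h3⟩

theorem put_eq_hot {tag lo hi : ℕ} (h : lo < hi) (e : ℕ → ℕ) (b : Config) :
    put α tag lo hi e b = hot (put α tag (lo + 1) hi e b) (wire α tag lo) (e lo) := by
  classical
  funext w
  rw [hot_apply, put, put, Bool.or_assoc, ← Bool.decide_or]
  congr 1
  rw [decide_eq_decide]
  constructor
  · rintro ⟨j, h1, h2, h3⟩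
    by_cases hj : j = lo
    · subst hj
      exact Or.inr h3
    · exact Or.inl ⟨j, by omega, h2, h3⟩
  · rintro (⟨j, h1, h2, h3⟩ | h1)
    · exact ⟨j, by omega, h2, h3⟩
    · exact ⟨lo, le_rfl, h, h1⟩

theorem put_self {tag lo : ℕ} (e : ℕ → ℕ) (b : Config) : put α tag lo lo e b = b := by
  funext w
  have : ¬ ∃ j, lo ≤ j ∧ j < lo ∧ w = wire α tag j (e j) := fun ⟨j, _, _, _⟩ => by omega
  simp [put, this]

theorem put_hot (tag lo hi v : ℕ) (w : ℕ → ℕ) (e : ℕ → ℕ) (b : Config) :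
    put α tag lo hi e (hot b w v) = hot (put α tag lo hi e b) w v := by
  funext x
  simp only [put, hot_apply, Bool.or_assoc, Bool.or_comm]
  rw [Bool.or_left_comm]

/-! ## The stages of the algorithm -/

/-- Preparing a uniform superposition of all group elements. -/
def prepare : Circ :=
  .loop (scalar 0) (.seq (cnot oneE (wireE 0 (.ctr 0) (.lit 0))) (chain 1 0))

/-- Evaluating the function. -/
def oracle : Circ :=
  .seq (toBinary 0 2 (scalar 1)) (.seq (.prim (.query (scalar 1) (.mul (.lit 2) (scalar 1))))
    (.rev (toBinary 0 2 (scalar 1))))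

/-- The Fourier transform. -/
def fourier : Circ := .loop (scalar 0) fourierDigit

/-- The initial configuration for the algorithm: the wires for the constants are set. -/
def start (α : ℕ → ℕ → ℕ) : Config := Function.update (fun _ => false) (wire α 7 0 0) true

/-- The configuration `b` with the number `y` in the register for the value of the function. -/
def withValue (α : ℕ → ℕ → ℕ) (y : ℕ) (b : Config) : Config := fun w =>
  if 2 * totalBits α ≤ w ∧ w < 2 * totalBits α + fieldBits α then y.testBit (w - 2 * totalBits α)
  else b w

theorem withValue_wire {y : ℕ} {b : Config} {tag l i : ℕ} :
    withValue α y b (wire α tag l i) = b (wire α tag l i) := by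
  rw [withValue, if_neg]
  unfold wire
  omega

theorem start_of_ne {w : ℕ} (h : w ≠ wire α 7 0 0) : start α w = false :=
  Function.update_of_ne h _ _

theorem start_tag {tag l i : ℕ} (ht : tag < 7) : start α (wire α tag l i) = false :=
  start_of_ne (wire_tag_ne _ _ _ _ (by omega) (by omega) (by omega))

theorem start_low {w : ℕ} (hw : w < 2 * totalBits α + fieldBits α) : start α w = false :=
  start_of_ne (by unfold wire; omega)

theorem mem_tuples_stride (hα : Layout α) {n : ℕ} (hn : n ≤ digitCount α) {d : ℕ → ℕ}
    (hd : d ∈ tuples (radix α) n) : ∀ l < n, d l < stride α := fun l hl =>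
  ((mem_tuples.1 hd).1 l hl).trans_le (hα.radix_le l (by omega))

theorem op_prepare (hα : Layout α) :
    prepare.op L F I α true 0 ρ (Finsupp.single (start α) 1) =
      ∑ e ∈ tuples (radix α) (digitCount α), (∏ l ∈ Finset.range (digitCount α), unif (radix α l)) •
        Finsupp.single (put α 0 0 (digitCount α) e (start α)) 1 := by
  have := op_loop_tuples (L := L) (F := F) (I := I) (δ := 0) (ρ := ρ) (scalar 0)
    (.seq (cnot oneE (wireE 0 (.ctr 0) (.lit 0))) (chain 1 0)) (digitCount α) rfl (radix α)
    (fun l d => put α 0 0 l d (start α)) (fun l _ => unif (radix α l)) ?_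
  · rwa [put_self] at this
  intro l hl d hd
  have hρ : Function.update ρ 0 l 0 = l := Function.update_self _ _ _
  have hS := mem_tuples_stride hα hl.le hd
  have hb : ∀ u < radix α (Function.update ρ 0 l 0),
      put α 0 0 l d (start α) (wire α 0 (Function.update ρ 0 l 0) u) = false := by
    rw [hρ]
    intro u hu
    have := hα.radix_le l hl
    rw [put_wire (by omega) hS (by omega), start_tag (by omega)]
    simp
  have := op_chain (L := L) (F := F) (I := I) (δ := 1) hα (by omega) (by rw [hρ]; exact hl)
    (show 0 < 16 by omega) hb
  rw [hρ] at this hb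
  rw [Circ.op_seq, op_cnot]
  · simp only [oneE, eval_wireE, HExpr.eval, hρ]
    rw [hb 0 (hα.radix_pos l hl), put_tag_ne (by omega) (by omega) (by omega), start,
      Function.update_self, Bool.false_xor]
    refine this.trans (Finset.sum_congr rfl fun v hv => ?_)
    rw [hot_put (Nat.zero_le _)]
    rfl
  · simp only [oneE, eval_wireE, HExpr.eval]
    exact wire_tag_ne _ _ _ _ (by omega) (by omega) (by omega)

/-- The conversion neither reads nor writes the register for the value of the function, so it can be
undone after the query as if nothing had happened. -/
theorem toBinary_operands (I : ℕ → ℕ) (ρ : ℕ → ℕ) (tag a : ℕ) (base : HExpr) (x : ℕ)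
    (hbase : ∀ ρ, base.eval I α ρ = x) (hx : x + totalBits α ≤ 2 * totalBits α) :
    (toBinary tag a base).All I α (fun s => ∀ w ∈ s.operands,
      ¬ (2 * totalBits α ≤ w ∧ w < 2 * totalBits α + fieldBits α)) 0 ρ := by
  have hw : ∀ tag l i, ¬ (2 * totalBits α ≤ wire α tag l i ∧
      wire α tag l i < 2 * totalBits α + fieldBits α) := by
    intro tag l i; unfold wire; omega
  have hw' : ∀ tag l i j, ¬ (2 * totalBits α ≤ wire α tag l i + j ∧
      wire α tag l i + j < 2 * totalBits α + fieldBits α) := by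
    intro tag l i; unfold wire; omega
  simp only [toBinary, loadAddend, addBit, cnot, Circ.All, Step.map, Step.operands, eval_scalar,
    HExpr.eval, eval_wireE, hbase, List.mem_cons, forall_eq_or_imp, List.not_mem_nil,
    false_imp_iff, implies_true, and_true, hw, hw', not_false_eq_true, true_and]
  simp only [Function.update_self]
  intro i (hi : i < totalBits α)
  omega

/-! ### Digits of group elements and the evaluation of the function. -/

/-- The value of the coordinate `i` of the group element with the digits `e`. -/
def coord (α : ℕ → ℕ → ℕ) (a : ℕ) (e : ℕ → ℕ) (i : ℕ) : ℕ :=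
  ∑ l ∈ Finset.range (digitCount α), if α 4 l = i then e l * α a l else 0

/-- The conditions on the representation of the coordinates of group elements, numbers below
`M i < 2 ^ L`, by digits. -/
structure Digits (α : ℕ → ℕ → ℕ) (k L : ℕ) (M : ℕ → ℕ) : Prop extends Layout α where
  totalBits_eq : totalBits α = k * L
  fieldBits_eq : fieldBits α = L
  fieldBits_pos : 0 < L
  index_lt : ∀ l < digitCount α, α 4 l < k
  lt_pow : ∀ i < k, M i < 2 ^ L
  coord_in_lt : ∀ e ∈ tuples (radix α) (digitCount α), ∀ i < k, coord α 2 e i < M i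
  coord_out_lt : ∀ e ∈ tuples (radix α) (digitCount α), ∀ i < k, coord α 3 e i < M i
  order_eq : ∀ l < digitCount α, orderOfDigit α l = M (α 4 l)
  order_pos : ∀ i < k, 0 < M i
  dvd : ∀ j l, j < l → l < digitCount α → α 4 j = α 4 l → M (α 4 l) ∣ α 2 j * α 3 l
  exists_coord_in : ∀ x : ℕ → ℕ, (∀ i < k, x i < M i) →
    ∃ e ∈ tuples (radix α) (digitCount α), ∀ i < k, coord α 2 e i = x i
  weight_out_pos : ∀ l < digitCount α, 0 < α 3 l
  card : ∏ l ∈ Finset.range (digitCount α), radix α l = ∏ i ∈ Finset.range k, M i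

/-- A digit of coordinate `i` enters with the additional factor `2 ^ (i * L)`, so a single sum over
all digits computes all coordinates at once, side by side in fields of `L` bits. -/
theorem sum_digitWeight {M : ℕ → ℕ} (hα : Digits α k L M) (a : ℕ) (e : ℕ → ℕ) :
    ∑ l ∈ Finset.range (digitCount α), e l * digitWeight α a l =
      digitSum (2 ^ L) (coord α a e) k := by
  unfold digitSum coord
  simp only [Finset.sum_mul]
  rw [Finset.sum_comm]
  refine Finset.sum_congr rfl fun l hl => ?_
  rw [Finset.mem_range] at hl
  have hi := hα.index_lt l hl
  rw [Finset.sum_eq_single (α 4 l)]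
  · rw [if_pos rfl, digitWeight, hα.pow, hα.fieldBits_eq, ← pow_mul, mul_comm L]
    · ring
    · rw [hα.totalBits_eq, hα.fieldBits_eq]
      exact Nat.mul_lt_mul_of_pos_right hi hα.fieldBits_pos
  · intro i _ h
    rw [if_neg (Ne.symm h), zero_mul]
  · intro h
    exact absurd (Finset.mem_range.2 hi) h

theorem digitSum_coord_lt {M : ℕ → ℕ} (hα : Digits α k L M) {a : ℕ} {e : ℕ → ℕ}
    (h : ∀ i < k, coord α a e i < M i) : digitSum (2 ^ L) (coord α a e) k < 2 ^ totalBits α := by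
  rw [hα.totalBits_eq, mul_comm, pow_mul]
  exact digitSum_lt fun i hi => (h i hi).trans (hα.lt_pow i hi)

theorem put_oneHot (hα : Layout α) {tag : ℕ} (ht : tag < 7) {e : ℕ → ℕ}
    (he : e ∈ tuples (radix α) (digitCount α)) {b : Config}
    (hb : ∀ l i, b (wire α tag l i) = false) {l : ℕ} (hl : l < digitCount α) :
    OneHot α (put α tag 0 (digitCount α) e b) tag l (e l) := by
  intro u hu
  have := hα.radix_le l hl
  rw [put_wire (by omega) (mem_tuples_stride hα le_rfl he) (by omega), hb]
  simp [hl]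

/-- The fields of a configuration hold the coordinates of the group element with the digits `e` once
`toBinary` has been run. -/
theorem toBinary_readField {M : ℕ → ℕ} (hα : Digits α k L M) (I : ℕ → ℕ) (ρ : ℕ → ℕ) {tag : ℕ}
    (htag : tag < 2) (a : ℕ) (base : HExpr) (x : ℕ) (hbase : ∀ ρ, base.eval I α ρ = x)
    (hx : x + totalBits α ≤ 2 * totalBits α) {e : ℕ → ℕ}
    (he : e ∈ tuples (radix α) (digitCount α)) (hea : ∀ i < k, coord α a e i < M i)
    {b : Config} (h1 : b (wire α 7 0 0) = true)
    (h0 : b (wire α 6 0 0) = false) (hb : ∀ l i, b (wire α tag l i) = false)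
    (hfresh : ∀ w, Work α x w → b w = false) {i : ℕ} (hi : i < k) :
    readField L ((toBinary tag a base).run I α 0 ρ (put α tag 0 (digitCount α) e b)) (x + i * L) =
      coord α a e i := by
  have hlt := digitSum_coord_lt hα hea
  have hrun := toBinary_run hα.toLayout I ρ htag a base x hbase hx
    (b := put α tag 0 (digitCount α) e b) (v := e) (mem_tuples.1 he).1
    (fun l hl => put_oneHot hα.toLayout (by omega) he hb hl)
    (by rw [put_tag_ne (by omega) (by omega) (by omega), h1])
    (by rw [put_tag_ne (by omega) (by omega) (by omega), h0])
    (fun w hw => by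
      rw [put_of_ne, hfresh w hw]
      rintro j hj rfl
      rcases hw with ⟨tag', l, i, h2, h4, -, -, h⟩ | ⟨i, hi, h⟩
      · exact wire_tag_ne _ _ _ _ (by omega) (by omega) (by omega) h
      · unfold wire at h; omega)
    (by rw [sum_digitWeight hα]; exact hlt)
  rw [sum_digitWeight hα, hα.totalBits_eq] at hrun
  exact readField_subfield (x := coord α a e) (fun i hi => (hea i hi).trans (hα.lt_pow i hi)) hrun hi

theorem op_query (x y : HExpr) (b : Config) :
    (Circ.prim (.query x y)).op L F I α true δ ρ (Finsupp.single b 1) =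
      Finsupp.single (queryConfig L F (x.eval I α ρ) (y.eval I α ρ) b) 1 := by
  simp only [Circ.op, Circ.gates, Step.map, Step.gates, applyGates, LinearMap.id_comp, Gate.op,
    Gate.onBasis, Finsupp.linearCombination_single, one_smul]

/-- Compute, query, uncompute. Clearing the binary copy of the argument and all auxiliary wires is
essential: anything left over would be correlated with the group element and would destroy the
interference in the Fourier transform. -/
theorem op_oracle {M : ℕ → ℕ} (hα : Digits α k L M) {e : ℕ → ℕ}
    (he : e ∈ tuples (radix α) (digitCount α)) :
    oracle.op L F I α true 0 ρ (Finsupp.single (put α 0 0 (digitCount α) e (start α)) 1) =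
      Finsupp.single (put α 0 0 (digitCount α) e
        (withValue α (F fun i => coord α 2 e i) (start α))) 1 := by
  set y := F fun i => coord α 2 e i with hy
  set b := put α 0 0 (digitCount α) e (start α) with hb
  set c := put α 0 0 (digitCount α) e (withValue α y (start α)) with hc
  have hbc : ∀ w, ¬ (2 * totalBits α ≤ w ∧ w < 2 * totalBits α + fieldBits α) → b w = c w := by
    intro w hw
    rw [hb, hc, put, put, withValue, if_neg hw]
  have hcl : (toBinary 0 2 (scalar 1)).IsClassical := by
    simp [toBinary, loadAddend, addBit, cnot, Circ.IsClassical, Step.IsClassical]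
  rw [oracle, Circ.op_seq, Circ.op_seq, Circ.op_rev, Circ.op_classical hcl, op_query]
  -- Querying after the conversion gives the same as converting with the value already present. On
  -- the value register this holds because the conversion does not write there, elsewhere because it
  -- does not read there.
  have hrun : queryConfig L F ((scalar 1).eval I α ρ)
      ((HExpr.mul (.lit 2) (scalar 1)).eval I α ρ) ((toBinary 0 2 (scalar 1)).run I α 0 ρ b) =
      (toBinary 0 2 (scalar 1)).run I α 0 ρ c := by
    have e1 : (scalar 1).eval I α ρ = totalBits α := rfl
    have e2 : (HExpr.mul (.lit 2) (scalar 1)).eval I α ρ = 2 * totalBits α := rfl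
    have hK : totalBits α + k * L ≤ 2 * totalBits α := by
      have := hα.totalBits_eq; omega
    have hF : (F fun i => readField L ((toBinary 0 2 (scalar 1)).run I α 0 ρ b)
        (totalBits α + i * L)) = y := by
      rw [hy]
      congr 1
      funext i
      refine toBinary_readField hα I ρ (by omega) 2 (scalar 1) _ (fun _ => rfl) (by omega) he
        (hα.coord_in_lt e he) ?_ ?_ ?_ ?_ i.2
      · exact Function.update_self _ _ _
      · exact start_tag (by omega)
      · exact fun l i => start_tag (by omega)
      · rintro w (⟨tag', l, i, h2, h4, -, -, rfl⟩ | ⟨i, hi, rfl⟩)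
        · exact start_tag (by omega)
        · exact start_low (by omega)
    funext w
    rw [e1, e2, queryConfig, if_pos (Or.inl hK)]
    simp only [hF]
    by_cases hw : 2 * totalBits α ≤ w ∧ w < 2 * totalBits α + fieldBits α
    · have hw' := hw
      rw [hα.fieldBits_eq] at hw'
      have hQ : ¬ Work α (totalBits α) w := by
        rintro (⟨tag', l, i, h2, h4, -, -, rfl⟩ | ⟨i, hi, rfl⟩)
        · unfold wire at hw; omega
        · omega
      have hwr := toBinary_writes hα.toLayout I ρ L 0 2 (scalar 1) (totalBits α) (fun _ => rfl)
      rw [if_pos hw', Circ.run_of_writes L hQ _ _ _ hwr, Circ.run_of_writes L hQ _ _ _ hwr,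
        hb, hc, put_low hw.2, put_low hw.2, start_low hw.2, withValue, if_pos hw, Bool.false_xor]
    · have hw' := hw
      rw [hα.fieldBits_eq] at hw'
      rw [if_neg hw']
      exact Circ.run_congr _ _ _ (toBinary_operands I ρ 0 2 (scalar 1) (totalBits α) (fun _ => rfl)
        (by omega)) _ _ hbc w hw
  rw [hrun, ← Circ.op_classical hcl (L := L) (F := F)]
  exact Circ.op_op_not false (toBinary 0 2 (scalar 1)) _

/-- The amplitude of the output digits `d` for the input digits `e` after the Fourier transform. -/
noncomputable def fourierAmp (α : ℕ → ℕ → ℕ) (e d : ℕ → ℕ) : ℂ :=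
  ∏ l ∈ Finset.range (digitCount α), (unif (radix α l) * phaseFactor (e l * d l) (radix α l) *
    ∏ j ∈ Finset.range (digitCount α),
      if l < j then phaseFactor (e j * d l * crossWeight α l j) (orderOfDigit α l) else 1)

/-- The loop for the phases runs over all digits, but the input digits up to and including `l` have
already been erased and contribute nothing. -/
theorem crossFactor_put (hα : Layout α) {e : ℕ → ℕ} (he : e ∈ tuples (radix α) (digitCount α))
    {b : Config} (hb : ∀ l i, b (wire α 0 l i) = false) (l v : ℕ) :
    crossFactor α (put α 0 (l + 1) (digitCount α) e b) l v = ∏ j ∈ Finset.range (digitCount α),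
      if l < j then phaseFactor (e j * v * crossWeight α l j) (orderOfDigit α l) else 1 := by
  refine Finset.prod_congr rfl fun j hj => ?_
  rw [Finset.mem_range] at hj
  have hS := mem_tuples_stride hα le_rfl he
  have hval : ∀ u < radix α j, put α 0 (l + 1) (digitCount α) e b (wire α 0 j u) =
      decide (l < j ∧ u = e j) := by
    intro u hu
    have := hα.radix_le j hj
    rw [put_wire (by omega) hS (by omega), hb]
    simp [hj]
  by_cases hlj : l < j
  · rw [if_pos hlj, Finset.prod_eq_single (e j)]
    · rw [hval _ ((mem_tuples.1 he).1 j hj)]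
      simp [hlj]
    · intro u hu hne
      rw [hval u (Finset.mem_range.1 hu), if_neg (by simp [hne])]
    · intro h
      exact absurd (Finset.mem_range.2 ((mem_tuples.1 he).1 j hj)) h
  · rw [if_neg hlj]
    refine Finset.prod_eq_one fun u hu => ?_
    rw [hval u (Finset.mem_range.1 hu), if_neg (by simp [hlj])]

theorem op_fourier (hα : Layout α) {e : ℕ → ℕ} (he : e ∈ tuples (radix α) (digitCount α))
    {b : Config} (hb : ∀ l i, b (wire α 0 l i) = false) (hb' : ∀ l i, b (wire α 1 l i) = false)
    (h1 : b (wire α 7 0 0) = true) :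
    fourier.op L F I α true 0 ρ (Finsupp.single (put α 0 0 (digitCount α) e b) 1) =
      ∑ d ∈ tuples (radix α) (digitCount α), fourierAmp α e d •
        Finsupp.single (put α 1 0 (digitCount α) d b) 1 := by
  have := op_loop_tuples (L := L) (F := F) (I := I) (δ := 0) (ρ := ρ) (scalar 0) fourierDigit
    (digitCount α) rfl (radix α)
    -- Before iteration `l`, the digits below `l` are in output form and those from `l` on are in
    -- input form.
    (fun l d => put α 1 0 l d (put α 0 l (digitCount α) e b))
    (fun l v => unif (radix α l) * phaseFactor (e l * v) (radix α l) *
      ∏ j ∈ Finset.range (digitCount α),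
      if l < j then phaseFactor (e j * v * crossWeight α l j) (orderOfDigit α l) else 1) ?_
  · rw [put_self] at this
    refine this.trans (Finset.sum_congr rfl fun d hd => ?_)
    rw [put_self]
    rfl
  intro l hl d hd
  have hρ : Function.update ρ 0 l 0 = l := Function.update_self _ _ _
  set B := put α 1 0 l d (put α 0 (l + 1) (digitCount α) e b) with hB
  have hS := mem_tuples_stride hα le_rfl he
  have hS' := mem_tuples_stride hα hl.le hd
  have e1 : put α 1 0 l d (put α 0 l (digitCount α) e b) = hot B (wire α 0 l) (e l) := by
    rw [put_eq_hot hl, put_hot]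
  have := op_fourierDigit (L := L) (F := F) (I := I) (ρ := Function.update ρ 0 l) hα
    (by rw [hρ]; exact hl) (b := B) (x := e l) (by rw [hρ]; exact (mem_tuples.1 he).1 l hl)
    (by
      rw [hρ]
      intro u hu
      have := hα.radix_le l hl
      rw [hB, put_wire (by omega) hS' (by omega), put_tag_ne (by omega) (by omega) (by omega), hb']
      simp)
    (by
      rw [hρ]
      intro u hu
      have := hα.radix_le l hl
      rw [hB, put_tag_ne (by omega) (by omega) (by omega), put_wire (by omega) hS (by omega), hb]
      simp)
    (by
      rw [hB, put_tag_ne (by omega) (by omega) (by omega),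
        put_tag_ne (by omega) (by omega) (by omega), h1])
  rw [hρ] at this
  rw [e1, this]
  refine Finset.sum_congr rfl fun v hv => ?_
  congr 1
  · rw [← crossFactor_put hα he hb]
    congr 1
    unfold crossFactor
    simp only [hB, put_tag_ne (show 1 < 16 by omega) (show 0 < 16 by omega) (show 0 ≠ 1 by omega)]
  · rw [hB, hot_put (Nat.zero_le _)]

/-- The state before the last stage of the algorithm. -/
theorem op_fourier_oracle_prepare {M : ℕ → ℕ} (hα : Digits α k L M) :
    fourier.op L F I α true 0 ρ (oracle.op L F I α true 0 ρ (prepare.op L F I α true 0 ρ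
      (Finsupp.single (start α) 1))) =
    ∑ d ∈ tuples (radix α) (digitCount α), ∑ e ∈ tuples (radix α) (digitCount α),
      ((∏ l ∈ Finset.range (digitCount α), unif (radix α l)) * fourierAmp α e d) •
        Finsupp.single (put α 1 0 (digitCount α) d
          (withValue α (F fun i => coord α 2 e i) (start α))) 1 := by
  rw [op_prepare hα.toLayout, Finset.sum_comm]
  simp only [map_sum, map_smul]
  refine Finset.sum_congr rfl fun e he => ?_
  rw [op_oracle hα he, op_fourier hα.toLayout he, Finset.smul_sum]
  · refine Finset.sum_congr rfl fun d _ => ?_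
    rw [smul_smul]
  · exact fun l i => by rw [withValue_wire, start_tag (by omega)]
  · exact fun l i => by rw [withValue_wire, start_tag (by omega)]
  · rw [withValue_wire, start, Function.update_self]

end

end QAlg

namespace QAlg

open ComplexConjugate

/-! ## Marking the good configurations -/

/-- The wire rotated to adjust the amplitude. -/
def flagE : HExpr := wireE 8 (.lit 0) (.lit 0)

/-- The wire marking the good configurations. -/
def goodE : HExpr := wireE 9 (.lit 0) (.lit 0)

/-- Adjusting the amplitude. -/
def adjust : Circ :=
  .prim (.refl (.sub (.mul (.lit 3) (.inp (.lit 1))) (.lit 4)) (.inp (.lit 1)) oneE flagE)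

/-- Testing whether all output digits vanish. -/
def testZero : Circ :=
  .seq (cnot oneE (wireE 5 (.lit 0) (.lit 0))) (.loop (scalar 0) (.prim (.ccnot
    (wireE 5 (.ctr 0) (.lit 0)) (wireE 1 (.ctr 0) (.lit 0)) (wireE 5 (.add (.ctr 0) (.lit 1)) (.lit 0)))))

/-- Writing the output and marking the good configurations. -/
def finish : Circ :=
  .seq (toBinary 1 3 (.lit 0)) (.seq testZero
    (.seq (.prim (.ccnot flagE (wireE 5 (scalar 0) (.lit 0)) goodE)) (cnot flagE goodE)))

/-- The algorithm before amplitude amplification. -/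
def sampler : Circ :=
  .seq (.prim (.not oneE)) (.seq prepare (.seq oracle (.seq fourier (.seq adjust finish))))

/-- Changing the sign of the good configurations. -/
def mark : Circ := .prim (.cph (.lit 1) (.lit 2) oneE goodE)

/-- Testing whether all wires of the algorithm vanish. -/
def ladder : Circ :=
  .seq (.prim (.not (scalar 4))) (.loop (scalar 4) (.seq (.prim (.not (.ctr 0)))
    (.seq (.prim (.ccnot (.add (scalar 4) (.ctr 0)) (.ctr 0)
      (.add (scalar 4) (.add (.ctr 0) (.lit 1))))) (.prim (.not (.ctr 0))))))

/-- Changing the sign of the initial configuration. -/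
def reflectZero : Circ :=
  .seq ladder (.seq (.prim (.cph (.lit 1) (.lit 2) (scalar 4) (.add (scalar 4) (scalar 4))))
    (.rev ladder))

/-- The algorithm. -/
def algorithm : Circ :=
  .seq sampler (.seq mark (.seq (.rev sampler) (.seq reflectZero sampler)))

section

variable {k L : ℕ} {F : (Fin k → ℕ) → ℕ} {I : ℕ → ℕ} {α : ℕ → ℕ → ℕ} {δ : ℕ} {ρ : ℕ → ℕ}

theorem toBinary_isClassical (tag a : ℕ) (base : HExpr) : (toBinary tag a base).IsClassical := by
  simp [toBinary, loadAddend, addBit, cnot, Circ.IsClassical, Step.IsClassical]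

theorem finish_isClassical : finish.IsClassical := by
  simp [finish, testZero, toBinary_isClassical, cnot, Circ.IsClassical, Step.IsClassical]

/-- Wire `m` of kind `5` is the conjunction of the first `m` tests. A one-hot digit vanishes exactly
if its wire `0` is set, so one Toffoli gate per digit suffices. -/
theorem testZero_run (hα : Layout α) {b : Config} {d : ℕ → ℕ} (h1 : b (wire α 7 0 0) = true)
    (hd : ∀ l < digitCount α, b (wire α 1 l 0) = decide (d l = 0))
    (hb : ∀ l, b (wire α 5 l 0) = false) :
    testZero.run I α 0 ρ b (wire α 5 (digitCount α) 0) = decide (∀ l < digitCount α, d l = 0) ∧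
      ∀ w, (∀ l, w ≠ wire α 5 l 0) → testZero.run I α 0 ρ b w = b w := by
  have hS : 0 < stride α := by have := hα.totalBits_lt; omega
  have hne : ∀ {l l'}, l ≠ l' → wire α 5 l 0 ≠ wire α 5 l' 0 := by
    intro l l' h
    rw [Ne, wire_inj (by omega) (by omega) hS hS]
    omega
  have e0 : testZero.run I α 0 ρ b = (List.range (digitCount α)).foldl (fun b l =>
      (Step.ccnot (wire α 5 l 0) (wire α 1 l 0) (wire α 5 (l + 1) 0)).apply b)
      (Function.update b (wire α 5 0 0) true) := by
    have hne' : wire α 5 0 0 ≠ wire α 7 0 0 := wire_tag_ne _ _ _ _ (by omega) (by omega) (by omega)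
    simp only [testZero, cnot, Circ.run, Step.map, oneE, eval_wireE, HExpr.eval, Function.update_self,
      ccnot_apply hne' hne', h1, hb, Bool.and_self, Bool.false_xor, eval_scalar]
  suffices h : ∀ m, m ≤ digitCount α → ∀ B, B = (List.range m).foldl (fun b l =>
      (Step.ccnot (wire α 5 l 0) (wire α 1 l 0) (wire α 5 (l + 1) 0)).apply b)
      (Function.update b (wire α 5 0 0) true) →
      B (wire α 5 m 0) = decide (∀ l < m, d l = 0) ∧ (∀ l, m < l → B (wire α 5 l 0) = false) ∧
      ∀ w, (∀ l, w ≠ wire α 5 l 0) → B w = b w by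
    obtain ⟨a1, -, a3⟩ := h _ le_rfl _ rfl
    rw [e0]
    exact ⟨a1, a3⟩
  intro m
  induction m with
  | zero =>
    rintro - B rfl
    refine ⟨by simp, fun l hl => ?_, fun w hw => Function.update_of_ne (hw 0) _ _⟩
    simp only [List.range_zero, List.foldl_nil]
    rw [Function.update_of_ne (hne (by omega)), hb]
  | succ m ih =>
    intro hm B hB
    obtain ⟨i1, i2, i3⟩ := ih (by omega) _ rfl
    rw [List.range_succ, List.foldl_append, List.foldl_cons, List.foldl_nil,
      ccnot_apply (hne (by omega)) (wire_tag_ne _ _ _ _ (by omega) (by omega) (by omega))] at hB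
    generalize (List.range m).foldl (fun b l =>
      (Step.ccnot (wire α 5 l 0) (wire α 1 l 0) (wire α 5 (l + 1) 0)).apply b)
      (Function.update b (wire α 5 0 0) true) = C at i1 i2 i3 hB
    subst hB
    refine ⟨?_, fun l hl => ?_, fun w hw => ?_⟩
    · rw [Function.update_self, i1, i2 _ (by omega),
        i3 _ fun l => wire_tag_ne _ _ _ _ (by omega) (by omega) (by omega), hd m (by omega),
        Bool.false_xor, ← Bool.decide_and, decide_eq_decide]
      constructor
      · rintro ⟨h1, h2⟩ l hl
        rcases Nat.lt_succ_iff_lt_or_eq.1 hl with h | rfl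
        · exact h1 l h
        · exact h2
      · exact fun h => ⟨fun l hl => h l (by omega), h m (by omega)⟩
    · rw [Function.update_of_ne (hne (by omega)), i2 l (by omega)]
    · rw [Function.update_of_ne (hw _), i3 w hw]

/-- The configurations before the last stage. -/
noncomputable def endConfig (α : ℕ → ℕ → ℕ) (d : ℕ → ℕ) (y : ℕ) : Config :=
  put α 1 0 (digitCount α) d (withValue α y (start α))

theorem endConfig_tag {d : ℕ → ℕ} {y tag l i : ℕ} (ht : tag < 16) (ht' : tag ≠ 1) :
    endConfig α d y (wire α tag l i) = start α (wire α tag l i) := by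
  rw [endConfig, put_tag_ne (by omega) ht ht', withValue_wire]

theorem endConfig_digit (hα : Layout α) {d : ℕ → ℕ} (hd : d ∈ tuples (radix α) (digitCount α))
    {y l i : ℕ} (hl : l < digitCount α) (hi : i < stride α) :
    endConfig α d y (wire α 1 l i) = decide (i = d l) := by
  rw [endConfig, put_wire (by omega) (mem_tuples_stride hα le_rfl hd) hi, withValue_wire,
    start_tag (by omega)]
  simp [hl]

open Classical in
/-- The last stage, for both values `f` of the flag. -/
theorem finish_run {M : ℕ → ℕ} (hα : Digits α k L M) {d : ℕ → ℕ}
    (hd : d ∈ tuples (radix α) (digitCount α)) (y : ℕ) (f : Bool) {b : Config}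
    (hb : b = Function.update (endConfig α d y) (wire α 8 0 0) f) :
    (∀ i < k, readField L (finish.run I α 0 ρ b) (i * L) = coord α 3 d i) ∧
      finish.run I α 0 ρ b (wire α 9 0 0) = (f && !decide (d = 0)) ∧
      finish.run I α 0 ρ b (wire α 7 0 0) = true := by
  have hS : 0 < stride α := by have := hα.totalBits_lt; omega
  have hflag : ∀ w, w ≠ wire α 8 0 0 → b w = endConfig α d y w := fun w hw => by
    rw [hb, Function.update_of_ne hw]
  have hwr := toBinary_writes hα.toLayout I ρ L 1 3 (.lit 0) 0 (fun _ => rfl)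
  have hfix : ∀ w, ¬ Work α 0 w → (toBinary 1 3 (.lit 0)).run I α 0 ρ b w = b w :=
    fun w hw => Circ.run_of_writes L hw _ _ _ hwr b
  have hnot : ∀ tag l i, tag < 16 → tag < 2 ∨ 4 < tag → ¬ Work α 0 (wire α tag l i) := by
    rintro tag l i ht ht' (⟨tag', l', i', h2, h4, -, -, h⟩ | ⟨i', hi, h⟩)
    · exact wire_tag_ne _ _ _ _ ht (by omega) (by omega) h
    · unfold wire at h; omega
  have hread : ∀ i < k, readField L ((toBinary 1 3 (.lit 0)).run I α 0 ρ b) (0 + i * L) =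
      coord α 3 d i := by
    have hput : b = put α 1 0 (digitCount α) d
        (Function.update (withValue α y (start α)) (wire α 8 0 0) f) := by
      rw [hb]
      funext w
      by_cases hw : w = wire α 8 0 0
      · subst hw
        rw [put_tag_ne (by omega) (by omega) (by omega), Function.update_self, Function.update_self]
      · rw [Function.update_of_ne hw, endConfig, put, put, Function.update_of_ne hw]
    intro i hi
    rw [hput]
    have hne : ∀ tag l i, tag < 8 → Function.update (withValue α y (start α)) (wire α 8 0 0) f
        (wire α tag l i) = start α (wire α tag l i) := fun tag l i h => by
      rw [Function.update_of_ne (wire_tag_ne _ _ _ _ (by omega) (by omega) (by omega)), withValue_wire]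
    refine toBinary_readField hα I ρ (by omega) 3 (.lit 0) 0 (fun _ => rfl) (by omega) hd
      (hα.coord_out_lt d hd) ?_ ?_ ?_ ?_ hi
    · rw [hne _ _ _ (by omega), start, Function.update_self]
    · rw [hne _ _ _ (by omega), start_tag (by omega)]
    · intro l i; rw [hne _ _ _ (by omega), start_tag (by omega)]
    · rintro w (⟨tag', l', i', h2, h4, -, -, rfl⟩ | ⟨i', hi, rfl⟩)
      · rw [hne _ _ _ (by omega), start_tag (by omega)]
      · rw [Function.update_of_ne (by unfold wire; omega), withValue, if_neg (by omega),
          start_low (by omega)]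
  set B := (toBinary 1 3 (.lit 0)).run I α 0 ρ b with hBdef
  obtain ⟨t1, t2⟩ := testZero_run (I := I) (ρ := ρ) hα.toLayout (b := B) (d := d)
    (by
      rw [hfix _ (hnot _ _ _ (by omega) (by omega)),
        hflag _ (wire_tag_ne _ _ _ _ (by omega) (by omega) (by omega)),
        endConfig_tag (by omega) (by omega), start, Function.update_self])
    (fun l hl => by
      rw [hfix _ (hnot _ _ _ (by omega) (by omega)),
        hflag _ (wire_tag_ne _ _ _ _ (by omega) (by omega) (by omega)),
        endConfig_digit hα.toLayout hd hl hS]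
      simp [eq_comm])
    (fun l => by
      rw [hfix _ (hnot _ _ _ (by omega) (by omega)),
        hflag _ (wire_tag_ne _ _ _ _ (by omega) (by omega) (by omega)),
        endConfig_tag (by omega) (by omega), start_tag (by omega)])
  have hzero : (∀ l < digitCount α, d l = 0) ↔ d = 0 := by
    constructor
    · intro h
      funext l
      by_cases hl : l < digitCount α
      · exact h l hl
      · exact (mem_tuples.1 hd).2 l (by omega)
    · rintro rfl l _
      rfl
  replace t1 := t1.trans (show _ = decide (d = 0) from decide_eq_decide.2 hzero)
  have n1 : wire α 9 0 0 ≠ wire α 8 0 0 := wire_tag_ne _ _ _ _ (by omega) (by omega) (by omega)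
  have n2 : wire α 9 0 0 ≠ wire α 5 (digitCount α) 0 :=
    wire_tag_ne _ _ _ _ (by omega) (by omega) (by omega)
  set C := testZero.run I α 0 ρ B with hC
  -- The mark receives flag and zero test first, and then the flag, modulo `2`. The result is the
  -- flag together with the failure of the zero test.
  have hrun : finish.run I α 0 ρ b = Function.update (Function.update C (wire α 9 0 0)
      (xor (C (wire α 9 0 0)) (C (wire α 8 0 0) && C (wire α 5 (digitCount α) 0)))) (wire α 9 0 0)
      (xor (xor (C (wire α 9 0 0)) (C (wire α 8 0 0) && C (wire α 5 (digitCount α) 0)))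
        (C (wire α 8 0 0))) := by
    simp only [finish, cnot, Circ.run, Step.map, flagE, goodE, eval_wireE, HExpr.eval, eval_scalar,
      ccnot_apply n1 n2, ccnot_apply n1 n1, ← hBdef, ← hC, Function.update_self,
      Function.update_of_ne n1.symm, Bool.and_self]
  have hrest : ∀ w, w ≠ wire α 9 0 0 → (∀ l, w ≠ wire α 5 l 0) → finish.run I α 0 ρ b w = B w := by
    intro w h1 h2
    rw [hrun, Function.update_of_ne h1, Function.update_of_ne h1, t2 w h2]
  refine ⟨fun i hi => ?_, ?_, ?_⟩
  · rw [← hread i hi, zero_add]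
    unfold readField
    refine Finset.sum_congr rfl fun j hj => ?_
    have hlow : i * L + j < 2 * totalBits α := by
      rw [Finset.mem_range] at hj
      have : (i + 1) * L ≤ k * L := Nat.mul_le_mul_right L hi
      rw [Nat.succ_mul] at this
      rw [hα.totalBits_eq]; omega
    rw [hrest _ (by unfold wire; omega) (fun l => by unfold wire; omega)]
  · rw [hrun, Function.update_self, t1, t2 _ fun l => wire_tag_ne _ _ _ _ (by omega) (by omega) (by omega),
      t2 _ fun l => wire_tag_ne _ _ _ _ (by omega) (by omega) (by omega),
      hfix _ (hnot _ _ _ (by omega) (by omega)), hfix _ (hnot _ _ _ (by omega) (by omega)),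
      hflag _ n1, endConfig_tag (by omega) (by omega),
      start_of_ne (wire_tag_ne _ _ _ _ (by omega) (by omega) (by omega)), hb, Function.update_self]
    cases f <;> by_cases h : d = 0 <;> simp [h]
  · rw [hrest _ (wire_tag_ne _ _ _ _ (by omega) (by omega) (by omega))
      (fun l => wire_tag_ne _ _ _ _ (by omega) (by omega) (by omega)),
      hfix _ (hnot _ _ _ (by omega) (by omega)),
      hflag _ (wire_tag_ne _ _ _ _ (by omega) (by omega) (by omega)),
      endConfig_tag (by omega) (by omega), start, Function.update_self]

/-! ## The reflection about the initial state -/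

/-- Wire `N + m` records whether the first `m` wires vanish. Each tested wire is negated only during
its own Toffoli gate, so the wires of the algorithm come back unchanged. -/
theorem ladder_run {N : ℕ} (hN : wireCount α = N) {b : Config}
    (hb : ∀ w, N ≤ w → b w = false) :
    ladder.run I α 0 ρ b N = true ∧
      ladder.run I α 0 ρ b (N + N) = decide (∀ i < N, b i = false) := by
  have e0 : ladder.run I α 0 ρ b = (List.range N).foldl (fun b i =>
      (Step.not i).apply ((Step.ccnot (N + i) i (N + (i + 1))).apply ((Step.not i).apply b)))
      (Function.update b N true) := by
    simp only [ladder, Circ.run, Step.map, HExpr.eval, Function.update_self, eval_scalar]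
    have : α 0 4 = N := hN
    rw [this]
    simp only [Step.apply, hb N le_rfl, Bool.not_false]
  suffices h : ∀ m ≤ N, ∀ B, B = (List.range m).foldl (fun b i =>
      (Step.not i).apply ((Step.ccnot (N + i) i (N + (i + 1))).apply ((Step.not i).apply b)))
      (Function.update b N true) → B N = true ∧ B (N + m) = decide (∀ i < m, b i = false) ∧
      (∀ j, m < j → B (N + j) = false) ∧ ∀ w < N, B w = b w by
    obtain ⟨h1, h2, -⟩ := h N le_rfl _ rfl
    rw [e0]
    exact ⟨h1, h2⟩
  intro m
  induction m with
  | zero =>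
    rintro - B rfl
    simp only [List.range_zero, List.foldl_nil]
    refine ⟨Function.update_self _ _ _, by simp, fun j hj => ?_, fun w hw => ?_⟩
    · rw [Function.update_of_ne (by omega), hb _ (by omega)]
    · rw [Function.update_of_ne (by omega)]
  | succ m ih =>
    intro hm B hB
    obtain ⟨i1, i2, i3, i4⟩ := ih (by omega) _ rfl
    rw [List.range_succ, List.foldl_append, List.foldl_cons, List.foldl_nil] at hB
    generalize (List.range m).foldl (fun b i =>
      (Step.not i).apply ((Step.ccnot (N + i) i (N + (i + 1))).apply ((Step.not i).apply b)))
      (Function.update b N true) = C at i1 i2 i3 i4 hB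
    rw [ccnot_apply (by omega) (by omega)] at hB
    simp only [Step.apply] at hB
    rw [Function.update_of_ne (show N + (m + 1) ≠ m by omega),
      Function.update_of_ne (show N + m ≠ m by omega), Function.update_self,
      Function.update_of_ne (show m ≠ N + (m + 1) by omega), Function.update_self, Bool.not_not,
      i2, i3 (m + 1) (by omega), i4 m (by omega), Bool.false_xor] at hB
    have hval : ∀ w, w ≠ N + (m + 1) → B w = C w := by
      intro w hw
      rw [hB]
      by_cases h : w = m
      · subst h
        rw [Function.update_self, i4 w (by omega)]
      · rw [Function.update_of_ne h, Function.update_of_ne hw, Function.update_of_ne h]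
    refine ⟨?_, ?_, fun j hj => ?_, fun w hw => ?_⟩
    · rw [hval _ (by omega), i1]
    · rw [hB, Function.update_of_ne (by omega), Function.update_self]
      have : (!b m) = decide (b m = false) := by cases b m <;> rfl
      rw [this, ← Bool.decide_and, decide_eq_decide]
      constructor
      · rintro ⟨h1, h2⟩ l hl
        rcases Nat.lt_succ_iff_lt_or_eq.1 hl with h | rfl
        · exact h1 l h
        · exact h2
      · exact fun h => ⟨fun l hl => h l (by omega), h m (by omega)⟩
    · rw [hval _ (by omega), i3 j (by omega)]
    · rw [hval _ (by omega), i4 w hw]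

theorem phaseFactor_one_two : phaseFactor 1 2 = -1 := by
  rw [phaseFactor, ← Complex.exp_pi_mul_I]
  congr 1
  push_cast
  ring

/-- After the ladder, wire `N` is `1` and wire `N + N` tells whether the configuration was initial,
so a phase `-1` between these two distinct wires gives the sign, and the ladder is undone. Linearity
extends this to superpositions. -/
theorem op_reflectZero {N : ℕ} (hN : wireCount α = N) (hN0 : 0 < N) {u : QState}
    (hu : u ∈ agreeing (fun w => w < N) (fun _ => false)) :
    reflectZero.op L F I α true 0 ρ u =
      u - (2 * u (fun _ => false)) • Finsupp.single (fun _ => false) 1 := by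
  classical
  have hcl : ladder.IsClassical := by simp [ladder, Circ.IsClassical, Step.IsClassical]
  have key : ∀ b : Config, (∀ w, ¬ w < N → b w = false) →
      reflectZero.op L F I α true 0 ρ (Finsupp.single b 1) = Finsupp.single b 1 -
        (2 * Finsupp.single b (1 : ℂ) (fun _ => false)) • Finsupp.single (fun _ => false) 1 := by
    intro b hb
    obtain ⟨h1, h2⟩ := ladder_run (I := I) (ρ := ρ) hN fun w hw => hb w (by omega)
    have hback : ladder.op L F I α false 0 ρ (Finsupp.single (ladder.run I α 0 ρ b) 1) =
        Finsupp.single b 1 := by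
      rw [← Circ.op_classical hcl (L := L) (F := F)]
      exact Circ.op_op_not false ladder _
    have hN' : (scalar 4).eval I α ρ = N := hN
    rw [reflectZero, Circ.op_seq, Circ.op_seq, Circ.op_rev, Circ.op_classical hcl, op_cph]
    · simp only [HExpr.eval, hN', h1, h2, decide_eq_true_eq, true_and, phaseFactor_one_two, map_smul]
      rw [Bool.not_true, hback]
      by_cases hz : b = fun _ => false
      · subst hz
        simp only [implies_true, if_true, Finsupp.single_eq_same]
        module
      · rw [if_neg, Finsupp.single_apply, if_neg hz]
        · simp
        · exact fun h => hz (funext fun w => by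
            by_cases hw : w < N
            · exact h w hw
            · exact hb w hw)
    · simp only [HExpr.eval, hN']
      omega
  rw [agreeing, Finsupp.supported_eq_span_single] at hu
  induction hu using Submodule.span_induction with
  | mem x hx =>
    obtain ⟨b, hb, rfl⟩ := hx
    exact key b hb
  | zero => simp
  | add x y _ _ hx hy => rw [map_add, hx, hy, Finsupp.add_apply]; module
  | smul a x _ hx => rw [map_smul, hx, Finsupp.smul_apply, smul_eq_mul]; module

theorem Circ.All.mono {Q Q' : Step ℕ → Prop} (h : ∀ s, Q s → Q' s) (c : Circ) :
    ∀ (δ : ℕ) (ρ : ℕ → ℕ), c.All I α Q δ ρ → c.All I α Q' δ ρ := by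
  induction c with
  | prim s => exact fun δ ρ => h _
  | seq c d ihc ihd => exact fun δ ρ hc => ⟨ihc _ _ hc.1, ihd _ _ hc.2⟩
  | loop b body ih => exact fun δ ρ hc i hi => ih _ _ (hc i hi)
  | rev c ih => exact fun δ ρ hc => ih _ _ hc

theorem Step.Writes.mono {Q Q' : ℕ → Prop} (h : ∀ w, Q w → Q' w) (s : Step ℕ)
    (hs : s.Writes L Q) : s.Writes L Q' := by
  cases s with
  | query x y => exact fun l hl => h _ (hs l hl)
  | _ => exact h _ hs

theorem wire_lt (hα : Layout α) {tag l i : ℕ} (ht : tag < 16) (hl : l ≤ digitCount α)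
    (hi : i < stride α) : wire α tag l i < wireCount α := by
  rw [hα.wireCount_eq, wire]
  have : l * stride α ≤ digitCount α * stride α := Nat.mul_le_mul_right _ hl
  rw [add_one_mul]
  omega

theorem work_lt (hα : Layout α) {x w : ℕ} (hx : x + totalBits α ≤ 2 * totalBits α)
    (hw : Work α x w) : w < wireCount α := by
  rcases hw with ⟨tag, l, i, h1, h2, h3, h4, rfl⟩ | ⟨i, hi, rfl⟩
  · exact wire_lt hα (by omega) h3 h4
  · rw [hα.wireCount_eq]; omega

/-- This is the reason why testing the first `wireCount α` wires suffices to recognise the initial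
configuration in the amplification step. -/
theorem sampler_writes (hα : Layout α) (hL : fieldBits α = L) :
    sampler.All I α (Step.Writes L (fun w => w < wireCount α)) 0 ρ := by
  have hS : 0 < stride α := by have := hα.totalBits_lt; omega
  have hn : α 0 0 = digitCount α := rfl
  have hw0 : ∀ tag, tag < 16 → ∀ {l}, l ≤ digitCount α → wire α tag l 0 < wireCount α :=
    fun _ ht _ hl => wire_lt hα ht hl hS
  have hchain : ∀ (tag δ : ℕ) (ρ : ℕ → ℕ), tag < 16 → 0 < δ → ρ 0 < digitCount α →
      (chain δ tag).All I α (Step.Writes L (fun w => w < wireCount α)) δ ρ := by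
    intro tag δ ρ ht hδ hl
    have hr := hα.radix_le _ hl
    simp only [chain, givens, cnot, Circ.All, Step.map, Step.Writes, HExpr.eval, eval_wireE,
      Function.update_self, Function.update_of_ne hδ.ne]
    intro i (hi : i < radix α (ρ 0) - 1)
    have a1 := wire_lt hα ht hl.le (show i < stride α by omega)
    have a2 := wire_lt hα ht hl.le (show i + 1 < stride α by omega)
    exact ⟨⟨a1, a2⟩, a1⟩
  have hbin : ∀ tag a base x ρ, (∀ ρ, HExpr.eval I α ρ base = x) →
      x + totalBits α ≤ 2 * totalBits α →
      (toBinary tag a base).All I α (Step.Writes L (fun w => w < wireCount α)) 0 ρ :=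
    fun tag a base x ρ hbase hx => Circ.All.mono
      (fun s hs => Step.Writes.mono (fun w hw => work_lt hα hx hw) s hs) _ _ _
      (toBinary_writes hα I ρ L tag a base x hbase)
  refine ⟨?_, ?_, ?_, ?_, ?_, ?_⟩
  · exact hw0 7 (by omega) (Nat.zero_le _)
  · intro l (hl : l < digitCount α)
    refine ⟨?_, hchain 0 1 _ (by omega) (by omega) hl⟩
    exact hw0 0 (by omega) hl.le
  · refine ⟨hbin _ _ _ (totalBits α) _ (fun _ => rfl) (by omega), ?_, hbin _ _ _ (totalBits α) _ (fun _ => rfl) (by omega)⟩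
    intro i hi
    change 2 * totalBits α + i < wireCount α
    rw [hα.wireCount_eq]
    omega
  · intro l (hl : l < digitCount α)
    have hρ : Function.update ρ 0 l 0 = l := Function.update_self _ _ _
    have hr := hα.radix_le l hl
    have hfs : ∀ z, fourierState.All I α (Step.Writes L (fun w => w < wireCount α)) 2
        (Function.update (Function.update ρ 0 l) 1 z) := by
      intro z
      refine ⟨hchain 1 2 _ (by omega) (by omega) hl, ?_⟩
      intro i (hi : i < radix α l)
      exact wire_lt hα (tag := 1) (by omega) hl.le (show i < stride α by omega)
    refine ⟨hw0 1 (by omega) hl.le, hchain 1 1 _ (by omega) (by omega) hl, ?_, ?_, ?_⟩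
    · intro i (hi : i < radix α l) j (hj : j < radix α l)
      exact wire_lt hα (tag := 1) (by omega) hl.le (show j < stride α by omega)
    · intro i (hi : i < radix α l)
      exact ⟨hfs i, wire_lt hα (tag := 0) (by omega) hl.le (show i < stride α by omega), hfs i⟩
    · intro j _ u _ v (hv : v < radix α l)
      exact wire_lt hα (tag := 1) (by omega) hl.le (show v < stride α by omega)
  · exact hw0 8 (by omega) (Nat.zero_le _)
  · refine ⟨hbin _ _ _ 0 _ (fun _ => rfl) (by omega), ⟨?_, ?_⟩, ?_, ?_⟩
    · exact hw0 5 (by omega) (Nat.zero_le _)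
    · intro l (hl : l < digitCount α)
      exact hw0 5 (by omega) (show l + 1 ≤ digitCount α by omega)
    · exact hw0 9 (by omega) (Nat.zero_le _)
    · exact hw0 9 (by omega) (Nat.zero_le _)

end

end QAlg

namespace QAlg

open ComplexConjugate

section

variable {k L : ℕ} {F : (Fin k → ℕ) → ℕ} {I : ℕ → ℕ} {α : ℕ → ℕ → ℕ} {ρ : ℕ → ℕ}

/-! ## Amplitude amplification -/

theorem inner_eq_zero_of_agreeing {Q : ℕ → Prop} {b₀ b₁ : Config} {u v : QState}
    (hu : u ∈ agreeing Q b₀) (hv : v ∈ agreeing Q b₁) {w : ℕ} (hw : ¬ Q w) (h : b₀ w ≠ b₁ w) :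
    inner u v = 0 := by
  unfold inner
  refine Finset.sum_eq_zero fun b hb => ?_
  have h1 := (Finsupp.mem_supported ℂ u).1 hu hb w hw
  have h2 : v b = 0 := by
    by_contra hne
    have := (Finsupp.mem_supported ℂ v).1 hv (Finsupp.mem_support_iff.2 hne) w hw
    exact h (h1.symm.trans this)
  simp [h2]

/-- Negating the flag. -/
def flip : Circ := .prim (.not flagE)

theorem op_flip (dir : Bool) (b : Config) : flip.op L F I α dir 0 ρ (Finsupp.single b 1) =
    Finsupp.single (Function.update b (wire α 8 0 0) (!b (wire α 8 0 0))) 1 := by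
  have h := Circ.op_classical (c := flip) (L := L) (F := F) (I := I) (α := α) (δ := 0) (ρ := ρ)
    trivial b 1
  have h' : flip.run I α 0 ρ b = Function.update b (wire α 8 0 0) (!b (wire α 8 0 0)) := by
    simp only [flip, Circ.run, Step.map, flagE, eval_wireE, HExpr.eval, Step.apply]
  rw [h'] at h
  cases dir
  · refine Eq.trans ?_ h
    simp only [Circ.op, flip, Circ.gates, Step.gates, Step.map]
  · exact h

theorem endConfig_one (d : ℕ → ℕ) (y : ℕ) : endConfig α d y (wire α 7 0 0) = true := by
  rw [endConfig_tag (by omega) (by omega), start, Function.update_self]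

theorem endConfig_flag (d : ℕ → ℕ) (y : ℕ) : endConfig α d y (wire α 8 0 0) = false := by
  rw [endConfig_tag (by omega) (by omega),
    start_of_ne (wire_tag_ne _ _ _ _ (by omega) (by omega) (by omega))]

/-- For `r ≥ 2` the parameters add up to `4 (r - 1)`, so the flag is set with probability `r / (4 (r
- 1))`. Multiplied by the probability `1 - 1 / r` of a nonzero output, this gives `1 / 4`. -/
theorem op_adjust {r : ℕ} (hr : I 1 = r) (d : ℕ → ℕ) (y : ℕ) :
    adjust.op L F I α true 0 ρ (Finsupp.single (endConfig α d y) 1) =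
      amp (3 * r - 4) r • Finsupp.single (endConfig α d y) 1 +
        coamp (3 * r - 4) r • flip.op L F I α true 0 ρ (Finsupp.single (endConfig α d y) 1) := by
  rw [op_flip, adjust, op_refl]
  · simp only [oneE, flagE, eval_wireE, HExpr.eval, hr, endConfig_one, endConfig_flag, if_true,
      Fintype.sum_bool, Bool.not_false]
    have : Function.update (endConfig α d y) (wire α 8 0 0) false = endConfig α d y := by
      rw [Function.update_eq_self_iff, endConfig_flag]
    rw [this, add_comm]
    simp [reflMatrix, amp, coamp]
  · simp only [oneE, flagE, eval_wireE, HExpr.eval]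
    exact wire_tag_ne _ _ _ _ (by omega) (by omega) (by omega)

/-- The part with output digits `d` of the state before the last stage. -/
noncomputable def branch (F : (Fin k → ℕ) → ℕ) (α : ℕ → ℕ → ℕ) (d : ℕ → ℕ) : QState :=
  ∑ e ∈ tuples (radix α) (digitCount α),
    ((∏ l ∈ Finset.range (digitCount α), unif (radix α l)) * fourierAmp α e d) •
      Finsupp.single (endConfig α d (F fun i => coord α 2 e i)) 1

open Classical in
theorem op_mark_finish {M : ℕ → ℕ} (hα : Digits α k L M) {d : ℕ → ℕ}
    (hd : d ∈ tuples (radix α) (digitCount α)) (y : ℕ) (f : Bool) {b : Config}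
    (hb : b = Function.update (endConfig α d y) (wire α 8 0 0) f) :
    mark.op L F I α true 0 ρ (finish.op L F I α true 0 ρ (Finsupp.single b 1)) =
      (if f = true ∧ d ≠ 0 then -1 else 1 : ℂ) • finish.op L F I α true 0 ρ (Finsupp.single b 1) := by
  obtain ⟨-, h1, h2⟩ := finish_run (I := I) (ρ := ρ) hα hd y f hb
  rw [Circ.op_classical finish_isClassical, mark, op_cph]
  · simp only [oneE, goodE, eval_wireE, HExpr.eval, h1, h2, phaseFactor_one_two]
    cases f <;> by_cases h : d = 0 <;> simp [h]
  · simp only [oneE, goodE, eval_wireE, HExpr.eval]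
    exact wire_tag_ne _ _ _ _ (by omega) (by omega) (by omega)

theorem mark_finish_branch {M : ℕ → ℕ} (hα : Digits α k L M) {d : ℕ → ℕ}
    (hd : d ∈ tuples (radix α) (digitCount α)) :
    mark.op L F I α true 0 ρ (finish.op L F I α true 0 ρ (branch F α d)) =
      finish.op L F I α true 0 ρ (branch F α d) := by
  unfold branch
  simp only [map_sum, map_smul]
  refine Finset.sum_congr rfl fun e _ => ?_
  rw [op_mark_finish hα hd _ false]
  · simp
  · rw [eq_comm, Function.update_eq_self_iff, endConfig_flag]

open Classical in
theorem mark_finish_flip_branch {M : ℕ → ℕ} (hα : Digits α k L M) {d : ℕ → ℕ}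
    (hd : d ∈ tuples (radix α) (digitCount α)) :
    mark.op L F I α true 0 ρ (finish.op L F I α true 0 ρ
      (flip.op L F I α true 0 ρ (branch F α d))) =
      (if d ≠ 0 then -1 else 1 : ℂ) •
        finish.op L F I α true 0 ρ (flip.op L F I α true 0 ρ (branch F α d)) := by
  unfold branch
  simp only [map_sum, map_smul, Finset.smul_sum]
  refine Finset.sum_congr rfl fun e _ => ?_
  rw [op_flip, op_mark_finish hα hd _ true]
  · rw [smul_comm]
    simp
  · rw [endConfig_flag]; rfl

theorem Circ.inner_op_op (c : Circ) (u v : QState) :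
    inner (c.op L F I α true 0 ρ u) (c.op L F I α true 0 ρ v) = inner u v := by
  rw [Circ.inner_op, show (!true) = false from rfl]
  exact congrArg (inner u) (Circ.op_op_not false c v)

theorem branch_mem (F : (Fin k → ℕ) → ℕ) {d : ℕ → ℕ} {Q : ℕ → Prop} {b₀ : Config}
    (h : ∀ y w, ¬ Q w → endConfig α d y w = b₀ w) : branch F α d ∈ agreeing Q b₀ :=
  Submodule.sum_mem _ fun _ _ => Submodule.smul_mem _ _ (single_mem_agreeing (h _) 1)

/-- Some digit of `d` is nonzero, and on the corresponding output wire the two branches have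
different constant values. -/
theorem inner_branch_zero (hα : Layout α) {d : ℕ → ℕ}
    (hd : d ∈ tuples (radix α) (digitCount α)) (hd0 : d ≠ 0) :
    inner (branch F α d) (branch F α 0) = 0 := by
  obtain ⟨l, hl⟩ := Function.ne_iff.1 hd0
  obtain ⟨h1, h2⟩ := mem_tuples.1 hd
  have hln : l < digitCount α := by
    by_contra h
    exact hl (h2 l (by omega))
  have hS := mem_tuples_stride hα le_rfl hd l hln
  have h0 : (0 : ℕ → ℕ) ∈ tuples (radix α) (digitCount α) :=
    mem_tuples.2 ⟨fun l hl => hα.radix_pos l hl, fun _ _ => rfl⟩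
  refine inner_eq_zero_of_agreeing (Q := fun w => w ≠ wire α 1 l (d l)) (b₀ := fun _ => true)
    (b₁ := fun _ => false) (branch_mem F fun y w hw => ?_) (branch_mem F fun y w hw => ?_)
    (w := wire α 1 l (d l)) (by simp) (by simp)
  · rw [not_not.1 hw, endConfig_digit hα hd hln hS]
    simp
  · rw [not_not.1 hw, endConfig_digit hα h0 hln hS]
    simpa using hl

/-- The state after the algorithm: the part of the final state with nonzero output is all of it. -/
theorem op_algorithm {M : ℕ → ℕ} (hα : Digits α k L M) {r : ℕ} (hr : I 1 = r) (hr2 : 2 ≤ r)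
    (h0 : inner (branch F α 0) (branch F α 0) = 1 / (r : ℂ)) :
    ∃ s : Finset (ℕ → ℕ), (∀ d ∈ s, d ∈ tuples (radix α) (digitCount α) ∧ d ≠ 0) ∧
    algorithm.op L F I α true 0 ρ (Finsupp.single (fun _ => false) 1) =
      (-2 * coamp (3 * r - 4) r) • ∑ d ∈ s,
        finish.op L F I α true 0 ρ (flip.op L F I α true 0 ρ (branch F α d)) := by
  classical
  set E := tuples (radix α) (digitCount α) with hE
  have hzero : (0 : ℕ → ℕ) ∈ E :=
    mem_tuples.2 ⟨fun l hl => hα.radix_pos l hl, fun _ _ => rfl⟩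
  refine ⟨E.erase 0, fun d hd => ⟨Finset.mem_of_mem_erase hd, Finset.ne_of_mem_erase hd⟩, ?_⟩
  set fin := finish.op L F I α true 0 ρ with hfin
  set U := flip.op L F I α true 0 ρ with hU
  set a := amp (3 * r - 4) r with ha
  set c := coamp (3 * r - 4) r with hc
  set Ψ := ∑ d ∈ E, branch F α d with hΨ
  set Ψ₁ := ∑ d ∈ E.erase 0, branch F α d with hΨ₁
  set v₀ : QState := Finsupp.single (fun _ => false) 1 with hv₀
  have hsplit : Ψ = branch F α 0 + Ψ₁ := (Finset.add_sum_erase E _ hzero).symm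
  have hstart : (Circ.prim (.not oneE)).op L F I α true 0 ρ v₀ = Finsupp.single (start α) 1 := by
    have h := Circ.op_classical (c := Circ.prim (.not oneE)) (L := L) (F := F) (I := I) (α := α)
      (δ := 0) (ρ := ρ) trivial (fun _ => false) 1
    rw [hv₀, h]
    simp only [Circ.run, Step.map, oneE, eval_wireE, HExpr.eval, Step.apply, Bool.not_false]
    rfl
  have hΨ' : fourier.op L F I α true 0 ρ (oracle.op L F I α true 0 ρ (prepare.op L F I α true 0 ρ
      (Finsupp.single (start α) 1))) = Ψ := op_fourier_oracle_prepare hα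
  -- The norm is inherited from the initial configuration by unitarity, without summing any
  -- amplitudes.
  have hnorm : inner Ψ Ψ = 1 := by
    rw [← hΨ', Circ.inner_op_op, Circ.inner_op_op, Circ.inner_op_op, inner_single_left]
    simp
  have hadj : adjust.op L F I α true 0 ρ Ψ = a • Ψ + c • U Ψ := by
    rw [hΨ]
    unfold branch
    simp only [map_sum, map_smul, Finset.smul_sum, ← Finset.sum_add_distrib]
    refine Finset.sum_congr rfl fun d _ => Finset.sum_congr rfl fun e _ => ?_
    rw [op_adjust hr, smul_add, smul_comm a, smul_comm c]
  set ψ := sampler.op L F I α true 0 ρ v₀ with hψ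
  have hψ' : ψ = fin (a • Ψ + c • U Ψ) := by
    rw [hψ, sampler, Circ.op_seq, Circ.op_seq, Circ.op_seq, Circ.op_seq, Circ.op_seq, hstart, hΨ',
      hadj]
  set g := c • fin (U Ψ₁) with hg
  have hmark : mark.op L F I α true 0 ρ ψ = ψ - (2 : ℂ) • g := by
    have m1 : mark.op L F I α true 0 ρ (fin Ψ) = fin Ψ := by
      simp only [hΨ, map_sum]
      exact Finset.sum_congr rfl fun d hd => mark_finish_branch hα hd
    have m2 : mark.op L F I α true 0 ρ (fin (U Ψ₁)) = - fin (U Ψ₁) := by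
      simp only [hΨ₁, map_sum]
      rw [← Finset.sum_neg_distrib]
      refine Finset.sum_congr rfl fun d hd => ?_
      rw [mark_finish_flip_branch hα (Finset.mem_of_mem_erase hd),
        if_pos (Finset.ne_of_mem_erase hd), neg_one_smul]
    have m3 : mark.op L F I α true 0 ρ (fin (U (branch F α 0))) = fin (U (branch F α 0)) := by
      rw [mark_finish_flip_branch hα hzero, if_neg (by simp), one_smul]
    rw [hψ', map_add, map_add, map_smul, map_smul, map_smul, map_smul, m1, hg]
    rw [hsplit, map_add U, map_add fin (U _), map_add (mark.op L F I α true 0 ρ), m2, m3]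
    module
  -- The two states have opposite values on the flag wire.
  have hflip : inner Ψ (U Ψ₁) = 0 := by
    refine inner_eq_zero_of_agreeing (Q := fun w => w ≠ wire α 8 0 0) (b₀ := fun _ => false)
      (b₁ := fun _ => true) (Submodule.sum_mem _ fun d hd => branch_mem F fun y w hw => ?_) ?_
      (w := wire α 8 0 0) (by simp) (by simp)
    · rw [not_not.1 hw, endConfig_flag]
    · rw [hΨ₁, map_sum]
      refine Submodule.sum_mem _ fun d hd => ?_
      unfold branch
      rw [map_sum]
      refine Submodule.sum_mem _ fun e _ => ?_
      rw [map_smul, hU, op_flip]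
      refine Submodule.smul_mem _ _ (single_mem_agreeing (fun w hw => ?_) 1)
      rw [not_not.1 hw, Function.update_self, endConfig_flag]
      rfl
  have hr' : (r : ℂ) ≠ 0 := by exact_mod_cast (by omega : r ≠ 0)
  have hΨΨ : inner Ψ Ψ₁ = 1 - 1 / (r : ℂ) := by
    have h1 : inner Ψ₁ (branch F α 0) = 0 := by
      rw [hΨ₁, inner_sum_left]
      exact Finset.sum_eq_zero fun d hd => inner_branch_zero hα.toLayout (Finset.mem_of_mem_erase hd)
        (Finset.ne_of_mem_erase hd)
    have h2 : inner Ψ (branch F α 0) = 1 / (r : ℂ) := by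
      rw [hsplit, inner_add_left, h0, h1, add_zero]
    have h3 : inner Ψ Ψ = inner Ψ (branch F α 0) + inner Ψ Ψ₁ := by
      conv_lhs => rw [hsplit, ← hsplit]
      conv_lhs => arg 2; rw [hsplit]
      rw [inner_add_right]
    rw [hnorm, h2] at h3
    linear_combination -h3
  -- The truncated subtraction in `3 * r - 4` is exact because `r ≥ 2`.
  have hcc : conj c * c = (r : ℂ) / (4 * ((r : ℂ) - 1)) := by
    have hr1 : (0 : ℝ) < (r : ℝ) - 1 := by
      have : (2 : ℝ) ≤ r := by exact_mod_cast hr2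
      linarith
    have e : 1 - ((3 * r - 4 : ℕ) : ℝ) / (((3 * r - 4 : ℕ) : ℝ) + (r : ℝ)) =
        (r : ℝ) / (4 * ((r : ℝ) - 1)) := by
      rw [Nat.cast_sub (by omega)]
      push_cast
      rw [show (3 * (r : ℝ) - 4 + r) = 4 * ((r : ℝ) - 1) by ring]
      field_simp
      ring
    rw [hc, coamp, Complex.conj_ofReal, ← Complex.ofReal_mul, e,
      Real.mul_self_sqrt (by positivity)]
    push_cast
    rfl
  -- The good part `g` has probability `1 / 4`, computed as `r / (4 (r - 1))` times `1 - 1 / r`.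
  have hψg : inner ψ g = 1 / 4 := by
    rw [hψ', hg, inner_smul_right, Circ.inner_op_op, inner_add_left, inner_smul_left,
      inner_smul_left, hflip, Circ.inner_op_op, hΨΨ]
    have hr1 : (r : ℂ) - 1 ≠ 0 := by
      rw [sub_ne_zero]; exact_mod_cast (by omega : r ≠ 1)
    calc _ = (conj c * c) * (1 - 1 / (r : ℂ)) := by ring
      _ = _ := by rw [hcc]; field_simp
  have hψψ : inner ψ ψ = 1 := by
    rw [hψ, Circ.inner_op_op, hv₀, inner_single_left]
    simp
  have hN0 : 0 < wireCount α := by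
    have := wire_lt hα.toLayout (tag := 0) (by omega) (Nat.zero_le _)
      (show 0 < stride α by have := hα.totalBits_lt; omega)
    omega
  have hW := sampler_writes (I := I) (ρ := ρ) hα.toLayout hα.fieldBits_eq
  set u := sampler.op L F I α false 0 ρ (mark.op L F I α true 0 ρ ψ) with hu
  have hmem : u ∈ agreeing (fun w => w < wireCount α) (fun _ => false) := by
    refine Circ.mem_agreeing sampler _ _ _ hW _ ?_
    refine Circ.mem_agreeing mark _ _ _ ?_ _ ?_
    · exact wire_lt hα.toLayout (tag := 9) (by omega) (Nat.zero_le _)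
        (show 0 < stride α by have := hα.totalBits_lt; omega)
    · exact Circ.mem_agreeing sampler _ _ _ hW _ (single_mem_agreeing (fun _ _ => rfl) 1)
  have hback : ∀ w, sampler.op L F I α false 0 ρ (sampler.op L F I α true 0 ρ w) = w :=
    fun w => Circ.op_op_not false sampler w
  have hback' : ∀ w, sampler.op L F I α true 0 ρ (sampler.op L F I α false 0 ρ w) = w :=
    fun w => Circ.op_op_not true sampler w
  -- By adjointness this is the inner product of `ψ` with `ψ - 2 g`, that is `1 - 2 / 4`. With the
  -- value `1 / 2` the reflection subtracts exactly one initial configuration, so after the last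
  -- sampler `ψ` cancels and `-2 g` remains.
  have hu0 : u (fun _ => false) = 1 / 2 := by
    have h1 : u (fun _ => false) = inner v₀ u := by rw [hv₀, inner_single_left]; simp
    rw [h1, hu, ← show (!true) = false from rfl, ← Circ.inner_op, ← hψ, hmark, sub_eq_add_neg,
      inner_add_right, ← neg_smul, inner_smul_right, hψψ, hψg]
    norm_num
  rw [algorithm, Circ.op_seq, Circ.op_seq, Circ.op_seq, Circ.op_seq, Circ.op_rev,
    show (!true) = false from rfl, ← hψ, ← hu, op_reflectZero rfl hN0 hmem, hu0, ← hv₀, map_sub,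
    map_smul, ← hψ, hu, hback', hmark]
  have : fin (U Ψ₁) = ∑ d ∈ E.erase 0, fin (U (branch F α d)) := by rw [hΨ₁, map_sum, map_sum]
  rw [← this, hg]
  module

/-- The output in the final state. -/
theorem finish_flip_endConfig {M : ℕ → ℕ} (hα : Digits α k L M) {d : ℕ → ℕ}
    (hd : d ∈ tuples (radix α) (digitCount α)) (y : ℕ) :
    ∃ b : Config, finish.op L F I α true 0 ρ (flip.op L F I α true 0 ρ
      (Finsupp.single (endConfig α d y) 1)) = Finsupp.single b 1 ∧
      ∀ i < k, readField L b (i * L) = coord α 3 d i := by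
  classical
  refine ⟨_, by rw [op_flip, Circ.op_classical finish_isClassical], ?_⟩
  exact (finish_run hα hd y true (by rw [endConfig_flag]; rfl)).1

end

end QAlg

namespace QAlg

open ComplexConjugate

/-! ## The amplitudes in terms of characters -/

theorem phaseFactor_sum {ι : Type*} (s : Finset ι) (a : ι → ℕ) (b : ℕ) :
    phaseFactor (∑ i ∈ s, a i) b = ∏ i ∈ s, phaseFactor (a i) b := by
  classical
  induction s using Finset.induction_on with
  | empty => simp [phaseFactor_zero]
  | insert i s hi ih => rw [Finset.sum_insert hi, Finset.prod_insert hi, phaseFactor_add, ih]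

section

variable {k L : ℕ} {F : (Fin k → ℕ) → ℕ} {I : ℕ → ℕ} {α : ℕ → ℕ → ℕ} {ρ : ℕ → ℕ} {M : ℕ → ℕ}

/-- The phase of the own digit has the right denominator because `p l * V l * W l` is the order of
the coordinate. Earlier digits of the same coordinate have trivial phases, since the order divides
`V j * W l`. Later ones are supplied by the circuit. -/
theorem prod_phaseFactor_digit (hα : Digits α k L M) (e d : ℕ → ℕ) {l : ℕ}
    (hl : l < digitCount α) :
    phaseFactor (e l * d l) (radix α l) * ∏ j ∈ Finset.range (digitCount α),
      (if l < j then phaseFactor (e j * d l * crossWeight α l j) (orderOfDigit α l) else 1) =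
    ∏ j ∈ Finset.range (digitCount α),
      if α 4 j = α 4 l then phaseFactor (e j * α 2 j * (d l * α 3 l)) (M (α 4 l)) else 1 := by
  have hord := hα.order_eq l hl
  have hpos := hα.order_pos _ (hα.index_lt l hl)
  have hvw : α 2 l * α 3 l ≠ 0 := by
    intro h0
    rw [← hord, orderOfDigit, mul_assoc, h0] at hpos
    omega
  have hfirst : phaseFactor (e l * d l) (radix α l) =
      ∏ j ∈ Finset.range (digitCount α), if j = l then
        phaseFactor (e j * α 2 j * (d l * α 3 l)) (M (α 4 l)) else 1 := by
    rw [Finset.prod_ite_eq' , if_pos (Finset.mem_range.2 hl), ← hord, orderOfDigit,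
      ← phaseFactor_mul_left (a := e l * d l) hvw]
    congr 1 <;> ring
  rw [hfirst, ← Finset.prod_mul_distrib]
  refine Finset.prod_congr rfl fun j hj => ?_
  rcases lt_trichotomy j l with h | rfl | h
  · rw [if_neg h.ne, if_neg (by omega), one_mul]
    split_ifs with h4
    · rw [phaseFactor_of_dvd]
      have := hα.dvd j l h hl h4
      rw [show e j * α 2 j * (d l * α 3 l) = (α 2 j * α 3 l) * (e j * d l) by ring]
      exact this.mul_right _
    · rfl
  · simp
  · rw [if_neg h.ne', if_pos h, one_mul, crossWeight]
    split_ifs with h4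
    · rw [h4, hord]
      congr 1
      simp only [Nat.sub_self, Nat.add_zero, Nat.sub_zero, mul_one]
      ring
    -- The two truncated differences add up to the distance of the coordinates, so for different
    -- coordinates this factor is `0`.
    · rw [show 1 - (α 4 l - α 4 j + (α 4 j - α 4 l)) = 0 by omega, mul_zero, mul_zero,
        phaseFactor_zero]

/-- Expanding the product of the two coordinates bilinearly in the digits yields exactly the phases
applied by the circuit. Each radix contributes its normalisation twice, once from the preparation
and once from the transform, so together they give one over the order of the group. -/
theorem fourierAmp_eq (hα : Digits α k L M) (e d : ℕ → ℕ) :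
    (∏ l ∈ Finset.range (digitCount α), unif (radix α l)) * fourierAmp α e d =
      1 / ((∏ i ∈ Finset.range k, M i : ℕ) : ℂ) *
        ∏ i ∈ Finset.range k, phaseFactor (coord α 2 e i * coord α 3 d i) (M i) := by
  have h1 : ∏ i ∈ Finset.range k, phaseFactor (coord α 2 e i * coord α 3 d i) (M i) =
      ∏ l ∈ Finset.range (digitCount α), ∏ j ∈ Finset.range (digitCount α),
      if α 4 j = α 4 l then phaseFactor (e j * α 2 j * (d l * α 3 l)) (M (α 4 l)) else 1 := by
    unfold coord
    simp only [Finset.sum_mul_sum, phaseFactor_sum]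
    rw [Finset.prod_comm]
    simp_rw [Finset.prod_comm (s := Finset.range k)]
    rw [Finset.prod_comm]
    refine Finset.prod_congr rfl fun l hl => Finset.prod_congr rfl fun j hj => ?_
    rw [Finset.prod_eq_single (α 4 l)]
    · simp only [if_true]
      split_ifs with h
      · rfl
      · rw [zero_mul, phaseFactor_zero]
    · intro i _ hi
      rw [if_neg (Ne.symm hi), mul_zero, phaseFactor_zero]
    · intro h
      exact absurd (Finset.mem_range.2 (hα.index_lt l (Finset.mem_range.1 hl))) h
  rw [h1, fourierAmp]
  rw [Finset.prod_congr rfl fun l hl => (mul_assoc _ _ _).trans (congrArg (unif (radix α l) * ·)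
    (prod_phaseFactor_digit hα e d (Finset.mem_range.1 hl))), Finset.prod_mul_distrib, ← mul_assoc,
    ← Finset.prod_mul_distrib]
  congr 1
  simp only [unif_mul_self]
  rw [← hα.card]
  push_cast
  simp

end

/-! ## The group -/

section

variable {k L : ℕ} {F : (Fin k → ℕ) → ℕ} {I : ℕ → ℕ} {α : ℕ → ℕ → ℕ} {ρ : ℕ → ℕ}
  {G : Type*} [AddCommGroup G] {M : Fin k → ℕ} [∀ i, NeZero (M i)]
  {e : G ≃+ ((i : Fin k) → ZMod (M i))} {M' : ℕ → ℕ}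

/-- The group element with the coordinates `x`. -/
def ofCoords (e : G ≃+ ((i : Fin k) → ZMod (M i))) (x : ℕ → ℕ) : G :=
  e.symm fun i => (x i : ZMod (M i))

theorem coords_ofCoords {x : ℕ → ℕ} (hx : ∀ i : Fin k, x i < M i) :
    coords e (ofCoords e x) = fun i : Fin k => x i := by
  funext i
  simp only [coords, ofCoords, AddEquiv.apply_symm_apply]
  exact ZMod.val_cast_of_lt (hx i)

theorem ofCoords_zero {x : ℕ → ℕ} (hx : ∀ i : Fin k, x i = 0) : ofCoords e x = 0 := by
  rw [ofCoords, AddEquiv.symm_apply_eq, map_zero]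
  funext i
  simp [hx]

theorem pairing_comm (g h : G) : pairing e g h = pairing e h g := by
  simp only [pairing, mul_comm]

theorem pairing_add_left (g g' h : G) : pairing e (g + g') h = pairing e g h * pairing e g' h := by
  simp only [pairing, map_add, Pi.add_apply, add_mul, AddChar.map_add_eq_mul, Finset.prod_mul_distrib]

theorem pairing_zero_right (g : G) : pairing e g 0 = 1 := by simp [pairing]

theorem pairing_ofCoords (hM : ∀ i : Fin k, M' i = M i) (x y : ℕ → ℕ) :
    ∏ i ∈ Finset.range k, phaseFactor (x i * y i) (M' i) =
      pairing e (ofCoords e x) (ofCoords e y) := by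
  rw [Finset.prod_range, pairing]
  refine Finset.prod_congr rfl fun i _ => ?_
  simp only [ofCoords, AddEquiv.apply_symm_apply]
  have := ZMod.stdAddChar_coe (N := M i) ((x i * y i : ℕ) : ℤ)
  push_cast at this
  rw [this, phaseFactor, hM]
  push_cast
  congr 1
  ring

/-! ### Character sums over the group. -/

variable [Fintype G]

theorem card_eq_prod (hM : ∀ i : Fin k, M' i = M i) (e : G ≃+ ((i : Fin k) → ZMod (M i))) :
    Fintype.card G = ∏ i ∈ Finset.range k, M' i := by
  rw [Fintype.card_congr e.toEquiv, Fintype.card_pi, Finset.prod_range]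
  exact Finset.prod_congr rfl fun i _ => by rw [ZMod.card, hM]

/-- Every element has input digits, and there are as many tuples of digits as elements, so the
representation is a bijection. -/
theorem sum_tuples_eq {A : Type*} [AddCommMonoid A] (hα : Digits α k L M')
    (hM : ∀ i : Fin k, M' i = M i) (φ : G → A) :
    ∑ d ∈ tuples (radix α) (digitCount α), φ (ofCoords e (coord α 2 d)) = ∑ x, φ x := by
  classical
  have himg : (tuples (radix α) (digitCount α)).image (fun d => ofCoords e (coord α 2 d)) =
      Finset.univ := by
    refine Finset.eq_univ_of_forall fun x => Finset.mem_image.2 ?_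
    obtain ⟨d, hd, h⟩ := hα.exists_coord_in (fun i => if h : i < k then coords e x ⟨i, h⟩ else 0)
      fun i hi => by rw [dif_pos hi, hM ⟨i, hi⟩]; exact ZMod.val_lt _
    refine ⟨d, hd, ?_⟩
    rw [ofCoords, AddEquiv.symm_apply_eq]
    funext i
    rw [h i i.2, dif_pos i.2, coords]
    exact ZMod.natCast_zmod_val _
  have hcard : ((tuples (radix α) (digitCount α)).image
      fun d => ofCoords e (coord α 2 d)).card = (tuples (radix α) (digitCount α)).card := by
    rw [himg, Finset.card_univ, card_eq_prod hM e, card_tuples, hα.card]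
  rw [← himg, Finset.sum_image (Finset.card_image_iff.1 hcard)]

variable {r : ℕ} {f : G → Fin r}

theorem branch_eq (hα : Digits α k L M') (hM : ∀ i : Fin k, M' i = M i)
    (hF : ∀ g : G, F (coords e g) = (f g : ℕ)) (d : ℕ → ℕ) :
    branch F α d = ∑ x : G, (1 / (Fintype.card G : ℂ) * pairing e x (ofCoords e (coord α 3 d))) •
      Finsupp.single (endConfig α d (f x)) 1 := by
  rw [← sum_tuples_eq (e := e) hα hM]
  refine Finset.sum_congr rfl fun u hu => ?_
  rw [fourierAmp_eq hα, pairing_ofCoords (e := e) hM, card_eq_prod hM e]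
  congr 3
  rw [← hF, coords_ofCoords fun i => ?_]
  rw [← hM]
  exact hα.coord_in_lt u hu i i.2

/-- Choose `h` in `H` pairing nontrivially with the element represented by `d`. Translating the
summation by `h` leaves the value of `f` unchanged and multiplies the character by that pairing, so
the branch equals a multiple of itself by a factor different from `1`. -/
theorem branch_eq_zero (hα : Digits α k L M') (hM : ∀ i : Fin k, M' i = M i)
    (hF : ∀ g : G, F (coords e g) = (f g : ℕ)) {H : AddSubgroup G}
    (hf : ∀ x y : G, f x = f y ↔ x - y ∈ H) {d : ℕ → ℕ}
    (hd : ofCoords e (coord α 3 d) ∉ orthogonal e H) : branch F α d = 0 := by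
  set z := ofCoords e (coord α 3 d) with hz
  have : ∃ h ∈ H, pairing e z h ≠ 1 := by
    by_contra hcon
    push Not at hcon
    exact hd hcon
  obtain ⟨h, hh, hne⟩ := this
  have key : branch F α d = pairing e z h • branch F α d := by
    conv_lhs => rw [branch_eq hα hM hF d, ← Equiv.sum_comp (Equiv.addRight h)]
    rw [branch_eq hα hM hF d, Finset.smul_sum]
    refine Finset.sum_congr rfl fun x _ => ?_
    have h1 : f (x + h) = f x := (hf _ _).2 (by simpa using hh)
    rw [Equiv.coe_addRight, h1, pairing_add_left, pairing_comm h, smul_smul]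
    congr 1
    ring
  have h2 : (1 - pairing e z h) • branch F α d = 0 := by rw [sub_smul, one_smul, ← key, sub_self]
  exact (smul_eq_zero.1 h2).resolve_left (sub_ne_zero.2 hne.symm)

theorem endConfig_injOn (hL : fieldBits α = L) {d : ℕ → ℕ} {y y' : ℕ} (hy : y < 2 ^ L)
    (hy' : y' < 2 ^ L) (h : endConfig α d y = endConfig α d y') : y = y' := by
  refine Nat.eq_of_testBit_eq fun i => ?_
  by_cases hi : i < L
  · have := congrFun h (2 * totalBits α + i)
    rw [endConfig, endConfig, put_low (by omega), put_low (by omega), withValue, withValue,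
      if_pos (by omega), if_pos (by omega)] at this
    simpa using this
  · rw [Nat.testBit_lt_two_pow (hy.trans_le (Nat.pow_le_pow_right (by omega) (by omega))),
      Nat.testBit_lt_two_pow (hy'.trans_le (Nat.pow_le_pow_right (by omega) (by omega)))]

/-- For output zero the character is trivial, so the squared norm is the number of pairs in the same
coset divided by the square of the order of the group. There are `|G| * |H|` such pairs, which gives
`|H| / |G| = 1 / r`. -/
theorem inner_branch_zero_zero (hα : Digits α k L M') (hM : ∀ i : Fin k, M' i = M i)
    (hF : ∀ g : G, F (coords e g) = (f g : ℕ)) {H : AddSubgroup G} (hH : H.index = r)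
    (hf : ∀ x y : G, f x = f y ↔ x - y ∈ H) (hr : r ≤ 2 ^ L) :
    inner (branch F α 0) (branch F α 0) = 1 / (r : ℂ) := by
  classical
  have h0 : ofCoords e (coord α 3 0) = 0 := ofCoords_zero fun i => by
    simp [coord]
  have hinj : ∀ x y : G, endConfig α 0 (f x) = endConfig α 0 (f y) ↔ x - y ∈ H := by
    intro x y
    rw [← hf]
    constructor
    · intro h
      exact Fin.ext (endConfig_injOn hα.fieldBits_eq ((f x).2.trans_le hr) ((f y).2.trans_le hr) h)
    · intro h; rw [h]
  rw [branch_eq hα hM hF, h0]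
  simp only [pairing_zero_right, mul_one, inner_sum_left, inner_sum_right, inner_smul_left,
    inner_smul_right, inner_single_left, Finsupp.single_apply, hinj, map_one, one_mul]
  have hcount : ∀ x : G, ∑ y : G, (if x - y ∈ H then 1 else 0 : ℂ) = (Nat.card H : ℂ) := by
    intro x
    refine (Equiv.sum_comp (Equiv.subLeft x) fun z => (if z ∈ H then 1 else 0 : ℂ)).trans ?_
    rw [Finset.sum_boole, Nat.card_eq_fintype_card, Fintype.card_subtype]
  have hG : (Fintype.card G : ℂ) ≠ 0 := by exact_mod_cast Fintype.card_ne_zero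
  have hmul : (Fintype.card G : ℂ) = (Nat.card H : ℂ) * r := by
    rw [← Nat.card_eq_fintype_card, ← H.card_mul_index, hH]
    push_cast
    rfl
  simp only [← Finset.mul_sum, hcount, Finset.sum_const, Finset.card_univ, nsmul_eq_mul, map_div₀, map_one, map_natCast]
  have hr0 : (r : ℂ) ≠ 0 := by
    intro h; rw [h, mul_zero] at hmul; exact hG hmul
  have hH0 : (Nat.card H : ℂ) ≠ 0 := by
    intro h; rw [h, zero_mul] at hmul; exact hG hmul
  rw [hmul]
  field_simp

/-- Exact success needs no computation of the final amplitudes: it is enough that the norm is one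
and that no bad configuration is in the support. -/
theorem prob_eq_one {u : QState} {S : Set Config} (hu : inner u u = 1)
    (hS : u ∈ Finsupp.supported ℂ ℂ S) : prob u S = 1 := by
  classical
  have h1 : u.support.filter (fun b => b ∈ S) = u.support :=
    Finset.filter_true_of_mem fun b hb => (Finsupp.mem_supported ℂ u).1 hS hb
  have h2 : (prob u S : ℂ) = inner u u := by
    unfold prob inner Finsupp.sum
    rw [Complex.ofReal_sum]
    refine Finset.sum_congr ?_ fun b _ => ?_
    · rw [← h1]
      congr
    · rw [← Complex.normSq_eq_norm_sq, Complex.normSq_eq_conj_mul_self]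
  rw [hu] at h2
  exact_mod_cast h2

/-- The algorithm finds a nonzero element of the orthogonal subgroup with certainty. -/
theorem prob_algorithm (hα : Digits α k L M') (hM : ∀ i : Fin k, M' i = M i) (hL : L = width M)
    (hI : I 1 = r) {H : AddSubgroup G} (hH : H.index = r) (hr : 1 < r)
    (hf : ∀ x y : G, f x = f y ↔ x - y ∈ H) (hF : ∀ g : G, F (coords e g) = (f g : ℕ)) :
    prob (finalState L F (algorithm.gates I α true 0 ρ)) (correctOutputs e H) = 1 := by
  -- The values of the function must fit into `L` bits, so that different values give different
  -- configurations.
  have hrL : r ≤ 2 ^ L := by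
    have h1 : r ≤ Fintype.card G := by
      rw [← hH, ← Nat.card_eq_fintype_card]
      exact Nat.le_of_dvd Nat.card_pos H.index_dvd_card
    rw [card_eq_prod hM e, Finset.prod_range] at h1
    have h2 : ∏ i : Fin k, M' i = ∏ i, M i := Finset.prod_congr rfl fun i _ => hM i
    rw [h2] at h1
    rw [hL]
    exact h1.trans (Nat.lt_size_self _).le
  obtain ⟨s, hs, hfinal⟩ := op_algorithm (L := L) (F := F) (I := I) (ρ := ρ) hα hI hr
    (inner_branch_zero_zero hα hM hF hH hf hrL)
  rw [finalState_eq]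
  change prob (algorithm.op L F I α true 0 ρ _) _ = 1
  refine prob_eq_one ?_ ?_
  · rw [Circ.inner_op_op, inner_single_left]
    simp
  · rw [hfinal]
    refine Submodule.smul_mem _ _ (Submodule.sum_mem _ fun d hd => ?_)
    obtain ⟨hdE, hd0⟩ := hs d hd
    by_cases hz : ofCoords e (coord α 3 d) ∈ orthogonal e H
    · rw [branch_eq hα hM hF]
      simp only [map_sum, map_smul]
      refine Submodule.sum_mem _ fun x _ => Submodule.smul_mem _ _ ?_
      obtain ⟨b, hb, hread⟩ := finish_flip_endConfig (L := L) (F := F) (I := I) (ρ := ρ) hα hdE (f x)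
      rw [hb]
      refine Finsupp.single_mem_supported ℂ 1 ⟨_, hz, fun h0 => hd0 ?_, fun i => ?_⟩
      -- If the represented element were zero, all coordinates would be; as sums of natural numbers
      -- with positive weights they would force all digits to vanish.
      · have hc : ∀ i : Fin k, coord α 3 d i = 0 := fun i => by
          have h1 := congrFun (coords_ofCoords (e := e) (x := coord α 3 d) fun i => by
            rw [← hM]; exact hα.coord_out_lt d hdE i i.2) i
          rw [h0] at h1
          simp only [coords, map_zero, Pi.zero_apply, ZMod.val_zero] at h1
          exact h1.symm
        funext l
        by_cases hl : l < digitCount α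
        · have h1 := hc ⟨_, hα.index_lt l hl⟩
          rw [coord, Finset.sum_eq_zero_iff] at h1
          have h2 := h1 l (Finset.mem_range.2 hl)
          rw [if_pos rfl, Nat.mul_eq_zero] at h2
          exact h2.resolve_right (hα.weight_out_pos l hl).ne'
        · exact (mem_tuples.1 hdE).2 l (by omega)
      · rw [← hL, hread i i.2, coords_ofCoords fun i => by
          rw [← hM]; exact hα.coord_out_lt d hdE i i.2]
    · rw [branch_eq_zero hα hM hF hf hz, map_zero, map_zero]
      exact Submodule.zero_mem _

end

end QAlg

namespace QAlg

/-! ## Mixed radix representations -/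

/-- The digits `l < n` with `C l = i`, with radices `p` and weights `V` and `W`, describe the part
`w` of `m = c * w`. -/
structure Splitting (n : ℕ) (p V W C : ℕ → ℕ) (i m c w : ℕ) : Prop where
  mul_eq : c * w = m
  order : ∀ l < n, C l = i → p l * V l * W l = m
  sum_in : (∑ l ∈ Finset.range n, if C l = i then (p l - 1) * V l else 0) + c = m
  sum_out : (∑ l ∈ Finset.range n, if C l = i then (p l - 1) * W l else 0) + 1 = w
  exists_digits : ∀ x < m, ∃ e : ℕ → ℕ, (∀ l < n, e l < p l) ∧
    (∑ l ∈ Finset.range n, if C l = i then e l * V l else 0) + x % c = x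
  dvd : ∀ j l, j < l → l < n → C j = i → C l = i → m ∣ V j * W l
  dvd_rest : ∀ j < n, C j = i → m ∣ V j * w
  prod : (∏ l ∈ Finset.range n, if C l = i then p l else 1) = w

theorem Splitting.init {n : ℕ} {p V W C : ℕ → ℕ} {i m : ℕ} (hC : ∀ l < n, C l ≠ i)
    (hp : ∀ l < n, 0 < p l) : Splitting n p V W C i m m 1 where
  mul_eq := mul_one m
  order l hl h := absurd h (hC l hl)
  sum_in := by
    rw [Finset.sum_eq_zero fun l hl => if_neg (hC l (Finset.mem_range.1 hl)), zero_add]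
  sum_out := by
    rw [Finset.sum_eq_zero fun l hl => if_neg (hC l (Finset.mem_range.1 hl))]
  exists_digits x hx := ⟨0, hp, by
    rw [Finset.sum_eq_zero fun l hl => if_neg (hC l (Finset.mem_range.1 hl)), zero_add,
      Nat.mod_eq_of_lt hx]⟩
  dvd j l h1 h2 _ h3 := absurd h3 (hC l h2)
  dvd_rest j hj h := absurd h (hC j hj)
  prod := Finset.prod_eq_one fun l hl => if_neg (hC l (Finset.mem_range.1 hl))

section

variable {n : ℕ} {p V W C p' V' W' C' : ℕ → ℕ} {i m c w : ℕ}

/-- A digit of another coordinate may be appended without affecting coordinate `i`. -/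
theorem Splitting.skip (h : Splitting n p V W C i m c w) (hp : ∀ l < n, p' l = p l)
    (hV : ∀ l < n, V' l = V l) (hW : ∀ l < n, W' l = W l) (hC : ∀ l < n, C' l = C l)
    (hpn : 0 < p' n) (hCn : C' n ≠ i) : Splitting (n + 1) p' V' W' C' i m c w := by
  have hlt : ∀ l < n + 1, C' l = i → l < n := fun l hl hi => by
    rcases Nat.lt_succ_iff_lt_or_eq.1 hl with h | rfl
    · exact h
    · exact absurd hi hCn
  constructor
  · exact h.mul_eq
  · intro l hl hi
    have := hlt l hl hi
    rw [hp l this, hV l this, hW l this]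
    rw [hC l this] at hi
    exact h.order l this hi
  · rw [Finset.sum_range_succ, if_neg hCn, add_zero, ← h.sum_in]
    congr 1
    refine Finset.sum_congr rfl fun l hl => ?_
    rw [Finset.mem_range] at hl
    rw [hp l hl, hV l hl, hC l hl]
  · rw [Finset.sum_range_succ, if_neg hCn, add_zero, ← h.sum_out]
    congr 1
    refine Finset.sum_congr rfl fun l hl => ?_
    rw [Finset.mem_range] at hl
    rw [hp l hl, hW l hl, hC l hl]
  · intro x hx
    obtain ⟨e, he, hsum⟩ := h.exists_digits x hx
    refine ⟨Function.update e n 0, fun l hl => ?_, ?_⟩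
    · rcases Nat.lt_succ_iff_lt_or_eq.1 hl with h | rfl
      · rw [Function.update_of_ne h.ne, hp l h]
        exact he l h
      · rwa [Function.update_self]
    · rw [Finset.sum_range_succ, if_neg hCn, add_zero]
      conv_rhs => rw [← hsum]
      congr 1
      refine Finset.sum_congr rfl fun l hl => ?_
      rw [Finset.mem_range] at hl
      rw [Function.update_of_ne hl.ne, hV l hl, hC l hl]
  · intro j l hjl hl hj hi
    have h1 := hlt l hl hi
    have h2 : j < n := by omega
    rw [hV j h2, hW l h1]
    rw [hC l h1] at hi
    rw [hC j h2] at hj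
    exact h.dvd j l hjl h1 hj hi
  · intro j hj hi
    have h1 := hlt j hj hi
    rw [hV j h1]
    rw [hC j h1] at hi
    exact h.dvd_rest j h1 hi
  · rw [Finset.prod_range_succ, if_neg hCn, mul_one]
    conv_rhs => rw [← h.prod]
    refine Finset.prod_congr rfl fun l hl => ?_
    rw [Finset.mem_range] at hl
    rw [hp l hl, hC l hl]

/-- Splitting a factor `d` off the unfactored part gives a digit with input weight the remaining
cofactor `c` and output weight the product `w` of the factors found before. Input weights thus
decrease while output weights increase, the digit reversal known from the fast Fourier transform;
this is what makes the order divide `V j * W l` for `j < l`. -/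
theorem Splitting.push (h : Splitting n p V W C i m (c * w') w) {d : ℕ} (hd : w' = d) (hd0 : 0 < d)
    (hc : 0 < c) (hp : ∀ l < n, p' l = p l)
    (hV : ∀ l < n, V' l = V l) (hW : ∀ l < n, W' l = W l) (hC : ∀ l < n, C' l = C l)
    (hpn : p' n = d) (hVn : V' n = c) (hWn : W' n = w) (hCn : C' n = i) :
    Splitting (n + 1) p' V' W' C' i m c (w * d) := by
  subst hd
  obtain ⟨u, rfl⟩ : ∃ u, w' = u + 1 := ⟨w' - 1, by omega⟩
  have hm := h.mul_eq
  constructor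
  · rw [← hm]; ring
  · intro l hl hi
    rcases Nat.lt_succ_iff_lt_or_eq.1 hl with h1 | rfl
    · rw [hp l h1, hV l h1, hW l h1]
      rw [hC l h1] at hi
      exact h.order l h1 hi
    · rw [hpn, hVn, hWn, ← hm]; ring
  · rw [Finset.sum_range_succ, if_pos hCn, hpn, hVn]
    have hs : (∑ l ∈ Finset.range n, if C' l = i then (p' l - 1) * V' l else 0) =
        ∑ l ∈ Finset.range n, if C l = i then (p l - 1) * V l else 0 :=
      Finset.sum_congr rfl fun l hl => by
        rw [Finset.mem_range] at hl
        rw [hp l hl, hV l hl, hC l hl]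
    conv_rhs => rw [← h.sum_in]
    rw [hs, Nat.add_sub_cancel]
    ring
  · rw [Finset.sum_range_succ, if_pos hCn, hpn, hWn]
    have hs : (∑ l ∈ Finset.range n, if C' l = i then (p' l - 1) * W' l else 0) =
        ∑ l ∈ Finset.range n, if C l = i then (p l - 1) * W l else 0 :=
      Finset.sum_congr rfl fun l hl => by
        rw [Finset.mem_range] at hl
        rw [hp l hl, hW l hl, hC l hl]
    rw [hs, Nat.add_sub_cancel, add_right_comm, h.sum_out]
    ring
  · intro x hx
    obtain ⟨e, he, hsum⟩ := h.exists_digits x hx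
    -- The new digit is the leading digit of the remainder that the previous digits left over; what
    -- is left next is the remainder modulo `c`.
    refine ⟨Function.update e n (x % (c * (u + 1)) / c), fun l hl => ?_, ?_⟩
    · rcases Nat.lt_succ_iff_lt_or_eq.1 hl with h | rfl
      · rw [Function.update_of_ne h.ne, hp l h]
        exact he l h
      · rw [Function.update_self, hpn]
        exact Nat.div_lt_of_lt_mul (Nat.mod_lt _ (by positivity))
    · rw [Finset.sum_range_succ, if_pos hCn, Function.update_self, hVn]
      conv_rhs => rw [← hsum]
      rw [add_assoc]
      congr 1
      · refine Finset.sum_congr rfl fun l hl => ?_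
        rw [Finset.mem_range] at hl
        rw [Function.update_of_ne hl.ne, hV l hl, hC l hl]
      · conv_rhs => rw [← Nat.div_add_mod (x % (c * (u + 1))) c]
        rw [Nat.mod_mod_of_dvd _ (Dvd.intro _ rfl), mul_comm]
  · intro j l hjl hl hj hi
    have h2 : j < n := by omega
    rw [hC j h2] at hj
    rcases Nat.lt_succ_iff_lt_or_eq.1 hl with h1 | rfl
    · rw [hV j h2, hW l h1]
      rw [hC l h1] at hi
      exact h.dvd j l hjl h1 hj hi
    · rw [hV j h2, hWn]
      exact h.dvd_rest j h2 hj
  · intro j hj hi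
    rcases Nat.lt_succ_iff_lt_or_eq.1 hj with h1 | rfl
    · rw [hV j h1, ← mul_assoc]
      rw [hC j h1] at hi
      exact (h.dvd_rest j h1 hi).mul_right _
    · rw [hVn, ← hm]
      exact ⟨1, by ring⟩
  · rw [Finset.prod_range_succ, if_pos hCn, hpn]
    congr 1
    conv_rhs => rw [← h.prod]
    refine Finset.prod_congr rfl fun l hl => ?_
    rw [Finset.mem_range] at hl
    rw [hp l hl, hC l hl]

end

/-- With every order completely factored, the remainder modulo `1` vanishes, so the input digits
represent each number below the order. The largest value in either system is the order minus one. -/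
theorem Digits.of_splitting {α : ℕ → ℕ → ℕ} {k L : ℕ} {M : ℕ → ℕ} (hα : Layout α)
    (hK : totalBits α = k * L) (hL : fieldBits α = L) (hL0 : 0 < L)
    (hC : ∀ l < digitCount α, α 4 l < k) (hM : ∀ i < k, M i < 2 ^ L) (hM0 : ∀ i < k, 0 < M i)
    (h : ∀ i < k, Splitting (digitCount α) (α 1) (α 2) (α 3) (α 4) i (M i) 1 (M i)) :
    Digits α k L M where
  toLayout := hα
  totalBits_eq := hK
  fieldBits_eq := hL
  fieldBits_pos := hL0
  index_lt := hC
  lt_pow := hM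
  coord_in_lt e he i hi := by
    rw [← (h i hi).sum_in, Nat.lt_succ_iff, coord]
    refine Finset.sum_le_sum fun l hl => ?_
    split_ifs
    · have := (mem_tuples.1 he).1 l (Finset.mem_range.1 hl)
      exact Nat.mul_le_mul_right _ (by unfold radix at this; omega)
    · exact le_rfl
  coord_out_lt e he i hi := by
    have := (h i hi).sum_out
    rw [← this, Nat.lt_succ_iff, coord]
    refine Finset.sum_le_sum fun l hl => ?_
    split_ifs
    · have := (mem_tuples.1 he).1 l (Finset.mem_range.1 hl)
      exact Nat.mul_le_mul_right _ (by unfold radix at this; omega)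
    · exact le_rfl
  order_eq l hl := (h _ (hC l hl)).order l hl rfl
  order_pos := hM0
  dvd j l hjl hl h4 := (h _ (hC l hl)).dvd j l hjl hl h4 rfl
  exists_coord_in x hx := by
    have : ∀ i, ∃ e : ℕ → ℕ, i < k → (∀ l < digitCount α, e l < α 1 l) ∧ coord α 2 e i = x i := by
      intro i
      by_cases hi : i < k
      · obtain ⟨e, h1, h2⟩ := (h i hi).exists_digits (x i) (hx i hi)
        rw [Nat.mod_one, add_zero] at h2
        exact ⟨e, fun _ => ⟨h1, h2⟩⟩
      · exact ⟨0, fun h => absurd h hi⟩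
    choose e he using this
    -- Every digit belongs to exactly one coordinate, so the digits chosen for the separate
    -- coordinates can be merged.
    refine ⟨fun l => if l < digitCount α then e (α 4 l) l else 0, mem_tuples.2 ⟨?_, ?_⟩, ?_⟩
    · intro l hl
      rw [if_pos hl]
      exact (he _ (hC l hl)).1 l hl
    · intro l hl
      rw [if_neg (by omega)]
    · intro i hi
      rw [← (he i hi).2]
      refine Finset.sum_congr rfl fun l hl => ?_
      dsimp only
      rw [if_pos (Finset.mem_range.1 hl)]
      split_ifs with h1
      · rw [h1]
      · rfl
  weight_out_pos l hl := by
    have h1 := (h _ (hC l hl)).order l hl rfl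
    have h2 := hM0 _ (hC l hl)
    rw [← h1] at h2
    exact Nat.pos_of_mul_pos_left h2
  card := by
    rw [Finset.prod_congr rfl fun i hi => ((h i (Finset.mem_range.1 hi)).prod).symm,
      Finset.prod_comm]
    refine Finset.prod_congr rfl fun l hl => ?_
    rw [Finset.prod_ite_eq, if_pos (Finset.mem_range.2 (hC l (Finset.mem_range.1 hl)))]

end QAlg

namespace QAlg

/-! ## The classical part of the algorithm

Besides the entries used by the circuits, the entries `5`, …, `10` of array `0` hold the order of
the group, an auxiliary number, a counter, the part of the order of the current coordinate that is
not yet factored, the factored part, and the current trial divisor. -/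

/-- Assignment to an entry of array `0`. -/
def setScalar (j : ℕ) (v : HExpr) : Prog := assign 0 (.lit j) v

/-- `while e ≠ 0 do p`. -/
def whileNonzero (e : HExpr) (p : Prog) : Prog := .loop e.compile p

/-- The condition that the counter is below the number of coordinates. -/
def moreCoordinates : HExpr := .sub (.inp (.lit 0)) (scalar 7)

/-- The order of the current coordinate. -/
def currentOrder : HExpr := .inp (.add (.lit 2) (scalar 7))

/-- Increasing the counter. -/
def advance : Prog := setScalar 7 (.add (scalar 7) (.lit 1))

/-- Computing the order of the group. -/
def computeOrder : Prog :=
  .seq (setScalar 5 (.lit 1)) (.seq (setScalar 7 (.lit 0))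
    (whileNonzero moreCoordinates (.seq (setScalar 5 (.mul (scalar 5) currentOrder)) advance)))

/-- Computing the bit length of the order of the group. -/
def computeWidth : Prog :=
  .seq (setScalar 6 (scalar 5)) (.seq (setScalar 2 (.lit 0))
    (whileNonzero (scalar 6) (.seq (setScalar 2 (.add (scalar 2) (.lit 1)))
      (setScalar 6 (.div (scalar 6) (.lit 2))))))

/-- Computing the powers of `2`. -/
def computePowers : Prog :=
  .seq (setScalar 1 (.mul (.inp (.lit 0)) (scalar 2))) (.seq (setScalar 6 (.lit 1))
    (.seq (setScalar 7 (.lit 0)) (whileNonzero (.sub (scalar 1) (scalar 7))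
      (.seq (assign 5 (scalar 7) (scalar 6)) (.seq (setScalar 6 (.mul (scalar 6) (.lit 2)))
        advance)))))

/-- Adding a digit with the current trial divisor as its radix. -/
def addDigit : Prog :=
  .seq (assign 1 (scalar 0) (scalar 10)) (.seq (setScalar 8 (.div (scalar 8) (scalar 10)))
    (.seq (assign 2 (scalar 0) (scalar 8)) (.seq (assign 3 (scalar 0) (scalar 9))
      (.seq (assign 4 (scalar 0) (scalar 7)) (.seq (setScalar 9 (.mul (scalar 9) (scalar 10)))
        (.seq (setScalar 3 (.add (scalar 3) (scalar 10)))
          (setScalar 0 (.add (scalar 0) (.lit 1)))))))))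

/-- Trial division. -/
def trialStep : Prog :=
  .ite (HExpr.mod (scalar 8) (scalar 10)).compile (setScalar 10 (.add (scalar 10) (.lit 1))) addDigit

/-- Factoring the order of the current coordinate. -/
def factorOrder : Prog :=
  .seq (setScalar 8 currentOrder) (.seq (setScalar 9 (.lit 1)) (.seq (setScalar 10 (.lit 2))
    (.seq (whileNonzero (.sub (scalar 8) (.lit 1)) trialStep) advance)))

/-- Computing the digits. -/
def computeDigits : Prog :=
  .seq (setScalar 3 (.add (scalar 1) (.lit 2))) (.seq (setScalar 0 (.lit 0))
    (.seq (setScalar 7 (.lit 0)) (whileNonzero moreCoordinates factorOrder)))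

/-- Computing the number of wires. -/
def computeWires : Prog :=
  setScalar 4 (.add (.add (.mul (.lit 2) (scalar 1)) (scalar 2))
    (.mul (.lit 16) (.mul (.add (scalar 0) (.lit 1)) (scalar 3))))

/-- The classical part of the algorithm. -/
def preprocess : Prog :=
  .seq computeOrder (.seq computeWidth (.seq computePowers (.seq computeDigits computeWires)))

section

variable {k : ℕ} {I : ℕ → ℕ} {B : ℕ} {α : ℕ → ℕ → ℕ}

theorem runs_setScalar (hI : I 0 = k) {j : ℕ} {v : HExpr} (y : ℕ)
    (hv : ∀ ρ, v.OK k I α ρ 0) (hy : ∀ ρ, v.eval I α ρ = y) (hB : y < 2 ^ B) :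
    Runs B k I (setScalar j v) α (setEntry α 0 j y) 1 :=
  runs_assign (i := .lit j) hI (by omega) (fun _ => trivial) hv j y (fun _ => rfl) hy hB

/-- The measure `μ` plays two roles: its decrease ensures termination, and its initial value bounds
the number of iterations. It need not be related to the tested value `val`. -/
theorem runs_while (hI : I 0 = k) {e : HExpr} {p : Prog} {s : ℕ} (Inv : (ℕ → ℕ → ℕ) → Prop)
    (val μ : (ℕ → ℕ → ℕ) → ℕ) (hval : ∀ α ρ, e.eval I α ρ = val α)
    (hOK : ∀ α ρ, Inv α → e.OK k I α ρ 0)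
    (hstep : ∀ α, Inv α → val α ≠ 0 → ∃ α', Inv α' ∧ μ α' < μ α ∧ Runs B k I p α α' s)
    (h : Inv α) :
    ∃ α', Inv α' ∧ val α' = 0 ∧ Runs B k I (whileNonzero e p) α α' (1 + μ α * (1 + s)) := by
  suffices H : ∀ n α, Inv α → μ α ≤ n → ∃ α', Inv α' ∧ val α' = 0 ∧
      Runs B k I (whileNonzero e p) α α' (1 + n * (1 + s)) from H _ α h le_rfl
  intro n
  clear h
  induction n with
  | zero =>
    intro α h hμ
    by_cases h0 : val α = 0
    · exact ⟨α, h, h0, (Runs.loop_done hI (fun ρ => hOK α ρ h)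
        fun ρ => (hval α ρ).trans h0).mono (by omega)⟩
    · obtain ⟨α', -, h2, -⟩ := hstep α h h0
      omega
  | succ n ih =>
    intro α h hμ
    by_cases h0 : val α = 0
    · exact ⟨α, h, h0, (Runs.loop_done hI (fun ρ => hOK α ρ h)
        fun ρ => (hval α ρ).trans h0).mono (by omega)⟩
    · obtain ⟨α', h1, h2, h3⟩ := hstep α h h0
      obtain ⟨α'', h4, h5, h6⟩ := ih α' h1 (by omega)
      refine ⟨α'', h4, h5, (Runs.loop_step hI h3 h6 (fun ρ => hOK α ρ h) fun ρ => ?_).mono ?_⟩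
      · rw [hval]; exact h0
      · rw [Nat.succ_mul]; omega

theorem two_pow_le_prod {n : ℕ} {p : ℕ → ℕ} (h : ∀ l < n, 2 ≤ p l) :
    2 ^ n ≤ ∏ l ∈ Finset.range n, p l := by
  have := Finset.prod_le_prod' (s := Finset.range n) (f := fun _ => 2) (g := p)
    fun l hl => h l (Finset.mem_range.1 hl)
  simpa using this

theorem prod_range_le {k i : ℕ} {M : ℕ → ℕ} (hM : ∀ i < k, 2 ≤ M i) (hi : i ≤ k) :
    ∏ j ∈ Finset.range i, M j ≤ ∏ j ∈ Finset.range k, M j := by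
  refine Nat.le_of_dvd (Finset.prod_pos fun j hj => ?_)
    (Finset.prod_dvd_prod_of_subset _ _ _ (Finset.range_subset_range.2 hi))
  have := hM j (Finset.mem_range.1 hj)
  omega

theorem le_prod_range {k i : ℕ} {M : ℕ → ℕ} (hM : ∀ i < k, 2 ≤ M i) (hi : i < k) :
    M i ≤ ∏ j ∈ Finset.range k, M j := by
  refine Nat.le_of_dvd (Finset.prod_pos fun j hj => ?_)
    (Finset.dvd_prod_of_mem _ (Finset.mem_range.2 hi))
  have := hM j (Finset.mem_range.1 hj)
  omega

theorem runs_computeOrder {M : ℕ → ℕ} (hI : I 0 = k) (hIM : ∀ i < k, I (2 + i) = M i)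
    (hM : ∀ i < k, 2 ≤ M i) (hm : ∏ i ∈ Finset.range k, M i < 2 ^ B) (hk : k < 2 ^ B) :
    ∃ α', α' 0 5 = ∏ i ∈ Finset.range k, M i ∧
      Runs B k I computeOrder α α' (3 + k * 3) := by
  have hpos : 0 < ∏ i ∈ Finset.range k, M i :=
    Finset.prod_pos fun i hi => by have := hM i (Finset.mem_range.1 hi); omega
  have h1 := runs_setScalar (α := α) (B := B) hI (j := 5) (v := .lit 1) 1 (fun _ => trivial)
    (fun _ => rfl) (by omega)
  have h2 := runs_setScalar (α := setEntry α 0 5 1) (B := B) hI (j := 7) (v := .lit 0) 0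
    (fun _ => trivial) (fun _ => rfl) (by positivity)
  obtain ⟨α', ⟨i1, i2⟩, i3, i4⟩ := runs_while (α := setEntry (setEntry α 0 5 1) 0 7 0) (B := B) hI
    (e := moreCoordinates) (p := .seq (setScalar 5 (.mul (scalar 5) currentOrder)) advance) (s := 2)
    (fun α => α 0 5 = ∏ i ∈ Finset.range (α 0 7), M i ∧ α 0 7 ≤ k)
    (fun α => k - α 0 7) (fun α => k - α 0 7)
    (fun α ρ => by simp [moreCoordinates, HExpr.eval, hI])
    (fun α ρ _ => by simp [moreCoordinates, HExpr.OK, HExpr.eval, scalar])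
    (fun α ⟨a1, a2⟩ h0 => by
      have hlt : α 0 7 < k := by omega
      have hle := prod_range_le (i := α 0 7 + 1) hM hlt
      rw [Finset.prod_range_succ] at hle
      refine ⟨_, ?_, ?_, (runs_setScalar hI (∏ i ∈ Finset.range (α 0 7 + 1), M i) (fun ρ => ?_)
        (fun ρ => ?_) ?_).seq (runs_setScalar hI (α 0 7 + 1) (fun ρ => ?_) (fun ρ => ?_) ?_)⟩
      · simp [setEntry, hlt]
      · simp [setEntry]; omega
      · simp [HExpr.OK, HExpr.eval, scalar, currentOrder]; omega
      · simp [HExpr.eval, currentOrder, a1, hIM _ hlt, Finset.prod_range_succ]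
      · rw [Finset.prod_range_succ]; omega
      · simp [HExpr.OK, scalar]
      · simp [HExpr.eval, setEntry]
      · omega)
    (by simp [setEntry])
  refine ⟨α', ?_, (h1.seq (h2.seq i4)).mono ?_⟩
  · rw [i1, show α' 0 7 = k by omega]
  · simp [setEntry]; omega

theorem size_div_two {t : ℕ} (ht : t ≠ 0) : Nat.size t = Nat.size (t / 2) + 1 := by
  refine le_antisymm (Nat.size_le.2 ?_) (Nat.lt_size.2 ?_)
  · have := Nat.lt_size_self (t / 2)
    rw [pow_succ]
    omega
  · rcases Nat.eq_zero_or_pos (Nat.size (t / 2)) with h | h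
    · rw [h, pow_zero]; omega
    · have h1 : 2 ^ (Nat.size (t / 2) - 1) ≤ t / 2 := Nat.lt_size.1 (by omega)
      have h2 : Nat.size (t / 2) = Nat.size (t / 2) - 1 + 1 := by omega
      rw [h2, pow_succ]
      omega

theorem size_lt_two_pow (m : ℕ) {B : ℕ} (h : m < 2 ^ B) : Nat.size m < 2 ^ B :=
  (Nat.size_le.2 h).trans_lt Nat.lt_two_pow_self

theorem runs_computeWidth (hI : I 0 = k) {m : ℕ} (hα : α 0 5 = m) (hm : m < 2 ^ B) :
    ∃ α', α' 0 2 = Nat.size m ∧ Runs B k I computeWidth α α' (3 + Nat.size m * 3) := by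
  have h1 := runs_setScalar (α := α) (B := B) hI (j := 6) (v := scalar 5) m
    (fun _ => by simp [HExpr.OK, scalar]) (fun _ => hα) hm
  have h2 := runs_setScalar (α := setEntry α 0 6 m) (B := B) hI (j := 2) (v := .lit 0) 0
    (fun _ => trivial) (fun _ => rfl) (by positivity)
  obtain ⟨α', ⟨i1, i2⟩, i3, i4⟩ := runs_while (α := setEntry (setEntry α 0 6 m) 0 2 0) (B := B) hI
    (e := scalar 6) (p := .seq (setScalar 2 (.add (scalar 2) (.lit 1)))
      (setScalar 6 (.div (scalar 6) (.lit 2)))) (s := 2)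
    (fun α => α 0 2 + Nat.size (α 0 6) = Nat.size m ∧ α 0 6 ≤ m)
    (fun α => α 0 6) (fun α => Nat.size (α 0 6))
    (fun α ρ => rfl)
    (fun α ρ _ => by simp [HExpr.OK, scalar])
    (fun α ⟨a1, a2⟩ h0 => by
      have h3 := size_div_two h0
      have h4 := size_lt_two_pow m hm
      refine ⟨_, ?_, ?_, (runs_setScalar hI (α 0 2 + 1) (fun ρ => ?_)
        (fun ρ => rfl) ?_).seq (runs_setScalar hI (α 0 6 / 2) (fun ρ => ?_) (fun ρ => rfl) ?_)⟩
      · simp only [setEntry, true_and, Nat.reduceEqDiff, reduceIte]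
        omega
      · simp only [setEntry, true_and, reduceIte]
        omega
      · simp [HExpr.OK, scalar]
      · omega
      · simp [HExpr.OK, scalar]
      · omega)
    (by simp [setEntry])
  refine ⟨α', ?_, (h1.seq (h2.seq i4)).mono ?_⟩
  · rw [show α' 0 6 = 0 from i3, Nat.size_zero] at i1
    exact i1
  · simp [setEntry]; omega

theorem runs_computePowers (hI : I 0 = k) {L : ℕ} (hα : α 0 2 = L) (hB : k * L < B) :
    ∃ α', α' 0 1 = k * L ∧ α' 0 2 = L ∧ (∀ i < k * L, α' 5 i = 2 ^ i) ∧
      Runs B k I computePowers α α' (4 + k * L * 4) := by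
  have hlt : k * L < 2 ^ B := hB.trans Nat.lt_two_pow_self
  have h1 := runs_setScalar (α := α) (B := B) hI (j := 1) (v := .mul (.inp (.lit 0)) (scalar 2))
    (k * L) (fun _ => by simp [HExpr.OK, HExpr.eval, scalar])
    (fun _ => by simp [HExpr.eval, hI, hα]) hlt
  have h2 := runs_setScalar (α := setEntry α 0 1 (k * L)) (B := B) hI (j := 6) (v := .lit 1) 1
    (fun _ => trivial) (fun _ => rfl) (Nat.one_lt_two_pow (by omega))
  have h3 := runs_setScalar (α := setEntry (setEntry α 0 1 (k * L)) 0 6 1) (B := B) hI (j := 7)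
    (v := .lit 0) 0 (fun _ => trivial) (fun _ => rfl) (by positivity)
  obtain ⟨α', ⟨i1, i2, i3, i4, i5⟩, i6, i7⟩ := runs_while
    (α := setEntry (setEntry (setEntry α 0 1 (k * L)) 0 6 1) 0 7 0) (B := B) hI
    (e := .sub (scalar 1) (scalar 7)) (p := .seq (assign 5 (scalar 7) (scalar 6))
      (.seq (setScalar 6 (.mul (scalar 6) (.lit 2))) advance)) (s := 3)
    (fun α => α 0 1 = k * L ∧ α 0 2 = L ∧ (∀ i < α 0 7, α 5 i = 2 ^ i) ∧ α 0 6 = 2 ^ α 0 7 ∧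
      α 0 7 ≤ k * L)
    (fun α => α 0 1 - α 0 7) (fun α => k * L - α 0 7)
    (fun α ρ => rfl)
    (fun α ρ _ => by simp [HExpr.OK, scalar])
    (fun α ⟨a1, a2, a3, a4, a5⟩ h0 => by
      have hlt' : α 0 7 < k * L := by omega
      refine ⟨_, ?_, ?_, (runs_assign (i := scalar 7) (v := scalar 6) hI (by omega) (fun ρ => ?_) (fun ρ => ?_)
        (α 0 7) (2 ^ α 0 7)
        (fun ρ => rfl) (fun ρ => a4) ?_).seq ((runs_setScalar hI (2 ^ (α 0 7 + 1)) (fun ρ => ?_)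
        (fun ρ => ?_) ?_).seq (runs_setScalar hI (α 0 7 + 1) (fun ρ => ?_) (fun ρ => ?_) ?_))⟩
      · refine ⟨by simp [setEntry, a1], by simp [setEntry, a2], ?_, by simp [setEntry], ?_⟩
        · intro i hi
          simp only [setEntry, true_and, reduceIte, OfNat.ofNat_ne_zero, false_and, OfNat.zero_ne_ofNat] at hi ⊢
          split_ifs with h
          · rw [h]
          · exact a3 i (by omega)
        · simp [setEntry]; omega
      · simp [setEntry]; omega
      · simp [HExpr.OK, scalar]
      · simp [HExpr.OK, scalar]
      · exact Nat.pow_lt_pow_right (by omega) (by omega)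
      · simp [HExpr.OK, scalar]
      · simp [HExpr.eval, setEntry, a4, pow_succ]
      · exact Nat.pow_lt_pow_right (by omega) (by omega)
      · simp [HExpr.OK, scalar]
      · simp [HExpr.eval, setEntry]
      · omega)
    (by simp [setEntry, hα])
  refine ⟨α', i1, i2, fun i hi => i3 i (by rw [i1] at i6; omega), (h1.seq (h2.seq (h3.seq i7))).mono ?_⟩
  simp [setEntry]; omega

/-! ### Factoring -/

/-- The state of the computation of the digits, with digits for coordinates below `j` only. -/
structure DigitState (α : ℕ → ℕ → ℕ) (L K P j : ℕ) : Prop where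
  total : α 0 1 = K
  field : α 0 2 = L
  pow : ∀ i < K, α 5 i = 2 ^ i
  stride_eq : α 0 3 = K + 2 + ∑ l ∈ Finset.range (α 0 0), α 1 l
  index : ∀ l < α 0 0, α 4 l < j
  radix : ∀ l < α 0 0, 2 ≤ α 1 l ∧ α 1 l ≤ P

/-- The state between coordinates. -/
structure BetweenState (α : ℕ → ℕ → ℕ) (L K P : ℕ) (M : ℕ → ℕ) (i : ℕ) : Prop
    extends DigitState α L K P i where
  coordinate : α 0 7 = i
  done : ∀ j < i, Splitting (α 0 0) (α 1) (α 2) (α 3) (α 4) j (M j) 1 (M j)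
  prod : ∏ l ∈ Finset.range (α 0 0), α 1 l = ∏ j ∈ Finset.range i, M j

/-- The state during trial division. -/
structure TrialState (α : ℕ → ℕ → ℕ) (L K P : ℕ) (M : ℕ → ℕ) (i : ℕ) : Prop
    extends DigitState α L K P (i + 1) where
  coordinate : α 0 7 = i
  done : ∀ j < i, Splitting (α 0 0) (α 1) (α 2) (α 3) (α 4) j (M j) 1 (M j)
  current : Splitting (α 0 0) (α 1) (α 2) (α 3) (α 4) i (M i) (α 0 8) (α 0 9)
  prod : ∏ l ∈ Finset.range (α 0 0), α 1 l = (∏ j ∈ Finset.range i, M j) * α 0 9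
  two_le : 2 ≤ α 0 10
  least : ∀ q, q.Prime → q ∣ α 0 8 → α 0 10 ≤ q

/-- Every radix is at least `2`, so the number of digits is logarithmic in their product. -/
theorem digitCount_le {L K P j m : ℕ} (h : DigitState α L K P j)
    (hprod : ∏ l ∈ Finset.range (α 0 0), α 1 l ≤ m) : α 0 0 ≤ Nat.log 2 m :=
  Nat.le_log_of_pow_le (by omega) ((two_pow_le_prod fun l hl => (h.radix l hl).1).trans hprod)

theorem stride_le {L K P j n : ℕ} (h : DigitState α L K P j) (hn : α 0 0 ≤ n) :
    α 0 3 ≤ K + 2 + n * P := by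
  rw [h.stride_eq]
  have h1 : ∑ l ∈ Finset.range (α 0 0), α 1 l ≤ α 0 0 * P := by
    have := Finset.sum_le_card_nsmul (Finset.range (α 0 0)) (α 1) P
      fun l hl => (h.radix l (Finset.mem_range.1 hl)).2
    rwa [Finset.card_range, smul_eq_mul] at this
  have := Nat.mul_le_mul_right P hn
  omega

/-- No prime factor of the unfactored part is below the trial divisor, and all of them are at most
`P`, so the divisor never exceeds `P` while something is left. Either the divisor grows, or it
divides and the unfactored part at least halves; both decrease the measure. Primality of the radices
is not needed, only that they lie between `2` and `P`. -/
theorem runs_trialStep (hI : I 0 = k) {M : ℕ → ℕ} {L K P i m : ℕ} (hi : i < k)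
    (hM : ∀ i < k, 2 ≤ M i) (hm : ∏ j ∈ Finset.range k, M j = m) (hmB : m < 2 ^ B)
    (hP : ∀ q, q.Prime → q ∣ m → q ≤ P) (hkB : k < 2 ^ B)
    (hSB : K + 2 + Nat.log 2 m * P < 2 ^ B) (hPB : P < 2 ^ B)
    (h : TrialState α L K P M i) (h0 : α 0 8 - 1 ≠ 0) :
    ∃ α', TrialState α' L K P M i ∧
      P + 1 - α' 0 10 + Nat.log 2 (α' 0 8) < P + 1 - α 0 10 + Nat.log 2 (α 0 8) ∧
      Runs B k I trialStep α α' 9 := by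
  have hcw := h.current.mul_eq
  have hMm : M i ∣ m := by
    rw [← hm]; exact Finset.dvd_prod_of_mem _ (Finset.mem_range.2 hi)
  have hMi := hM i hi
  have hm0 : 0 < m := by
    rw [← hm]
    exact Finset.prod_pos fun j hj => by have := hM j (Finset.mem_range.1 hj); omega
  have hMle : M i ≤ m := Nat.le_of_dvd hm0 hMm
  have hcM : α 0 8 ≤ M i := Nat.le_of_dvd (by omega) ⟨_, hcw.symm⟩
  have hcm : α 0 8 ∣ m := (Dvd.intro _ hcw).trans hMm
  have hq := Nat.minFac_prime (show α 0 8 ≠ 1 by omega)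
  have hqP := hP _ hq ((Nat.minFac_dvd _).trans hcm)
  have hdq := h.least _ hq (Nat.minFac_dvd _)
  have hd := h.two_le
  by_cases hdvd : α 0 8 % α 0 10 = 0
  · obtain ⟨c, hc⟩ := Nat.dvd_of_mod_eq_zero hdvd
    have hdiv : α 0 8 / α 0 10 = c := by
      rw [hc]; exact Nat.mul_div_cancel_left c (by omega)
    have hc0 : 0 < c := by
      rcases Nat.eq_zero_or_pos c with h | h
      · rw [h, mul_zero] at hc; omega
      · exact h
    have hw0 : α 0 9 * α 0 10 ≤ M i := by
      refine Nat.le_of_dvd (by omega) ⟨c, ?_⟩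
      rw [← hcw, hc]; ring
    set n := α 0 0 with hn
    set d := α 0 10 with hdd
    set w := α 0 9 with hw
    have hcur : Splitting n (α 1) (α 2) (α 3) (α 4) i (M i) (c * d) w := by
      have := h.current
      rwa [hc, mul_comm] at this
    have hprod' : (∏ l ∈ Finset.range n, α 1 l) * d ≤ m := by
      rw [h.prod, mul_assoc]
      refine (Nat.mul_le_mul_left _ hw0).trans ?_
      rw [← Finset.prod_range_succ, ← hm]
      exact prod_range_le hM hi
    have r1 := runs_assign (α := α) (B := B) hI (a := 1) (i := scalar 0) (v := scalar 10) (by omega)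
      (fun ρ => by simp [HExpr.OK, scalar]) (fun ρ => by simp [HExpr.OK, scalar]) n d (fun ρ => rfl)
      (fun ρ => rfl) (by omega)
    set α1 := setEntry α 1 n d with hα1
    have r2 := runs_setScalar (α := α1) (B := B) hI (j := 8) (v := .div (scalar 8) (scalar 10)) c
      (fun ρ => by simp [HExpr.OK, scalar])
      (fun ρ => by simp [HExpr.eval, hα1, setEntry, hdiv, ← hdd])
      (by have := Nat.le_mul_of_pos_left c (show 0 < d by omega); omega)
    set α2 := setEntry α1 0 8 c with hα2
    have r3 := runs_assign (α := α2) (B := B) hI (a := 2) (i := scalar 0) (v := scalar 8) (by omega)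
      (fun ρ => by simp [HExpr.OK, scalar]) (fun ρ => by simp [HExpr.OK, scalar]) n c
      (fun ρ => by simp [hα2, hα1, setEntry, ← hn]) (fun ρ => by simp [hα2, setEntry])
      (by have := Nat.le_mul_of_pos_left c (show 0 < d by omega); omega)
    set α3 := setEntry α2 2 n c with hα3
    have r4 := runs_assign (α := α3) (B := B) hI (a := 3) (i := scalar 0) (v := scalar 9) (by omega)
      (fun ρ => by simp [HExpr.OK, scalar]) (fun ρ => by simp [HExpr.OK, scalar]) n w
      (fun ρ => by simp [hα3, hα2, hα1, setEntry, ← hn])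
      (fun ρ => by simp [hα3, hα2, hα1, setEntry, ← hw])
      (by have := Nat.le_mul_of_pos_right w (show 0 < d by omega); omega)
    set α4 := setEntry α3 3 n w with hα4
    have r5 := runs_assign (α := α4) (B := B) hI (a := 4) (i := scalar 0) (v := scalar 7) (by omega)
      (fun ρ => by simp [HExpr.OK, scalar]) (fun ρ => by simp [HExpr.OK, scalar]) n i
      (fun ρ => by simp [hα4, hα3, hα2, hα1, setEntry, ← hn])
      (fun ρ => by simp [hα4, hα3, hα2, hα1, setEntry, h.coordinate]) (by omega)
    set α5 := setEntry α4 4 n i with hα5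
    have r6 := runs_setScalar (α := α5) (B := B) hI (j := 9) (v := .mul (scalar 9) (scalar 10))
      (w * d) (fun ρ => by simp [HExpr.OK, scalar])
      (fun ρ => by simp [HExpr.eval, hα5, hα4, hα3, hα2, hα1, setEntry, ← hw, ← hdd]) (by omega)
    set α6 := setEntry α5 0 9 (w * d) with hα6
    -- This counts the new digit as well, as needed for the bound on the enlarged stride.
    have hnlog : n + 1 ≤ Nat.log 2 m := by
      refine Nat.le_log_of_pow_le (by omega) (le_trans ?_ hprod')
      rw [pow_succ]
      exact Nat.mul_le_mul (two_pow_le_prod fun l hl => (h.radix l hl).1) hd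
    have hstr : α 0 3 + d ≤ K + 2 + Nat.log 2 m * P := by
      have h1 := stride_le (n := n) h.toDigitState le_rfl
      have h2 := Nat.mul_le_mul_right P hnlog
      rw [Nat.succ_mul] at h2
      omega
    have r7 := runs_setScalar (α := α6) (B := B) hI (j := 3) (v := .add (scalar 3) (scalar 10))
      (α 0 3 + d) (fun ρ => by simp [HExpr.OK, scalar])
      (fun ρ => by simp [HExpr.eval, hα6, hα5, hα4, hα3, hα2, hα1, setEntry, ← hdd]) (by omega)
    set α7 := setEntry α6 0 3 (α 0 3 + d) with hα7
    have hlogm : Nat.log 2 m ≤ m := Nat.log_le_self _ _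
    have r8 := runs_setScalar (α := α7) (B := B) hI (j := 0) (v := .add (scalar 0) (.lit 1))
      (n + 1) (fun ρ => by simp [HExpr.OK, scalar])
      (fun ρ => by simp [HExpr.eval, hα7, hα6, hα5, hα4, hα3, hα2, hα1, setEntry, ← hn]) (by omega)
    set α8 := setEntry α7 0 0 (n + 1) with hα8
    have e00 : α8 0 0 = n + 1 := by simp [hα8, setEntry]
    have e01 : α8 0 1 = α 0 1 := by
      simp [hα8, hα7, hα6, hα5, hα4, hα3, hα2, hα1, setEntry]
    have e02 : α8 0 2 = α 0 2 := by
      simp [hα8, hα7, hα6, hα5, hα4, hα3, hα2, hα1, setEntry]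
    have e03 : α8 0 3 = α 0 3 + d := by simp [hα8, hα7, setEntry]
    have e07 : α8 0 7 = α 0 7 := by
      simp [hα8, hα7, hα6, hα5, hα4, hα3, hα2, hα1, setEntry]
    have e08 : α8 0 8 = c := by
      simp [hα8, hα7, hα6, hα5, hα4, hα3, hα2, setEntry]
    have e09 : α8 0 9 = w * d := by simp [hα8, hα7, hα6, setEntry]
    have e10 : α8 0 10 = d := by
      simp [hα8, hα7, hα6, hα5, hα4, hα3, hα2, hα1, setEntry, ← hdd]
    have e5 : α8 5 = α 5 := by
      funext l; simp [hα8, hα7, hα6, hα5, hα4, hα3, hα2, hα1, setEntry]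
    have e1 : ∀ l, α8 1 l = if l = n then d else α 1 l := by
      intro l; simp [hα8, hα7, hα6, hα5, hα4, hα3, hα2, hα1, setEntry]
    have e2 : ∀ l, α8 2 l = if l = n then c else α 2 l := by
      intro l; simp [hα8, hα7, hα6, hα5, hα4, hα3, hα2, hα1, setEntry]
    have e3 : ∀ l, α8 3 l = if l = n then w else α 3 l := by
      intro l; simp [hα8, hα7, hα6, hα5, hα4, hα3, hα2, hα1, setEntry]
    have e4 : ∀ l, α8 4 l = if l = n then i else α 4 l := by
      intro l; simp [hα8, hα7, hα6, hα5, hα4, hα3, hα2, hα1, setEntry]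
    have f1 : ∀ l < n, α8 1 l = α 1 l := fun l hl => by rw [e1, if_neg hl.ne]
    have f2 : ∀ l < n, α8 2 l = α 2 l := fun l hl => by rw [e2, if_neg hl.ne]
    have f3 : ∀ l < n, α8 3 l = α 3 l := fun l hl => by rw [e3, if_neg hl.ne]
    have f4 : ∀ l < n, α8 4 l = α 4 l := fun l hl => by rw [e4, if_neg hl.ne]
    refine ⟨α8, ?_, ?_, ((Runs.ite_false hI (e := .mod (scalar 8) (scalar 10))
      (r1.seq (r2.seq (r3.seq (r4.seq (r5.seq (r6.seq (r7.seq r8)))))))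
      (fun ρ => by simp [HExpr.OK, scalar]) (fun ρ => hdvd))).mono (by omega)⟩
    · constructor
      · constructor
        · rw [e01, h.total]
        · rw [e02, h.field]
        · rw [e5]; exact h.pow
        · rw [e03, e00, Finset.sum_range_succ, e1, if_pos rfl, h.stride_eq, ← hn, add_assoc]
          congr 2
          exact Finset.sum_congr rfl fun l hl => (f1 l (Finset.mem_range.1 hl)).symm
        · rw [e00]
          intro l hl
          rw [e4]
          split_ifs with hln
          · omega
          · exact h.index l (by omega)
        · rw [e00]
          intro l hl
          rw [e1]
          split_ifs with hln
          · omega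
          · exact h.radix l (by omega)
      · rw [e07, h.coordinate]
      · intro j hj
        rw [e00]
        exact (h.done j hj).skip f1 f2 f3 f4 (by rw [e1, if_pos rfl]; omega)
          (by rw [e4, if_pos rfl]; omega)
      · rw [e00, e08, e09]
        exact hcur.push rfl (by omega) hc0 f1 f2 f3 f4 (by rw [e1, if_pos rfl])
          (by rw [e2, if_pos rfl]) (by rw [e3, if_pos rfl]) (by rw [e4, if_pos rfl])
      · rw [e00, e09, Finset.prod_range_succ, e1, if_pos rfl, ← mul_assoc, ← h.prod]
        congr 1
        exact Finset.prod_congr rfl fun l hl => f1 l (Finset.mem_range.1 hl)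
      · rw [e10]; exact hd
      · rw [e08, e10]
        intro q hq hqc
        exact h.least q hq (by rw [hc]; exact hqc.mul_left _)
    · rw [e10, e08]
      have h1 : Nat.log 2 c + 1 = Nat.log 2 (c * 2) := (Nat.log_mul_base (by omega) hc0.ne').symm
      have h2 : Nat.log 2 (c * 2) ≤ Nat.log 2 (α 0 8) := Nat.log_mono_right (by
        rw [hc, mul_comm d]; exact Nat.mul_le_mul_left c hd)
      omega
  -- A divisor that fails is not the least prime factor, hence strictly below it, and may be
  -- increased without passing a prime factor.
  · have hne : α 0 10 ≠ (α 0 8).minFac := by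
      intro he
      apply hdvd
      rw [he]
      exact Nat.mod_eq_zero_of_dvd (Nat.minFac_dvd _)
    have r := runs_setScalar (α := α) (B := B) hI (j := 10) (v := .add (scalar 10) (.lit 1))
      (α 0 10 + 1) (fun ρ => by simp [HExpr.OK, scalar]) (fun ρ => rfl) (by omega)
    refine ⟨_, ?_, ?_, ((Runs.ite_true hI (e := .mod (scalar 8) (scalar 10)) r
      (fun ρ => by simp [HExpr.OK, scalar]) (fun ρ => hdvd))).mono (by omega)⟩
    · have e : ∀ a, a ≠ 0 → setEntry α 0 10 (α 0 10 + 1) a = α a := by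
        intro a ha; funext l; simp [setEntry, ha]
      have e' : ∀ l, l ≠ 10 → setEntry α 0 10 (α 0 10 + 1) 0 l = α 0 l := by
        intro l hl; simp [setEntry, hl]
      have e10 : setEntry α 0 10 (α 0 10 + 1) 0 10 = α 0 10 + 1 := by simp [setEntry]
      constructor
      · constructor
        · rw [e' 1 (by omega), h.total]
        · rw [e' 2 (by omega), h.field]
        · rw [e 5 (by omega)]; exact h.pow
        · rw [e' 3 (by omega), e' 0 (by omega), e 1 (by omega), h.stride_eq]
        · rw [e' 0 (by omega), e 4 (by omega)]; exact h.index
        · rw [e' 0 (by omega), e 1 (by omega)]; exact h.radix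
      · rw [e' 7 (by omega), h.coordinate]
      · rw [e' 0 (by omega), e 1 (by omega), e 2 (by omega), e 3 (by omega), e 4 (by omega)]
        exact h.done
      · rw [e' 0 (by omega), e 1 (by omega), e 2 (by omega), e 3 (by omega), e 4 (by omega),
          e' 8 (by omega), e' 9 (by omega)]
        exact h.current
      · rw [e' 0 (by omega), e 1 (by omega), e' 9 (by omega)]
        exact h.prod
      · rw [e10]; omega
      · rw [e10, e' 8 (by omega)]
        intro q hq hqc
        have h1 := h.least q hq hqc
        rcases h1.lt_or_eq with h2 | h2
        · exact h2
        · exact absurd (Nat.mod_eq_zero_of_dvd (h2 ▸ hqc)) hdvd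
    · simp only [setEntry, true_and, reduceIte, Nat.reduceEqDiff]
      omega

end

end QAlg

/-! ### Factoring all orders and the resulting digit system. -/

namespace QAlg

section

variable {k : ℕ} {I : ℕ → ℕ} {B : ℕ} {α α' : ℕ → ℕ → ℕ} {L K P : ℕ} {M : ℕ → ℕ}

theorem DigitState.congr {j j' : ℕ} (h : DigitState α L K P j) (hj : j ≤ j')
    (h0 : ∀ l < 4, α' 0 l = α 0 l) (h1 : ∀ a, a ≠ 0 → α' a = α a) : DigitState α' L K P j' := by
  have e0 := h0 0 (by omega)
  have e1 := h0 1 (by omega)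
  have e2 := h0 2 (by omega)
  have e3 := h0 3 (by omega)
  have f1 := h1 1 (by omega)
  have f4 := h1 4 (by omega)
  have f5 := h1 5 (by omega)
  constructor
  · rw [e1, h.total]
  · rw [e2, h.field]
  · rw [f5]; exact h.pow
  · rw [e3, e0, f1, h.stride_eq]
  · rw [e0, f4]; exact fun l hl => (h.index l hl).trans_le hj
  · rw [e0, f1]; exact h.radix

theorem runs_factorOrder (hI : I 0 = k) (hIM : ∀ i < k, I (2 + i) = M i) {i m : ℕ} (hi : i < k)
    (hM : ∀ i < k, 2 ≤ M i) (hm : ∏ j ∈ Finset.range k, M j = m) (hmB : m < 2 ^ B)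
    (hP : ∀ q, q.Prime → q ∣ m → q ≤ P) (hkB : k < 2 ^ B)
    (hSB : K + 2 + Nat.log 2 m * P < 2 ^ B) (hPB : P < 2 ^ B)
    (h : BetweenState α L K P M i) :
    ∃ α', BetweenState α' L K P M (i + 1) ∧
      Runs B k I factorOrder α α' (5 + (P + 1 + Nat.log 2 m) * 10) := by
  have hMm : M i ≤ m := hm ▸ le_prod_range hM hi
  have hMi := hM i hi
  have r1 := runs_setScalar (α := α) (B := B) hI (j := 8) (v := currentOrder) (M i)
    (fun ρ => by simp [HExpr.OK, HExpr.eval, currentOrder, scalar, h.coordinate]; omega)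
    (fun ρ => by simp [HExpr.eval, currentOrder, h.coordinate, hIM i hi]) (by omega)
  set α1 := setEntry α 0 8 (M i) with hα1
  have r2 := runs_setScalar (α := α1) (B := B) hI (j := 9) (v := .lit 1) 1
    (fun _ => trivial) (fun _ => rfl) (by omega)
  set α2 := setEntry α1 0 9 1 with hα2
  have r3 := runs_setScalar (α := α2) (B := B) hI (j := 10) (v := .lit 2) 2
    (fun _ => trivial) (fun _ => rfl) (by omega)
  set α3 := setEntry α2 0 10 2 with hα3
  have f : ∀ a, a ≠ 0 → α3 a = α a := by
    intro a ha; funext l; simp [hα1, hα2, hα3, setEntry, ha]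
  have f' : ∀ l, l < 8 → α3 0 l = α 0 l := by
    intro l hl
    simp [hα1, hα2, hα3, setEntry, show l ≠ 8 by omega, show l ≠ 9 by omega, show l ≠ 10 by omega]
  have e8 : α3 0 8 = M i := by simp [hα1, hα2, hα3, setEntry]
  have e9 : α3 0 9 = 1 := by simp [hα2, hα3, setEntry]
  have e10 : α3 0 10 = 2 := by simp [hα3, setEntry]
  have hT : TrialState α3 L K P M i := by
    constructor
    · exact h.toDigitState.congr (by omega) (fun l hl => f' l (by omega)) f
    · rw [f' 7 (by omega), h.coordinate]
    · rw [f' 0 (by omega), f 1 (by omega), f 2 (by omega), f 3 (by omega), f 4 (by omega)]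
      exact h.done
    · rw [f' 0 (by omega), f 1 (by omega), f 2 (by omega), f 3 (by omega), f 4 (by omega), e8, e9]
      exact Splitting.init (fun l hl => (h.index l hl).ne)
        (fun l hl => by have := (h.radix l hl).1; omega)
    · rw [f' 0 (by omega), f 1 (by omega), e9, mul_one]
      exact h.prod
    · rw [e10]
    · rw [e10]
      exact fun q hq _ => hq.two_le
  obtain ⟨α4, i1, i2, i3⟩ := runs_while (α := α3) (B := B) hI (e := .sub (scalar 8) (.lit 1))
    (p := trialStep) (s := 9) (fun α => TrialState α L K P M i) (fun α => α 0 8 - 1)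
    (fun α => P + 1 - α 0 10 + Nat.log 2 (α 0 8)) (fun _ _ => rfl)
    (fun α ρ _ => by simp [HExpr.OK, scalar])
    (fun α hα h0 => runs_trialStep hI hi hM hm hmB hP hkB hSB hPB hα h0) hT
  -- The loop ends when the truncated difference with `1` is zero. The unfactored part divides a
  -- positive order, so it is then `1` and not `0`.
  have hc0 : α4 0 8 ≠ 0 := by
    intro h0
    have := i1.current.mul_eq
    rw [h0, zero_mul] at this
    omega
  have hc : α4 0 8 = 1 := by omega
  have hw : α4 0 9 = M i := by
    have := i1.current.mul_eq
    rwa [hc, one_mul] at this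
  have r4 := runs_setScalar (α := α4) (B := B) hI (j := 7) (v := .add (scalar 7) (.lit 1)) (i + 1)
    (fun ρ => by simp [HExpr.OK, scalar]) (fun ρ => by simp [HExpr.eval, i1.coordinate])
    (by omega)
  set α5 := setEntry α4 0 7 (i + 1) with hα5
  have g : ∀ a, a ≠ 0 → α5 a = α4 a := by
    intro a ha; funext l; simp [hα5, setEntry, ha]
  have g' : ∀ l, l < 7 → α5 0 l = α4 0 l := by
    intro l hl
    simp [hα5, setEntry, show l ≠ 7 by omega]
  refine ⟨α5, ?_, (r1.seq (r2.seq (r3.seq (i3.seq r4)))).mono ?_⟩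
  · constructor
    · exact i1.toDigitState.congr le_rfl (fun l hl => g' l (by omega)) g
    · simp [hα5, setEntry]
    · rw [g' 0 (by omega), g 1 (by omega), g 2 (by omega), g 3 (by omega), g 4 (by omega)]
      intro j hj
      rcases Nat.lt_succ_iff_lt_or_eq.1 hj with h1 | rfl
      · exact i1.done j h1
      · have := i1.current
        rwa [hc, hw] at this
    · rw [g' 0 (by omega), g 1 (by omega), Finset.prod_range_succ, i1.prod, hw]
  · rw [e8, e10]
    have h1 : Nat.log 2 (M i) ≤ Nat.log 2 m := Nat.log_mono_right hMm
    have h2 := Nat.mul_le_mul_right 10 (show P + 1 - 2 + Nat.log 2 (M i) ≤ P + 1 + Nat.log 2 m by omega)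
    omega

theorem runs_computeDigits (hI : I 0 = k) (hIM : ∀ i < k, I (2 + i) = M i) {m : ℕ}
    (hM : ∀ i < k, 2 ≤ M i) (hm : ∏ j ∈ Finset.range k, M j = m) (hmB : m < 2 ^ B)
    (hP : ∀ q, q.Prime → q ∣ m → q ≤ P) (hkB : k < 2 ^ B)
    (hSB : K + 2 + Nat.log 2 m * P < 2 ^ B) (hPB : P < 2 ^ B)
    (h1 : α 0 1 = K) (h2 : α 0 2 = L) (h5 : ∀ i < K, α 5 i = 2 ^ i) :
    ∃ α', BetweenState α' L K P M k ∧
      Runs B k I computeDigits α α' (4 + k * (6 + (P + 1 + Nat.log 2 m) * 10)) := by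
  have r1 := runs_setScalar (α := α) (B := B) hI (j := 3) (v := .add (scalar 1) (.lit 2)) (K + 2)
    (fun ρ => by simp [HExpr.OK, scalar]) (fun ρ => by simp [HExpr.eval, h1]) (by omega)
  set α1 := setEntry α 0 3 (K + 2) with hα1
  have r2 := runs_setScalar (α := α1) (B := B) hI (j := 0) (v := .lit 0) 0
    (fun _ => trivial) (fun _ => rfl) (by omega)
  set α2 := setEntry α1 0 0 0 with hα2
  have r3 := runs_setScalar (α := α2) (B := B) hI (j := 7) (v := .lit 0) 0
    (fun _ => trivial) (fun _ => rfl) (by omega)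
  set α3 := setEntry α2 0 7 0 with hα3
  have e0 : α3 0 0 = 0 := by simp [hα1, hα2, hα3, setEntry]
  have hT : BetweenState α3 L K P M 0 := by
    constructor
    · constructor
      · simp [hα1, hα2, hα3, setEntry, h1]
      · simp [hα1, hα2, hα3, setEntry, h2]
      · simpa [hα1, hα2, hα3, setEntry] using h5
      · rw [e0]; simp [hα1, hα2, hα3, setEntry]
      · rw [e0]; intro l hl; omega
      · rw [e0]; intro l hl; omega
    · simp [hα3, setEntry]
    · intro j hj; omega
    · rw [e0]; simp
  obtain ⟨α4, ⟨i0, i1⟩, i2, i3⟩ := runs_while (α := α3) (B := B) hI (e := moreCoordinates)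
    (p := factorOrder) (s := 5 + (P + 1 + Nat.log 2 m) * 10)
    (fun α => α 0 7 ≤ k ∧ BetweenState α L K P M (α 0 7))
    (fun α => k - α 0 7) (fun α => k - α 0 7)
    (fun α ρ => by simp [moreCoordinates, HExpr.eval, hI])
    (fun α ρ _ => by simp [moreCoordinates, HExpr.OK, HExpr.eval, scalar])
    (fun α ⟨hα0, hα⟩ h0 => by
      obtain ⟨β, hβ, hr⟩ := runs_factorOrder hI hIM (show α 0 7 < k by omega) hM hm hmB hP hkB hSB
        hPB hα
      refine ⟨β, ⟨?_, ?_⟩, ?_, hr⟩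
      · rw [hβ.coordinate]; omega
      · rw [hβ.coordinate]; exact hβ
      · rw [hβ.coordinate]; omega) ⟨by rw [hT.coordinate]; omega, by rw [hT.coordinate]; exact hT⟩
  refine ⟨α4, ?_, (r1.seq (r2.seq (r3.seq i3))).mono ?_⟩
  · rwa [show α4 0 7 = k by omega] at i1
  · rw [hT.coordinate, Nat.sub_zero]
    have h : 1 + (5 + (P + 1 + Nat.log 2 m) * 10) = 6 + (P + 1 + Nat.log 2 m) * 10 := by omega
    rw [h]
    omega

theorem lt_of_two_le_prod {m : ℕ} (hM : ∀ i < k, 2 ≤ M i)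
    (hm : ∏ j ∈ Finset.range k, M j = m) : k ≤ Nat.log 2 m ∧ k < m := by
  have h := two_pow_le_prod hM
  rw [hm] at h
  refine ⟨Nat.le_log_of_pow_le (by omega) h, Nat.lt_two_pow_self.trans_le h⟩

/-- A bound for the number of wires. -/
def wireBound (n L K P : ℕ) : ℕ := 2 * K + L + 16 * ((n + 1) * (K + 2 + n * P))

theorem runs_preprocess (hI : I 0 = k) (hIM : ∀ i < k, I (2 + i) = M i) {m : ℕ}
    (hM : ∀ i < k, 2 ≤ M i) (hm : ∏ j ∈ Finset.range k, M j = m) (hmB : m < 2 ^ B)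
    (hP : ∀ q, q.Prime → q ∣ m → q ≤ P) (hPB : P < 2 ^ B) (hL : L = Nat.size m)
    (hKB : k * L < B) (hNB : wireBound (Nat.log 2 m) L (k * L) P < 2 ^ B) :
    ∃ α', BetweenState α' L (k * L) P M k ∧
      α' 0 4 = 2 * (k * L) + L + 16 * ((α' 0 0 + 1) * α' 0 3) ∧
      Runs B k I preprocess α α' (15 + k * 3 + L * 3 + k * L * 4 +
        k * (6 + (P + 1 + Nat.log 2 m) * 10)) := by
  subst hL
  have hkm := (lt_of_two_le_prod hM hm).2
  have hkB : k < 2 ^ B := hkm.trans hmB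
  obtain ⟨α1, h1, r1⟩ := runs_computeOrder (α := α) hI hIM hM (by rw [hm]; exact hmB) hkB
  obtain ⟨α2, h2, r2⟩ := runs_computeWidth hI (h1.trans hm) hmB
  obtain ⟨α3, h3, h4, h5, r3⟩ := runs_computePowers hI h2 hKB
  have hSB : k * Nat.size m + 2 + Nat.log 2 m * P < 2 ^ B := by
    refine lt_of_le_of_lt ?_ hNB
    have := Nat.le_mul_of_pos_left (k * Nat.size m + 2 + Nat.log 2 m * P)
      (show 0 < Nat.log 2 m + 1 by omega)
    rw [wireBound]
    omega
  obtain ⟨α4, h6, r4⟩ := runs_computeDigits hI hIM hM hm hmB hP hkB hSB hPB h3 h4 h5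
  have hn := digitCount_le h6.toDigitState (m := m) (by rw [h6.prod, hm])
  have r5 := runs_setScalar (α := α4) (B := B) hI (j := 4) (v := .add (.add (.mul (.lit 2)
    (scalar 1)) (scalar 2)) (.mul (.lit 16) (.mul (.add (scalar 0) (.lit 1)) (scalar 3))))
    (2 * (k * Nat.size m) + Nat.size m + 16 * ((α4 0 0 + 1) * α4 0 3))
    (fun ρ => by simp [HExpr.OK, scalar])
    (fun ρ => by simp [HExpr.eval, h6.total, h6.field]) (by
      refine lt_of_le_of_lt ?_ hNB
      rw [wireBound]
      have := Nat.mul_le_mul (Nat.succ_le_succ hn) (stride_le h6.toDigitState hn)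
      simp only [Nat.succ_eq_add_one] at this
      omega)
  refine ⟨_, ?_, ?_, (r1.seq (r2.seq (r3.seq (r4.seq r5)))).mono (by omega)⟩
  · have f : ∀ a, a ≠ 0 → setEntry α4 0 4 (2 * (k * Nat.size m) + Nat.size m +
        16 * ((α4 0 0 + 1) * α4 0 3)) a = α4 a := by
      intro a ha; funext l; simp [setEntry, ha]
    have f' : ∀ l, l ≠ 4 → setEntry α4 0 4 (2 * (k * Nat.size m) + Nat.size m +
        16 * ((α4 0 0 + 1) * α4 0 3)) 0 l = α4 0 l := by
      intro l hl; simp [setEntry, hl]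
    constructor
    · exact h6.toDigitState.congr le_rfl (fun l hl => f' l (by omega)) f
    · rw [f' 7 (by omega), h6.coordinate]
    · rw [f' 0 (by omega), f 1 (by omega), f 2 (by omega), f 3 (by omega), f 4 (by omega)]
      exact h6.done
    · rw [f' 0 (by omega), f 1 (by omega)]
      exact h6.prod
  · simp [setEntry]

/-- The stride is the sum of all radices plus the number of bits plus `2`, so it is long enough both
for one-hot registers and for carries. -/
theorem BetweenState.digits {m : ℕ} (h : BetweenState α L (k * L) P M k)
    (hN : α 0 4 = 2 * (k * L) + L + 16 * ((α 0 0 + 1) * α 0 3))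
    (hM : ∀ i < k, 2 ≤ M i) (hm : ∏ j ∈ Finset.range k, M j = m) (hL : L = Nat.size m) :
    Digits α k L M := by
  have hm0 : 0 < m := by
    rw [← hm]
    exact Finset.prod_pos fun j hj => by have := hM j (Finset.mem_range.1 hj); omega
  refine Digits.of_splitting ?_ h.total h.field ?_ h.index (fun i hi => ?_)
    (fun i hi => by have := hM i hi; omega) h.done
  · constructor
    · change α 0 1 < α 0 3
      rw [h.total, h.stride_eq]; omega
    · intro l hl
      have : α 1 l ≤ ∑ l ∈ Finset.range (α 0 0), α 1 l :=
        Finset.single_le_sum (f := α 1) (fun _ _ => Nat.zero_le _) (Finset.mem_range.2 hl)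
      change α 1 l ≤ α 0 3
      rw [h.stride_eq]
      omega
    · intro l hl
      have := (h.radix l hl).1
      change 0 < α 1 l
      omega
    · intro i hi
      change i < α 0 1 at hi
      exact h.pow i (by rwa [h.total] at hi)
    · change α 0 4 = 2 * α 0 1 + α 0 2 + 16 * ((α 0 0 + 1) * α 0 3)
      rw [hN, h.total, h.field]
  · rw [hL]; exact Nat.size_pos.2 hm0
  · rw [hL, ← hm]
    exact (le_prod_range hM hi).trans_lt (Nat.lt_size_self _)

end

end QAlg

/-! ### Admissibility of the circuits and bounds for their loops. -/

namespace QAlg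

section

variable {k L : ℕ} {I : ℕ → ℕ} {α : ℕ → ℕ → ℕ} {ρ : ℕ → ℕ} {R : ℕ}

theorem toBinary_ok (hn : α 0 0 ≤ R) (hK : α 0 1 ≤ R) (hp : ∀ l < α 0 0, α 1 l ≤ R) {tag a : ℕ}
    (ha : a < 7) {base : HExpr} (hbase : ∀ ρ, base.OK k I α ρ 1) :
    (toBinary tag a base).OK k I α R 0 ρ := by
  simp +contextual [toBinary, loadAddend, addBit, cnot, Circ.OK, Step.operands, HExpr.OK, scalar,
    wireE, weightE, HExpr.eval, hn, hK, hp, ha, hbase, Function.update]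

theorem chain_ok {δ tag : ℕ} (hδ : 0 < δ) (hp : α 1 (ρ 0) ≤ R) :
    (chain δ tag).OK k I α R δ ρ := by
  have : α 1 (ρ 0) - 1 ≤ R := by omega
  simp +contextual [chain, givens, cnot, Circ.OK, Step.operands, HExpr.OK, scalar,
    wireE, HExpr.eval, this, hδ]

theorem fourierState_ok (hp : α 1 (ρ 0) ≤ R) : fourierState.OK k I α R 2 ρ := by
  simp +contextual [fourierState, chain_ok, Circ.OK, Step.operands, HExpr.OK, scalar, oneE,
    wireE, HExpr.eval, hp]

theorem fourierDigit_ok (hn : α 0 0 ≤ R) (hp : ∀ l < α 0 0, α 1 l ≤ R) (h0 : ρ 0 < α 0 0) :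
    fourierDigit.OK k I α R 1 ρ := by
  simp +contextual [fourierDigit, digitPhases, crossPhases, crossE, orderE, erase, cnot,
    chain_ok, fourierState_ok, Circ.OK, Step.operands, HExpr.OK, scalar, oneE,
    wireE, HExpr.eval, hp, h0, hn, Function.update]

theorem ladder_ok (hN : α 0 4 ≤ R) : ladder.OK k I α R 0 ρ := by
  simp [ladder, Circ.OK, Step.operands, HExpr.OK, HExpr.eval, scalar, hN]

theorem sampler_ok (hn : α 0 0 ≤ R) (hK : α 0 1 ≤ R) (hp : ∀ l < α 0 0, α 1 l ≤ R) :
    sampler.OK k I α R 0 ρ := by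
  have h1 : (toBinary 0 2 (.arr 0 (.lit 1))).OK k I α R 0 ρ :=
    toBinary_ok hn hK hp (by omega) fun _ => ⟨by omega, trivial⟩
  have h1' : (toBinary 1 3 (.lit 0)).OK k I α R 0 ρ :=
    toBinary_ok hn hK hp (by omega) fun _ => trivial
  have h2 : ∀ {ρ}, ρ 0 < α 0 0 → fourierDigit.OK k I α R 1 ρ := fourierDigit_ok hn hp
  simp +contextual [sampler, prepare, oracle, fourier, adjust, finish, testZero, cnot, flagE, goodE,
    h1, h1', h2, chain_ok, Circ.OK, Step.operands, HExpr.OK, HExpr.eval, scalar, oneE, wireE, hn, hp]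

theorem algorithm_ok (hn : α 0 0 ≤ R) (hK : α 0 1 ≤ R) (hN : α 0 4 ≤ R)
    (hp : ∀ l < α 0 0, α 1 l ≤ R) : algorithm.OK k I α R 0 ρ := by
  have h1 : sampler.OK k I α R 0 ρ := sampler_ok hn hK hp
  have h2 : ladder.OK k I α R 0 ρ := ladder_ok hN
  simp [algorithm, mark, reflectZero, goodE, h1, h2, Circ.OK, Step.operands, HExpr.OK, scalar, oneE,
    wireE]

end

end QAlg

/-! ### The complete program and its running time. -/

namespace QAlg

/-- The program: the classical part followed by the quantum part. -/
def program : Prog := .seq preprocess (algorithm.compile true 0)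

/-- The factor in the time bound that does not depend on the input. -/
def programConstant : ℕ := (1 + algorithm.length) * (program.weight + 1)

/-- The bound for the number of wires and for the bit lengths of all numbers, as a function of the
logarithm of the order of the group and of a bound for its prime factors. -/
def sizeBound (n P : ℕ) : ℕ := 32 * (n + P + 2) ^ 3

theorem wireBound_le {k n P : ℕ} (hk : k ≤ n) :
    wireBound n (n + 1) (k * (n + 1)) P ≤ sizeBound n P := by
  have h : k * (n + 1) ≤ n * (n + 1) := Nat.mul_le_mul_right _ hk
  have h2 : (n + 1) * (k * (n + 1) + 2 + n * P) ≤ (n + 1) * (n * (n + 1) + 2 + n * P) :=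
    Nat.mul_le_mul_left _ (by omega)
  unfold wireBound sizeBound
  refine (show _ ≤ 2 * (n * (n + 1)) + (n + 1) + 16 * ((n + 1) * (n * (n + 1) + 2 + n * P)) by
    omega).trans ?_
  ring_nf
  nlinarith [Nat.zero_le (n * P), Nat.zero_le (n ^ 2 * P), Nat.zero_le (n * P ^ 2),
    Nat.zero_le (P ^ 2), Nat.zero_le (P ^ 3), Nat.zero_le (n ^ 3)]

theorem preprocess_steps_le {k n P : ℕ} (hk : k ≤ n) :
    15 + k * 3 + (n + 1) * 3 + k * (n + 1) * 4 + k * (6 + (P + 1 + n) * 10) ≤ sizeBound n P := by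
  have h1 : k * (n + 1) ≤ n * (n + 1) := Nat.mul_le_mul_right _ hk
  have h2 : k * (6 + (P + 1 + n) * 10) ≤ n * (6 + (P + 1 + n) * 10) := Nat.mul_le_mul_right _ hk
  unfold sizeBound
  refine (show _ ≤ 15 + n * 3 + (n + 1) * 3 + n * (n + 1) * 4 + n * (6 + (P + 1 + n) * 10) by
    omega).trans ?_
  ring_nf
  nlinarith [Nat.zero_le (n * P), Nat.zero_le (n ^ 2 * P), Nat.zero_le (n * P ^ 2),
    Nat.zero_le (P ^ 2), Nat.zero_le (P ^ 3), Nat.zero_le (n ^ 3)]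

/-- The bound for the running time. -/
noncomputable def timeBound (s : Polynomial ℕ) : MvPolynomial (Fin 2) ℕ :=
  MvPolynomial.C programConstant *
    (32 * (MvPolynomial.X 0 + s.eval₂ MvPolynomial.C (MvPolynomial.X 0) + 2) ^ 3 + 1) ^
      (algorithm.depth + 2) * (MvPolynomial.X 1 + 1)

theorem eval_timeBound (s : Polynomial ℕ) (n T : ℕ) :
    MvPolynomial.eval ![n, T] (timeBound s) =
      programConstant * (sizeBound n (s.eval n) + 1) ^ (algorithm.depth + 2) * (T + 1) := by
  have h : MvPolynomial.eval ![n, T] (s.eval₂ MvPolynomial.C (MvPolynomial.X 0)) = s.eval n := by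
    rw [Polynomial.hom_eval₂, MvPolynomial.eval_X, Polynomial.eval,
      Subsingleton.elim ((MvPolynomial.eval ![n, T]).comp MvPolynomial.C) (RingHom.id ℕ)]
    rfl
  simp [timeBound, h, sizeBound]

theorem rep_inputMem {k : ℕ} (M : Fin k → ℕ) (r : ℕ) :
    Rep k (inputMem M r) (inputMem M r) (fun _ _ => 0) (fun _ => 0) 0 where
  inp _ _ := rfl
  arr a _ i := by
    rw [show k + 2 + 8 * i + a = (k + 8 * i + a) + 2 by omega]
    exact dif_neg (by omega)
  ctr j hj := absurd hj (Nat.not_lt_zero j)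

theorem inputMem_lt {k : ℕ} {M : Fin k → ℕ} {r N : ℕ} (hk : k < N) (hr : r < N)
    (hM : ∀ i, M i < N) (x : ℕ) : inputMem M r x < N := by
  match x with
  | 0 => exact hk
  | 1 => exact hr
  | j + 2 =>
    change (if h : j < k then M ⟨j, h⟩ else 0) < N
    split_ifs
    · exact hM _
    · omega

/-- The orders of the cyclic factors, as a function on the natural numbers. -/
def orders {k : ℕ} (M : Fin k → ℕ) (r : ℕ) (i : ℕ) : ℕ := inputMem M r (2 + i)

theorem orders_fin {k : ℕ} (M : Fin k → ℕ) (r : ℕ) (i : Fin k) : orders M r i = M i := by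
  rw [orders, add_comm]
  exact dif_pos i.2

/-- The number of steps is multiplied by a uniform bound for the cost of one step. Two extra powers
of `b + 1` absorb the preprocessing steps and the bit length of the numbers. -/
theorem time_le {b d c w T s₁ s₂ : ℕ} (h1 : s₁ ≤ b) (h2 : s₂ ≤ c * (b + 1) ^ d) :
    (s₁ + s₂) * (w * (b + 1) + T) ≤ (1 + c) * (w + 1) * (b + 1) ^ (d + 2) * (T + 1) := by
  have h3 : s₁ + s₂ ≤ (1 + c) * (b + 1) ^ (d + 1) := by
    have h4 : b + 1 ≤ (b + 1) ^ (d + 1) := Nat.le_self_pow (by omega) _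
    have h5 : (b + 1) ^ d ≤ (b + 1) ^ (d + 1) := Nat.pow_le_pow_right (by omega) (by omega)
    nlinarith [Nat.mul_le_mul_left c h5]
  have h6 : w * (b + 1) + T ≤ (w + 1) * (b + 1) * (T + 1) := by
    nlinarith [Nat.zero_le (w * b * T), Nat.zero_le (w * T), Nat.zero_le (b * T)]
  refine (Nat.mul_le_mul h3 h6).trans (le_of_eq ?_)
  ring

/-- One quantity `b` bounds everything: the steps of the preprocessing, all loop bounds of the
circuit, and the bit lengths of the stored numbers. It is polynomial in the logarithm of the order
and in the bound `P` for the prime factors. -/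
theorem exec_program {k : ℕ} {M : Fin k → ℕ} {r m P : ℕ} (hM : ∀ i, 2 ≤ M i)
    (hm : ∏ i, M i = m) (hP : ∀ q, q.Prime → q ∣ m → q ≤ P) (hr : r ≤ m) (T : ℕ) :
    ∃ (α : ℕ → ℕ → ℕ) (σ : Mem) (t : ℕ), Digits α k (width M) (orders M r) ∧
      Exec T program (inputMem M r) σ (algorithm.gates (inputMem M r) α true 0 fun _ => 0) t ∧
      t ≤ programConstant * (sizeBound (Nat.log 2 m) P + 1) ^ (algorithm.depth + 2) * (T + 1) := by
  set b := sizeBound (Nat.log 2 m) P with hb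
  have hM' : ∀ i < k, 2 ≤ orders M r i := fun i hi => by
    rw [show i = ((⟨i, hi⟩ : Fin k) : ℕ) from rfl, orders_fin]
    exact hM _
  have hm' : ∏ i ∈ Finset.range k, orders M r i = m := by
    rw [Finset.prod_range, ← hm]
    exact Finset.prod_congr rfl fun i _ => orders_fin M r i
  obtain ⟨hk, hkm⟩ := lt_of_two_le_prod hM' hm'
  have hm0 : m ≠ 0 := by omega
  have hL : Nat.size m = Nat.log 2 m + 1 := by
    refine le_antisymm (Nat.size_le.2 (Nat.lt_pow_succ_log_self (by omega) m))
      (Nat.lt_size.2 (Nat.pow_log_le_self 2 hm0))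
  have hw : width M = Nat.log 2 m + 1 := by rw [width, hm, hL]
  have hb1 : Nat.log 2 m + 1 ≤ b ∧ P ≤ b := by
    have : Nat.log 2 m + P + 2 ≤ (Nat.log 2 m + P + 2) ^ 3 := Nat.le_self_pow (by omega) _
    rw [hb, sizeBound]
    omega
  have hN := wireBound_le (P := P) hk
  rw [← hb] at hN
  have hbb : b < 2 ^ b := Nat.lt_two_pow_self
  have hKN : k * (Nat.log 2 m + 1) < wireBound (Nat.log 2 m) (Nat.log 2 m + 1)
      (k * (Nat.log 2 m + 1)) P := by
    unfold wireBound; omega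
  have hmb : m < 2 ^ b := (Nat.lt_pow_succ_log_self (by omega) m).trans_le
    (Nat.pow_le_pow_right (by omega) hb1.1)
  obtain ⟨α, h1, h2, h3⟩ := runs_preprocess (α := fun _ _ => 0) (B := b) (I := inputMem M r)
    (L := Nat.log 2 m + 1) (P := P) (M := orders M r)
    (show inputMem M r 0 = k from rfl) (fun i _ => rfl) hM' hm' hmb hP (by omega) hL.symm (by omega)
    (by omega)
  have hα := h1.digits h2 hM' hm' hL.symm
  obtain ⟨σ₁, s₁, e1, r1, b1⟩ := h3 _ _ (rep_inputMem M r)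
  have hn := digitCount_le h1.toDigitState (m := m) (by rw [h1.prod, hm'])
  have hok : algorithm.OK k (inputMem M r) α b 0 fun _ => 0 := by
    refine algorithm_ok (by omega) (by rw [h1.total]; omega) ?_ fun l hl => ?_
    · rw [h2]
      refine le_trans ?_ hN
      have := Nat.mul_le_mul (Nat.succ_le_succ hn) (stride_le h1.toDigitState hn)
      simp only [Nat.succ_eq_add_one] at this
      unfold wireBound
      omega
    · have := (h1.radix l hl).2
      omega
  obtain ⟨σ₂, s₂, e2, -, b2⟩ := Circ.exec (B := b) (show inputMem M r 0 = k from rfl) hbb algorithm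
    true 0 _ σ₁ hok r1
  obtain ⟨-, t, ht, hle⟩ := (ExecN.seq e1 e2).exec (T := T) (inputMem_lt (by omega) (by omega)
    fun i => by
      refine lt_of_le_of_lt ?_ hmb
      rw [← orders_fin M r i, ← hm']
      exact le_prod_range hM' i.2) _ le_rfl
  rw [List.nil_append] at ht
  refine ⟨α, σ₂, t, by rw [hw]; exact hα, ht, hle.trans ?_⟩
  exact time_le (b1.trans (preprocess_steps_le hk)) (b2.trans (Circ.count_le _ _))

end QAlg

theorem theorem3 :
    ∃ P : QAlg.Prog, ∀ s : Polynomial ℕ, ∃ τ : MvPolynomial (Fin 2) ℕ,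
      ∀ (G : Type*) [AddCommGroup G] [Finite G] (k : ℕ) (M : Fin k → ℕ) [∀ i, NeZero (M i)]
        (e : G ≃+ ((i : Fin k) → ZMod (M i))) (H : AddSubgroup G) (r : ℕ) (f : G → Fin r)
        (F : (Fin k → ℕ) → ℕ) (T : ℕ),
        (∀ i, 2 ≤ M i) → QAlg.IsSmooth s (Nat.card G) →
        H.index = r → 1 < r →
        (∀ x y : G, f x = f y ↔ x - y ∈ H) →
        (∀ g : G, F (QAlg.coords e g) = (f g : ℕ)) →
        ∃ (σ : QAlg.Mem) (gs : List (QAlg.Gate ℕ)) (t : ℕ),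
          QAlg.Exec T P (QAlg.inputMem M r) σ gs t ∧
          t ≤ MvPolynomial.eval ![Nat.log 2 (Nat.card G), T] τ ∧
          QAlg.prob (QAlg.finalState (QAlg.width M) F gs) (QAlg.correctOutputs e H) = 1 := by
  -- The program does not know the smoothness bound; the polynomial `s` enters only its time
  -- analysis.
  refine ⟨QAlg.program, fun s => ⟨QAlg.timeBound s, ?_⟩⟩
  intro G _ _ k M _ e H r f F T hM hs hH hr hf hF
  have := Fintype.ofFinite G
  have hcard : ∏ i, M i = Nat.card G := by
    rw [Nat.card_congr e.toEquiv, Nat.card_pi]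
    exact (Finset.prod_congr rfl fun i _ => Nat.card_zmod _).symm
  -- Smoothness supplies the bound for the prime factors, with `P` the value of `s`; the index
  -- divides the order of the group, hence `r` is at most the order.
  obtain ⟨α, σ, t, hα, ht, hle⟩ := QAlg.exec_program (r := r) hM hcard hs
    (hH ▸ Nat.le_of_dvd Nat.card_pos H.index_dvd_card) T
  refine ⟨σ, _, t, ht, ?_, ?_⟩
  · rw [QAlg.eval_timeBound]
    exact hle
  · exact QAlg.prob_algorithm hα (fun i => QAlg.orders_fin M r i) rfl rfl hH hr hf hF
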